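/- Graphs are finite and loopless; parallel edges are allowed; $n(G)$ is the number of vertices of $G$. $\Theta$ is the graph with two vertices joined by three parallel edges. Connectivity of multigraphs is measured by internally disjoint paths, parallel edges giving different paths (so $\Theta$ is 3-connected). Let $H=H[A,B]$ be a connected bipartite cubic graph with color classes $A,B$. A pair $(a,b)\in A\times B$ is $\lambda$-matchable if $H$ has a spanning subgraph in which $a$ and $b$ have degree $3$ and every other vertex has degree $1$; $\rho(H)$ is the number of these pairs. A cut $\partial(X)$ of a matching covered graph (a connected graph of order at least two, each of whose edges lies in a perfect matching) is tight if it meets every perfect matching in exactly one edge, and nontrivial if both shores $X,\overline X$ have at least two vertices. The tight cut decomposition procedure replaces a graph that has a nontrivial tight cut $\partial(X)$ by its two contractions, obtained by shrinking $X$, respectively $\overline X$, to a single vertex, and repeats this until no nontrivial tight cut is left; the bipartite graphs of the resulting list are the braces of $H$ (a brace is a bipartite matching covered graph without nontrivial tight cuts). Let $b'(H)$ be the number of braces of $H$ of order at least six, and $\tilde b(H)=\sum (n(K)/2)^2$ over these braces $K$. The 2-cut decomposition procedure replaces a graph that is not 3-connected, with a 2-cut $C$, by its two marked $C$-components (the two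 components of the graph minus $C$, each with a new edge joining its two ends of $C$), and repeats this until all graphs are 3-connected; these are the 3-connected pieces of $H$. Let $\theta(H)$ and $\bar\theta(H)$ be the numbers of 3-connected pieces of $H$ that are, respectively are not, isomorphic to $\Theta$. Splicing $G$ at a vertex $u$ with $G'$ at a vertex $v$ of the same degree, with respect to a bijection $\pi$ between the edges at $u$ and the edges at $v$, means: take the disjoint union of $G-u$ and $G'-v$ and, for each edge $e$ at $u$, join the other end of $e$ to the other end of $\pi(e)$. Let $\mathcal J$ be the family of simple cubic braces. Let $\mathcal K$ be the smallest family of graphs (up to isomorphism) that contains $K_{3,3}$ and, with each $G\in\mathcal K$ and each $v\in V(G)$ for which there are exactly three vertices $w$ with $(v,w)$ $\lambda$-matchable in $G$, every graph obtained by splicing $G$ at $v$ with $K_{3,3}$. Let $\mathcal L$ (respectively $\mathcal K'$) be the family of connected bipartite cubic graphs all of whose 3-connected pieces belong to $\mathcal J\cup\mathcal K\cup\{\Theta\}$ (respectively $\mathcal K\cup\{\Theta\}$). Theorem. Both procedures can be carried out on every connected bipartite cubic graph $H$, and, whichever applications of the two procedures are used to compute $b',\tilde b,\theta,\bar\theta$,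 \[ \rho(H)\ \ge\ \tilde b(H)+3b'(H)-3\bar\theta(H)+\theta(H)\ \ge\ 3n(H)-9\bar\theta(H)-5\theta(H). \] Furthermore, (i) the first inequality holds with equality if and only if $H\in\mathcal L$, and (ii) equality holds throughout if and only if $H\in\mathcal K'$. -/

import Mathlib

open scoped Graph

namespace CubicGraph

variable {α β α' β' : Type*}

/-! ### Basic notions for multigraphs

Multigraphs are Mathlib's `Graph α β`: a vertex set in `α`, an edge set in `β`, and a link relation;
parallel edges are allowed.  All graphs of interest are loopless. -/

/-- The order of a graph. -/
noncomputable def order (G : Graph α β) : ℕ := V(G).ncard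

/-- The degree of `v` in a loopless graph: the number of edges incident with `v`. -/
noncomputable def deg (G : Graph α β) (v : α) : ℕ := (G.incidenceSet v).ncard

/-- `3`-regular graphs. -/
def IsCubic (G : Graph α β) : Prop := ∀ v ∈ V(G), deg G v = 3

/-- A graph is connected if it has a vertex and any two vertices are joined by a walk. -/
def IsConnected (G : Graph α β) : Prop :=
  V(G).Nonempty ∧ ∀ u ∈ V(G), ∀ v ∈ V(G), Relation.ReflTransGen G.Adj u v

/-- `A` and `B` are the color classes of a bipartition of `G`. -/
structure IsBipartition (G : Graph α β) (A B : Set α) : Prop where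
  union_eq : A ∪ B = V(G)
  disjoint : Disjoint A B
  isLink : ∀ e x y, G.IsLink e x y → (x ∈ A ∧ y ∈ B) ∨ (x ∈ B ∧ y ∈ A)

def IsBipartite (G : Graph α β) : Prop := ∃ A B : Set α, IsBipartition G A B

/-- Isomorphism of multigraphs: compatible bijections of the vertex sets and of the edge sets. -/
def Iso (G : Graph α β) (G' : Graph α' β') : Prop :=
  ∃ (f : V(G) ≃ V(G')) (g : E(G) ≃ E(G')), ∀ (e : E(G)) (x y : V(G)),
    G.IsLink e x y ↔ G'.IsLink (g e) (f x) (f y)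

/-- The graph `Θ`: two vertices joined by three parallel edges. -/
def Theta : Graph Bool (Fin 3) := Graph.banana false true Set.univ

/-- The complete bipartite graph `K₃,₃`. -/
def K33 : Graph (Fin 3 ⊕ Fin 3) (Sym2 (Fin 3 ⊕ Fin 3)) :=
  Graph.ofSimpleGraph (completeBipartiteGraph (Fin 3) (Fin 3))

/-- `k`-connectedness of a multigraph, in separator form: there are at least two vertices and no
two distinct vertices `u`, `v` can be separated by deleting fewer than `k` elements, each of them an
edge or a vertex other than `u` and `v`.  By Menger's theorem this says that any two distinct
vertices are joined by `k` internally disjoint paths, where parallel edges count as different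
paths; in particular `Θ` is `3`-connected. -/
def IsKConnected (k : ℕ) (G : Graph α β) : Prop :=
  V(G).Nontrivial ∧ ∀ u ∈ V(G), ∀ v ∈ V(G), u ≠ v →
    ∀ (S : Finset α) (F : Finset β), u ∉ S → v ∉ S → S.card + F.card < k →
      Relation.ReflTransGen ((G.deleteVerts (S : Set α)).deleteEdges (F : Set β)).Adj u v

/-! ### Matchings and `λ`-matchable pairs -/

/-- `M` is (the edge set of) a perfect matching of `G`: a `1`-regular spanning subgraph. -/
def IsPerfectMatching (G : Graph α β) (M : Set β) : Prop :=
  M ⊆ E(G) ∧ ∀ v ∈ V(G), deg (G.restrict M) v = 1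

/-- `M` is (the edge set of) an `(a, b)`-matching of `G`: a spanning subgraph in which `a` and `b`
have degree three and every other vertex has degree one. -/
def IsPairMatching (G : Graph α β) (a b : α) (M : Set β) : Prop :=
  M ⊆ E(G) ∧ deg (G.restrict M) a = 3 ∧ deg (G.restrict M) b = 3 ∧
    ∀ v ∈ V(G), v ≠ a → v ≠ b → deg (G.restrict M) v = 1

/-- The pair `(a, b)` is `λ`-matchable in `G`. -/
def IsLambdaMatchablePair (G : Graph α β) (a b : α) : Prop :=
  ∃ M, IsPairMatching G a b M

/-- `ρ(H)` for a bipartite graph `H[A, B]`: the number of `λ`-matchable pairs `(a, b)` with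
`a ∈ A` and `b ∈ B`. -/
noncomputable def rho (H : Graph α β) (A B : Set α) : ℕ :=
  {p : α × α | p.1 ∈ A ∧ p.2 ∈ B ∧ IsLambdaMatchablePair H p.1 p.2}.ncard

/-- The number of vertices `v` such that the pair `(u, v)` is `λ`-matchable in `H`. -/
noncomputable def numPartners (H : Graph α β) (u : α) : ℕ :=
  {v ∈ V(H) | v ≠ u ∧ IsLambdaMatchablePair H u v}.ncard

/-- A matching covered graph: connected, of order two or more, each edge in a perfect matching. -/
def IsMatchingCovered (G : Graph α β) : Prop :=
  IsConnected G ∧ 2 ≤ order G ∧ ∀ e ∈ E(G), ∃ M, IsPerfectMatching G M ∧ e ∈ M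

/-! ### Tight cuts and the tight cut decomposition procedure -/

/-- The cut `∂(X)`: the edges with one end in `X` and the other end outside `X`. -/
def cut (G : Graph α β) (X : Set α) : Set β := {e | ∃ x y, G.IsLink e x y ∧ x ∈ X ∧ y ∉ X}

/-- The cut `∂(X)` is tight: it has exactly one edge in common with every perfect matching. -/
def IsTightCut (G : Graph α β) (X : Set α) : Prop :=
  X ⊆ V(G) ∧ ∀ M, IsPerfectMatching G M → (cut G X ∩ M).ncard = 1

/-- The cut `∂(X)` is tight and nontrivial, that is, both shores have at least two vertices. -/
def IsNontrivialTightCut (G : Graph α β) (X : Set α) : Prop :=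
  IsTightCut G X ∧ X.Nontrivial ∧ (V(G) \ X).Nontrivial

open Classical in
/-- The graph `G / X → x` obtained by shrinking `X` into a single vertex: the edges inside `X` are
deleted and all vertices of `X` are identified.  A vertex `x ∈ X` serves as the name of the
contraction vertex; up to isomorphism this choice does not matter. -/
noncomputable def contract (G : Graph α β) (X : Set α) (x : α) : Graph α β :=
  (G.deleteEdges {e | ∃ y z, G.IsLink e y z ∧ y ∈ X ∧ z ∈ X}).map (fun v => if v ∈ X then x else v)

/-- `IsTightCutDecomposition G L`: the multiset `L` is the outcome of an application of the tight
cut decomposition procedure to `G`. -/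
inductive IsTightCutDecomposition : Graph α β → Multiset (Graph α β) → Prop
  | leaf (G : Graph α β) (h : ∀ X, ¬ IsNontrivialTightCut G X) : IsTightCutDecomposition G {G}
  | step (G : Graph α β) (X : Set α) (x y : α) (L₁ L₂ : Multiset (Graph α β))
      (hX : IsNontrivialTightCut G X) (hx : x ∈ X) (hy : y ∈ V(G) \ X)
      (h₁ : IsTightCutDecomposition (contract G X x) L₁)
      (h₂ : IsTightCutDecomposition (contract G (V(G) \ X) y) L₂) :
      IsTightCutDecomposition G (L₁ + L₂)

/-- A brace: a bipartite matching covered graph without nontrivial tight cuts. -/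
def IsBrace (G : Graph α β) : Prop :=
  IsMatchingCovered G ∧ IsBipartite G ∧ ∀ X, ¬ IsNontrivialTightCut G X

open Classical in
/-- The braces of order six or more in a list of graphs. -/
noncomputable def largeBraces (L : Multiset (Graph α β)) : Multiset (Graph α β) :=
  L.filter (fun G => IsBrace G ∧ 6 ≤ order G)

/-- `b'`: the number of braces of order six or more. -/
noncomputable def bPrime (L : Multiset (Graph α β)) : ℕ := (largeBraces L).card

/-- `b̃`: the sum of `(n / 2) ^ 2` over the braces of order `n ≥ 6`. -/
noncomputable def bTilde (L : Multiset (Graph α β)) : ℚ :=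
  ((largeBraces L).map (fun G => ((order G : ℚ) / 2) ^ 2)).sum

/-! ### The `2`-cut decomposition procedure -/

/-- Add to `G` an edge with label `e` (in applications not yet in use) and ends `x`, `y`. -/
def addEdge (G : Graph α β) (e : β) (x y : α) : Graph α β where
  vertexSet := V(G) ∪ {x, y}
  IsLink f u v := (f = e ∧ ((u = x ∧ v = y) ∨ (u = y ∧ v = x))) ∨ (f ≠ e ∧ G.IsLink f u v)
  isLink_symm := by
    intro f _
    refine ⟨fun u v h => ?_⟩
    rcases h with ⟨h, h'⟩ | ⟨h, h'⟩
    · exact Or.inl ⟨h, by tauto⟩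
    · exact Or.inr ⟨h, h'.symm⟩
  eq_or_eq_of_isLink_of_isLink := by
    rintro f u v w z (⟨h, h'⟩ | ⟨h, h'⟩) (⟨k, k'⟩ | ⟨k, k'⟩)
    · grind
    · exact absurd h k
    · exact absurd k h
    · exact h'.left_eq_or_eq k'
  left_mem_of_isLink := by
    rintro f u v (⟨h, h'⟩ | ⟨h, h'⟩)
    · simp only [Set.mem_union, Set.mem_insert_iff, Set.mem_singleton_iff]; tauto
    · exact Or.inl h'.left_mem

/-- `IsTwoCutDecomposition G L`: the multiset `L` is the outcome of an application of the `2`-cut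
decomposition procedure to `G`.  In a step, `{e, f}` is a `2`-cut `∂(X)` with `e` joining `x ∈ X`
to `y ∉ X` and `f` joining `x' ∈ X` to `y' ∉ X`; the marked components are `G[X]` with a new edge
joining `x` and `x'`, and `G[V(G) \ X]` with a new edge joining `y` and `y'`.  The label `e` is
reused for the new edges. -/
inductive IsTwoCutDecomposition : Graph α β → Multiset (Graph α β) → Prop
  | leaf (G : Graph α β) (h : IsKConnected 3 G) : IsTwoCutDecomposition G {G}
  | step (G : Graph α β) (X : Set α) (e f : β) (x y x' y' : α) (L₁ L₂ : Multiset (Graph α β))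
      (hG : ¬ IsKConnected 3 G) (hX : X ⊆ V(G)) (hef : e ≠ f) (hcut : cut G X = {e, f})
      (he : G.IsLink e x y) (hx : x ∈ X) (hy : y ∉ X)
      (hf : G.IsLink f x' y') (hx' : x' ∈ X) (hy' : y' ∉ X)
      (h₁ : IsTwoCutDecomposition (addEdge (G.induce X) e x x') L₁)
      (h₂ : IsTwoCutDecomposition (addEdge (G.induce (V(G) \ X)) e y y') L₂) :
      IsTwoCutDecomposition G (L₁ + L₂)

open Classical in
/-- `θ`: the number of graphs in the list that are isomorphic to `Θ`. -/
noncomputable def theta (L : Multiset (Graph α β)) : ℕ := L.countP (fun G => Iso G Theta)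

open Classical in
/-- `θ̄`: the number of graphs in the list that are not isomorphic to `Θ`. -/
noncomputable def thetaBar (L : Multiset (Graph α β)) : ℕ := L.countP (fun G => ¬ Iso G Theta)

/-! ### Splicing and the families of tight examples -/

/-- The graph obtained from `G - u` and `H - v` by adding, for each edge `e` of `G` at `u`, an edge
joining the end of `e` other than `u` to the end of `π e` other than `v`. -/
def splice (G : Graph α β) (u : α) (H : Graph α' β') (v : α') (π : β → β') :
    Graph (α ⊕ α') (β ⊕ β') where
  vertexSet := Sum.inl '' (V(G) \ {u}) ∪ Sum.inr '' (V(H) \ {v})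
  IsLink
    | Sum.inl e, Sum.inl x, Sum.inl y => G.IsLink e x y ∧ x ≠ u ∧ y ≠ u
    | Sum.inl e, Sum.inl x, Sum.inr y => G.IsLink e u x ∧ H.IsLink (π e) v y ∧ x ≠ u ∧ y ≠ v
    | Sum.inl e, Sum.inr y, Sum.inl x => G.IsLink e u x ∧ H.IsLink (π e) v y ∧ x ≠ u ∧ y ≠ v
    | Sum.inr f, Sum.inr x, Sum.inr y => H.IsLink f x y ∧ x ≠ v ∧ y ≠ v
    | _, _, _ => False
  isLink_symm := by
    rintro (e | e) - <;> refine ⟨?_⟩ <;> rintro (x | x) (y | y) h <;>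
      simp only at h ⊢ <;> first | exact h | exact ⟨h.1.symm, h.2.2, h.2.1⟩
  eq_or_eq_of_isLink_of_isLink := by
    rintro (e | e) (x | x) (y | y) (z | z) (w | w) h h' <;>
      simp only [Sum.inl.injEq, Sum.inr.injEq, reduceCtorEq, or_false, false_or] at h h' ⊢
    all_goals first
      | exact h.elim
      | exact h'.elim
      | exact h.1.left_eq_or_eq h'.1
      | exact h.1.right_unique h'.1
      | exact h.2.1.right_unique h'.2.1
      | (rcases h.1.left_eq_or_eq h'.1 with k | k <;> simp_all)
  left_mem_of_isLink := by
    rintro (e | e) (x | x) (y | y) h <;> simp only at h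
    all_goals first
      | exact h.elim
      | exact Or.inl ⟨x, ⟨h.1.left_mem, h.2.1⟩, rfl⟩
      | exact Or.inl ⟨x, ⟨h.1.right_mem, h.2.2.1⟩, rfl⟩
      | exact Or.inr ⟨x, ⟨h.2.1.right_mem, h.2.2.2⟩, rfl⟩
      | exact Or.inr ⟨x, ⟨h.1.left_mem, h.2.1⟩, rfl⟩

/-- `J` is, up to isomorphism, obtained by splicing `G` at `u` with `H` at `v` with respect to some
bijection between the edges of `G` at `u` and the edges of `H` at `v`. -/
def IsSplicing {α₀ β₀ : Type*} (J : Graph α₀ β₀) (G : Graph α β) (u : α) (H : Graph α' β')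
    (v : α') : Prop :=
  u ∈ V(G) ∧ v ∈ V(H) ∧ ∃ π : β → β', Set.BijOn π (G.incidenceSet u) (H.incidenceSet v) ∧
    Iso J (splice G u H v π)

/-- The family `𝓙` of simple cubic braces. -/
def InJ (G : Graph α β) : Prop := G.Simple ∧ IsCubic G ∧ IsBrace G

/-- The family `𝓚`: it contains `K₃,₃`, and it contains every splicing of a member `G` at `v` with
`K₃,₃` whenever exactly three pairs `(v, w)` are `λ`-matchable in `G`.  (Since `G` has fewer vertices
and edges than the splicing `J`, it is no restriction to take `G` over the same types as `J`.) -/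
inductive InK : Graph α β → Prop
  | base (G : Graph α β) (h : Iso G K33) : InK G
  | splice (J G : Graph α β) (v : α) (w : Fin 3 ⊕ Fin 3) (hG : InK G) (hv : numPartners G v = 3)
      (hJ : IsSplicing J G v K33 w) : InK J

/-- The family `𝓛`: finite connected bipartite cubic graphs all of whose `3`-connected pieces
belong to `𝓙 ∪ 𝓚 ∪ {Θ}`. -/
def InL (G : Graph α β) : Prop :=
  V(G).Finite ∧ IsConnected G ∧ IsBipartite G ∧ IsCubic G ∧
    ∃ P, IsTwoCutDecomposition G P ∧ ∀ Q ∈ P, InJ Q ∨ InK Q ∨ Iso Q Theta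

/-- The family `𝓚'`: finite connected bipartite cubic graphs all of whose `3`-connected pieces
belong to `𝓚 ∪ {Θ}`. -/
def InKPrime (G : Graph α β) : Prop :=
  V(G).Finite ∧ IsConnected G ∧ IsBipartite G ∧ IsCubic G ∧
    ∃ P, IsTwoCutDecomposition G P ∧ ∀ Q ∈ P, InK Q ∨ Iso Q Theta

end CubicGraph

open CubicGraph

/-! Everything rests on one count. In a cubic graph with color classes A and B, counting edge ends
in a set X shows that the numbers of edges leaving X from A and from B differ by 3(|A ∩ X| − |B ∩
X|) (`Rep.excess`). Hence there are no bridges, the two edges of a 2-cut leave X from different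
colors, and the three edges of a 3-cut leave X from the same color. As the edge set splits into
three perfect matchings, the tight cuts are exactly the 3-cuts (`Rep.isTightCut_iff`), and both
contractions at a tight cut are connected, bipartite and cubic again.

Give a brace of order n ≥ 6 the weight (n/2)² + 3 and every other brace the weight 0, so that b̃ +
3b' is the total weight of a tight cut decomposition. An uncrossing argument shows that this total,
`tv G`, does not depend on the decomposition (`uniqueBelow`). It is therefore additive over the two
contractions at any nontrivial tight cut.

Cutting and gluing matchings along a tight cut gives ρ(G) = ρ(G₁) + ρ(G₂) − p − q + pq, where G₁, G₂
are the contractions and p, q are the numbers of partners of their contraction vertices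
(`Rep.rho_step`). So the slack `gap` = ρ + 3 − tv satisfies gap G = gap G₁ + gap G₂ + (p − 1)(q − 1)
− 4. In a 3-connected graph of order greater than two every vertex has at least three partners, and
by Hall's theorem all pairs of a simple cubic brace are λ-matchable, so that braces have gap 0;
hence the gap is never negative. The quantity tv − (3n − 6) is additive too and equals (n/2 − 3)² on
a brace, which gives the second inequality. If the gap is 0 then p = q = 3 at every nontrivial tight
cut. Shrinking the complement of a smallest shore then leaves a brace with three partners per
vertex, which is K₃,₃, and peeling these off one by one exhibits a member of 𝓚 (`Piece.inK_of_gap`).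

For 2-cuts, moving one end of a cut edge to the other shore produces a 3-cut, and the marked
component is a contraction at it (`IsTwoCut.addEdge_eq`). No λ-matchable pair crosses a 2-cut, so ρ,
tv and the order are all additive over marked components. The numbers θ and θ̄ are read off from the
classes of vertices that no cut of at most two edges separates, so they depend on the graph only.
Both slacks of the theorem (`pieceGap`, `pieceGap'`) thus become sums over the 3-connected pieces,
with nonnegative terms that vanish on Θ, and equality is decided piece by piece. -/

namespace CubicGraph

open Finset Relation
open scoped Classical

section Basic

variable {α β α' β' : Type*}

/-! ### Finite connected bipartite cubic graphs with explicit ends -/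

/-- `G` is a connected bipartite cubic graph with color classes `A` and `B` and edge set `E`, and
the edge `e` joins `s e ∈ A` to `t e ∈ B`. -/
structure Rep (G : Graph α β) (A B : Finset α) (E : Finset β) (s t : β → α) : Prop where
  verts : V(G) = ↑A ∪ ↑B
  disj : Disjoint A B
  isLink : ∀ e x y, G.IsLink e x y ↔ e ∈ E ∧ (x = s e ∧ y = t e ∨ x = t e ∧ y = s e)
  smem : ∀ e ∈ E, s e ∈ A
  tmem : ∀ e ∈ E, t e ∈ B
  degA : ∀ v ∈ A, #{e ∈ E | s e = v} = 3
  degB : ∀ v ∈ B, #{e ∈ E | t e = v} = 3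
  nonempty : A.Nonempty
  -- Connectedness in cut form. Unlike walks, this passes to contractions simply by pulling X back
  -- along the vertex map.
  conn : ∀ X : Set α, (∃ u ∈ V(G), u ∈ X) → (∃ u ∈ V(G), u ∉ X) → ∃ e ∈ E, ¬ (s e ∈ X ↔ t e ∈ X)

/-- `M` has degree `d v` at every vertex `v`. -/
def IsFactor (A B : Finset α) (s t : β → α) (M : Finset β) (d : α → ℕ) : Prop :=
  (∀ v ∈ A, #{e ∈ M | s e = v} = d v) ∧ ∀ v ∈ B, #{e ∈ M | t e = v} = d v

lemma card_filter_eq_sum {A : Finset α} {s : β → α} {M : Finset β} (hs : ∀ e ∈ M, s e ∈ A)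
    (X : Set α) : #{e ∈ M | s e ∈ X} = ∑ v ∈ A with v ∈ X, #{e ∈ M | s e = v} := by
  rw [Finset.card_eq_sum_card_fiberwise (f := s) (t := {v ∈ A | v ∈ X})]
  · refine Finset.sum_congr rfl fun v hv => ?_
    congr 1
    ext e
    simp only [Finset.mem_filter] at hv ⊢
    grind
  · intro e he
    simp only [Finset.coe_filter, Set.mem_ofPred_eq] at he ⊢
    exact ⟨hs e he.1, he.2⟩

/-! ### Perfect matchings of regular bipartite multigraphs. -/

/-- Hall's theorem, for perfect matchings of bipartite multigraphs. -/
lemma exists_factor_of_hall {A B : Finset α} {E : Finset β} {s t : β → α}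
    (ht : ∀ e ∈ E, t e ∈ B) (hAB : #A = #B)
    (hall : ∀ S ⊆ A, #S ≤ #({e ∈ E | s e ∈ S}.image t)) :
    ∃ M ⊆ E, (∀ e ∈ M, s e ∈ A) ∧ IsFactor A B s t M 1 := by
  have key := (Finset.all_card_le_biUnion_card_iff_exists_injective
    (fun a : A => {e ∈ E | s e = a}.image t)).1 (by
      intro S
      have h1 := hall (S.image Subtype.val) (by
        intro v hv
        simp only [Finset.mem_image] at hv
        obtain ⟨a, -, rfl⟩ := hv
        exact a.2)
      rw [Finset.card_image_of_injective _ Subtype.val_injective] at h1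
      refine h1.trans (Finset.card_le_card ?_)
      intro b hb
      simp only [Finset.mem_image, Finset.mem_filter, Finset.mem_biUnion] at hb ⊢
      obtain ⟨e, ⟨he, a, ha, hae⟩, rfl⟩ := hb
      exact ⟨a, ha, e, ⟨he, hae.symm⟩, rfl⟩)
  obtain ⟨f, finj, hf⟩ := key
  have hf' : ∀ a : A, ∃ e ∈ E, s e = a ∧ t e = f a := by
    intro a
    have := hf a
    simp only [Finset.mem_image, Finset.mem_filter] at this
    obtain ⟨e, ⟨h1, h2⟩, h3⟩ := this
    exact ⟨e, h1, h2, h3⟩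
  choose g hgE hgs hgt using hf'
  have himg : Finset.univ.image f = B := by
    apply Finset.eq_of_subset_of_card_le
    · intro b hb
      simp only [Finset.mem_image, Finset.mem_univ, true_and] at hb
      obtain ⟨a, rfl⟩ := hb
      rw [← hgt a]
      exact ht _ (hgE a)
    · rw [Finset.card_image_of_injective _ finj]
      simp [hAB]
  refine ⟨Finset.univ.image g, ?_, ?_, ?_, ?_⟩
  · intro e he
    simp only [Finset.mem_image, Finset.mem_univ, true_and] at he
    obtain ⟨a, rfl⟩ := he
    exact hgE a
  · intro e he
    simp only [Finset.mem_image, Finset.mem_univ, true_and] at he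
    obtain ⟨a, rfl⟩ := he
    rw [hgs]; exact a.2
  · intro v hv
    rw [Pi.one_apply, Finset.card_eq_one]
    refine ⟨g ⟨v, hv⟩, ?_⟩
    ext e
    simp only [Finset.mem_filter, Finset.mem_image, Finset.mem_univ, true_and,
      Finset.mem_singleton]
    constructor
    · rintro ⟨⟨a, rfl⟩, h⟩
      congr 1
      apply Subtype.ext
      exact (hgs a).symm.trans h
    · rintro rfl
      exact ⟨⟨_, rfl⟩, hgs _⟩
  · intro v hv
    rw [← himg] at hv
    simp only [Finset.mem_image, Finset.mem_univ, true_and] at hv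
    obtain ⟨a, rfl⟩ := hv
    rw [Pi.one_apply, Finset.card_eq_one]
    refine ⟨g a, ?_⟩
    ext e
    simp only [Finset.mem_filter, Finset.mem_image, Finset.mem_univ, true_and,
      Finset.mem_singleton]
    constructor
    · rintro ⟨⟨a', rfl⟩, h⟩
      congr 1
      apply finj
      rw [← h, hgt]
    · rintro rfl
      exact ⟨⟨_, rfl⟩, hgt _⟩

lemma card_eq_mul_of_regular {A : Finset α} {s : β → α} {M : Finset β} {k : ℕ}
    (hs : ∀ e ∈ M, s e ∈ A) (hA : ∀ v ∈ A, #{e ∈ M | s e = v} = k) : #M = #A * k := by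
  have := card_filter_eq_sum hs Set.univ
  simp only [Set.mem_univ, Finset.filter_true] at this
  rw [this, Finset.sum_congr rfl hA]
  simp

/-- A regular bipartite multigraph has a perfect matching. -/
lemma exists_factor_of_regular {A B : Finset α} {E : Finset β} {s t : β → α} {k : ℕ}
    (hk : 0 < k) (hs : ∀ e ∈ E, s e ∈ A) (ht : ∀ e ∈ E, t e ∈ B)
    (hE : IsFactor A B s t E fun _ => k) : ∃ M ⊆ E, IsFactor A B s t M 1 := by
  have hAB : #A = #B := by
    have h1 := card_eq_mul_of_regular hs hE.1
    have h2 := card_eq_mul_of_regular ht hE.2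
    exact Nat.eq_of_mul_eq_mul_right hk (h1.symm.trans h2)
  obtain ⟨M, hM, -, h⟩ := exists_factor_of_hall (s := s) (E := E) ht hAB (by
    intro S hS
    -- Hall's condition by double counting: the k|S| edges at S end in N(S), and each vertex there
    -- receives at most k of them.
    have h1 : #{e ∈ E | s e ∈ S} = #S * k := by
      apply card_eq_mul_of_regular (s := s)
      · simp
      · intro v hv
        rw [Finset.filter_filter]
        refine Eq.trans ?_ (hE.1 v (hS hv))
        congr 1
        ext e
        simp only [Finset.mem_filter]
        grind
    have h2 : #{e ∈ E | s e ∈ S} ≤ #({e ∈ E | s e ∈ S}.image t) * k := by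
      rw [mul_comm]
      apply Finset.card_le_mul_card_image
      intro b hb
      simp only [Finset.mem_image, Finset.mem_filter] at hb
      obtain ⟨e, ⟨he, -⟩, rfl⟩ := hb
      refine le_trans ?_ (hE.2 _ (ht e he)).le
      apply Finset.card_le_card
      intro e'
      simp only [Finset.mem_filter]
      grind
    rw [h1] at h2
    exact Nat.le_of_mul_le_mul_right h2 hk)
  exact ⟨M, hM, h⟩

lemma IsFactor.sdiff {A B : Finset α} {s t : β → α} {E M : Finset β} {d d' : α → ℕ}
    (hE : IsFactor A B s t E d) (hM : IsFactor A B s t M d') (h : M ⊆ E) :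
    IsFactor A B s t (E \ M) fun v => d v - d' v := by
  have key : ∀ (r : β → α) (v : α), #{e ∈ E \ M | r e = v} = #{e ∈ E | r e = v} - #{e ∈ M | r e = v} := by
    intro r v
    rw [← Finset.card_sdiff_of_subset (Finset.filter_subset_filter _ h)]
    congr 1
    ext e
    simp only [Finset.mem_filter, Finset.mem_sdiff]
    grind
  exact ⟨fun v hv => by rw [key, hE.1 v hv, hM.1 v hv], fun v hv => by rw [key, hE.2 v hv, hM.2 v hv]⟩

namespace Rep

variable {G : Graph α β} {A B : Finset α} {E : Finset β} {s t : β → α}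

/-- The two colors play the same role. Most facts below are proved for one color, or for one shore
of a cut, and carried over by this exchange. -/
lemma symm (h : Rep G A B E s t) : Rep G B A E t s := by
  have hne : B.Nonempty := by
    obtain ⟨a, ha⟩ := h.nonempty
    have := h.degA a ha
    obtain ⟨e, he⟩ := Finset.card_pos.1 (by omega : 0 < #{e ∈ E | s e = a})
    exact ⟨t e, h.tmem e (Finset.mem_filter.1 he).1⟩
  refine ⟨by rw [h.verts, Set.union_comm], h.disj.symm, ?_, h.tmem, h.smem, h.degB, h.degA, hne, ?_⟩
  · intro e x y
    rw [h.isLink]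
    tauto
  · intro X h1 h2
    obtain ⟨e, he, h3⟩ := h.conn X h1 h2
    exact ⟨e, he, fun h4 => h3 h4.symm⟩

lemma mem_edgeSet (h : Rep G A B E s t) {e : β} : e ∈ E(G) ↔ e ∈ E := by
  rw [Graph.edgeSet_eq_setOfPred_exists_isLink]
  simp only [Set.mem_ofPred_eq, h.isLink]
  constructor
  · rintro ⟨x, y, h, -⟩; exact h
  · intro he; exact ⟨s e, t e, he, Or.inl ⟨rfl, rfl⟩⟩

lemma edgeSet (h : Rep G A B E s t) : E(G) = ↑E := by
  ext e; exact h.mem_edgeSet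

lemma mem_verts (h : Rep G A B E s t) {v : α} : v ∈ V(G) ↔ v ∈ A ∨ v ∈ B := by
  rw [h.verts]; simp

lemma inc (h : Rep G A B E s t) {e : β} {v : α} :
    G.Inc e v ↔ e ∈ E ∧ (s e = v ∨ t e = v) := by
  simp only [Graph.Inc, h.isLink]
  grind

lemma link (h : Rep G A B E s t) {e : β} (he : e ∈ E) : G.IsLink e (s e) (t e) :=
  (h.isLink _ _ _).2 ⟨he, Or.inl ⟨rfl, rfl⟩⟩

lemma notMem_B (h : Rep G A B E s t) {v : α} (hv : v ∈ A) : v ∉ B :=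
  Finset.disjoint_left.1 h.disj hv

lemma notMem_A (h : Rep G A B E s t) {v : α} (hv : v ∈ B) : v ∉ A :=
  Finset.disjoint_right.1 h.disj hv

lemma card_eq (h : Rep G A B E s t) : #A = #B := by
  have h1 := card_eq_mul_of_regular h.smem h.degA
  have h2 := card_eq_mul_of_regular h.tmem h.degB
  omega

lemma order_eq (h : Rep G A B E s t) : order G = 2 * #A := by
  rw [order, h.verts, ← Finset.coe_union, Set.ncard_coe_finset, Finset.card_union_of_disjoint h.disj,
    ← h.card_eq]
  omega

lemma order_pos (h : Rep G A B E s t) : 2 ≤ order G := by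
  have := Finset.card_pos.2 h.nonempty
  rw [h.order_eq]; omega

lemma finite (h : Rep G A B E s t) : V(G).Finite := by
  rw [h.verts, ← Finset.coe_union]; exact Finset.finite_toSet _

lemma deg_restrict (h : Rep G A B E s t) {M : Finset β} (hM : M ⊆ E) {v : α} (hv : v ∈ A) :
    deg (G.restrict ↑M) v = #{e ∈ M | s e = v} := by
  rw [deg, ← Set.ncard_coe_finset]
  congr 1
  ext e
  simp only [Graph.mem_incidenceSet, Graph.restrict_inc, h.inc, Finset.coe_filter,
    Set.mem_ofPred_eq, Finset.mem_coe]
  constructor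
  · rintro ⟨⟨he, h1 | h1⟩, h2⟩
    · exact ⟨h2, h1⟩
    · exact absurd (h.tmem e he) (h1 ▸ h.notMem_B hv)
  · rintro ⟨h1, h2⟩
    exact ⟨⟨hM h1, Or.inl h2⟩, h1⟩

lemma deg_eq (h : Rep G A B E s t) {v : α} (hv : v ∈ V(G)) : deg G v = 3 := by
  have : G = G.restrict (E : Set β) := by
    rw [eq_comm, Graph.restrict_eq_self_iff, h.edgeSet]
  rw [this]
  rcases h.mem_verts.1 hv with hv | hv
  · rw [h.deg_restrict subset_rfl hv, h.degA v hv]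
  · rw [h.symm.deg_restrict subset_rfl hv, h.degB v hv]

lemma isCubic (h : Rep G A B E s t) : IsCubic G := fun _ hv => h.deg_eq hv

lemma isBipartition (h : Rep G A B E s t) : IsBipartition G ↑A ↑B where
  union_eq := h.verts.symm
  disjoint := by exact_mod_cast h.disj
  isLink e x y hl := by
    obtain ⟨he, ⟨rfl, rfl⟩ | ⟨rfl, rfl⟩⟩ := (h.isLink _ _ _).1 hl
    · exact Or.inl ⟨h.smem e he, h.tmem e he⟩
    · exact Or.inr ⟨h.tmem e he, h.smem e he⟩

lemma isConnected (h : Rep G A B E s t) : IsConnected G := by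
  refine ⟨⟨_, h.mem_verts.2 (Or.inl h.nonempty.choose_spec)⟩, fun u hu v hv => ?_⟩
  by_contra hcon
  obtain ⟨e, he, h1⟩ := h.conn {w | ReflTransGen G.Adj u w} ⟨u, hu, ReflTransGen.refl⟩ ⟨v, hv, hcon⟩
  apply h1
  exact ⟨fun h2 => h2.tail ⟨e, h.link he⟩, fun h2 => h2.tail ⟨e, (h.link he).symm⟩⟩

lemma factor_three (h : Rep G A B E s t) : IsFactor A B s t E fun _ => 3 := ⟨h.degA, h.degB⟩

/-- Degree count over a set `X` of vertices. -/
lemma factor_count (h : Rep G A B E s t) {M : Finset β} (hM : M ⊆ E) {d : α → ℕ}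
    (hd : IsFactor A B s t M d) (X : Set α) :
    (∑ v ∈ A with v ∈ X, d v) + #{e ∈ M | s e ∉ X ∧ t e ∈ X} =
      (∑ v ∈ B with v ∈ X, d v) + #{e ∈ M | s e ∈ X ∧ t e ∉ X} := by
  have h1 : ∑ v ∈ A with v ∈ X, d v = #{e ∈ M | s e ∈ X} := by
    rw [card_filter_eq_sum fun e he => h.smem e (hM he)]
    exact Finset.sum_congr rfl fun v hv => (hd.1 v (Finset.mem_filter.1 hv).1).symm
  have h2 : ∑ v ∈ B with v ∈ X, d v = #{e ∈ M | t e ∈ X} := by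
    rw [card_filter_eq_sum fun e he => h.tmem e (hM he)]
    exact Finset.sum_congr rfl fun v hv => (hd.2 v (Finset.mem_filter.1 hv).1).symm
  have h3 : #{e ∈ M | s e ∈ X} = #{e ∈ M | s e ∈ X ∧ t e ∈ X} + #{e ∈ M | s e ∈ X ∧ t e ∉ X} := by
    rw [← Finset.filter_filter, ← Finset.filter_filter, Finset.card_filter_add_card_filter_not]
  have h4 : #{e ∈ M | t e ∈ X} = #{e ∈ M | s e ∈ X ∧ t e ∈ X} + #{e ∈ M | s e ∉ X ∧ t e ∈ X} := by
    simp only [and_comm (b := t _ ∈ X)]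
    rw [← Finset.filter_filter, ← Finset.filter_filter, Finset.card_filter_add_card_filter_not]
  omega

end Rep

/-- Finite connected bipartite cubic graphs. -/
def Cub (G : Graph α β) : Prop := ∃ A B E s t, Rep G A B E s t

/-- The entry point: finiteness of the edge set is not assumed and follows from cubicity, and the
bipartition orients every edge from A to B. -/
lemma exists_rep {G : Graph α β} {A B : Set α} (hfin : V(G).Finite) (hconn : IsConnected G)
    (hcubic : IsCubic G) (hbip : IsBipartition G A B) :
    ∃ (A' B' : Finset α) (E : Finset β) (s t : β → α), ↑A' = A ∧ ↑B' = B ∧ Rep G A' B' E s t := by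
  have hEfin : E(G).Finite := by
    have : E(G) ⊆ ⋃ v ∈ V(G), G.incidenceSet v := by
      intro e he
      obtain ⟨x, y, h⟩ := Graph.exists_isLink_of_mem_edgeSet he
      simp only [Set.mem_iUnion]
      exact ⟨x, h.left_mem, h.inc_left⟩
    refine (hfin.biUnion fun v hv => ?_).subset this
    -- `Set.ncard` is 0 on infinite sets, so degree 3 forces each incidence set to be finite.
    apply Set.finite_of_ncard_ne_zero
    have := hcubic v hv
    rw [deg] at this
    omega
  have hAfin : A.Finite := hfin.subset (by rw [← hbip.union_eq]; exact Set.subset_union_left)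
  have hBfin : B.Finite := hfin.subset (by rw [← hbip.union_eq]; exact Set.subset_union_right)
  have hends : ∀ e, ∃ x y, e ∈ E(G) → G.IsLink e x y ∧ x ∈ A ∧ y ∈ B := by
    intro e
    by_cases he : e ∈ E(G)
    · obtain ⟨x, y, h⟩ := Graph.exists_isLink_of_mem_edgeSet he
      rcases hbip.isLink e x y h with h' | h'
      · exact ⟨x, y, fun _ => ⟨h, h'.1, h'.2⟩⟩
      · exact ⟨y, x, fun _ => ⟨h.symm, h'.2, h'.1⟩⟩
    · obtain ⟨v, hv⟩ := hconn.1
      -- Labels that are not edges get an arbitrary vertex as both ends.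
      exact ⟨v, v, fun h => absurd h he⟩
  choose s t hst using hends
  have hdisj := hbip.disjoint
  have hl : ∀ e x y, G.IsLink e x y ↔ e ∈ hEfin.toFinset ∧ (x = s e ∧ y = t e ∨ x = t e ∧ y = s e) := by
    intro e x y
    rw [Set.Finite.mem_toFinset]
    constructor
    · intro h
      exact ⟨h.edge_mem, h.eq_and_eq_or_eq_and_eq (hst e h.edge_mem).1⟩
    · rintro ⟨he, ⟨rfl, rfl⟩ | ⟨rfl, rfl⟩⟩
      · exact (hst e he).1
      · exact (hst e he).1.symm
  have hinc : ∀ e x, G.Inc e x ↔ e ∈ hEfin.toFinset ∧ (s e = x ∨ t e = x) := by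
    intro e x
    simp only [Graph.Inc, hl]
    grind
  have hdegA : ∀ v ∈ A, #{e ∈ hEfin.toFinset | s e = v} = 3 := by
    intro v hv
    rw [← hcubic v (hbip.union_eq ▸ Or.inl hv), deg, ← Set.ncard_coe_finset]
    congr 1
    ext e
    simp only [Finset.coe_filter, Set.mem_ofPred_eq, Graph.mem_incidenceSet, hinc]
    constructor
    · rintro ⟨h1, h2⟩; exact ⟨h1, Or.inl h2⟩
    · rintro ⟨h1, h2 | h2⟩
      · exact ⟨h1, h2⟩
      · exact absurd (h2 ▸ (hst e (by simpa using h1)).2.2) (Set.disjoint_left.1 hdisj hv)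
  have hdegB : ∀ v ∈ B, #{e ∈ hEfin.toFinset | t e = v} = 3 := by
    intro v hv
    rw [← hcubic v (hbip.union_eq ▸ Or.inr hv), deg, ← Set.ncard_coe_finset]
    congr 1
    ext e
    simp only [Finset.coe_filter, Set.mem_ofPred_eq, Graph.mem_incidenceSet, hinc]
    constructor
    · rintro ⟨h1, h2⟩; exact ⟨h1, Or.inr h2⟩
    · rintro ⟨h1, h2 | h2⟩
      · exact absurd (h2 ▸ (hst e (by simpa using h1)).2.1) (Set.disjoint_right.1 hdisj hv)
      · exact ⟨h1, h2⟩
  refine ⟨hAfin.toFinset, hBfin.toFinset, hEfin.toFinset, s, t, by simp, by simp, ?_, ?_, hl,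
    ?_, ?_, ?_, ?_, ?_, ?_⟩
  · simp [hbip.union_eq]
  · rw [← Finset.disjoint_coe]; simpa using hdisj
  · intro e he; simpa using (hst e (by simpa using he)).2.1
  · intro e he; simpa using (hst e (by simpa using he)).2.2
  · intro v hv; exact hdegA v (by simpa using hv)
  · intro v hv; exact hdegB v (by simpa using hv)
  · obtain ⟨v, hv⟩ := hconn.1
    rw [← hbip.union_eq] at hv
    rcases hv with hv | hv
    · exact ⟨v, by simpa using hv⟩
    · have := hdegB v hv
      obtain ⟨e, he⟩ := Finset.card_pos.1 (by omega : 0 < #{e ∈ hEfin.toFinset | t e = v})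
      rw [Finset.mem_filter] at he
      exact ⟨s e, by simpa using (hst e (by simpa using he.1)).2.1⟩
  · rintro X ⟨u, hu, huX⟩ ⟨v, hv, hvX⟩
    by_contra hcon
    push Not at hcon
    have := hconn.2 u hu v hv
    apply hvX
    clear hv hvX
    induction this with
    | refl => exact huX
    | tail _ h ih =>
      obtain ⟨e, he⟩ := h
      obtain ⟨h1, ⟨h2, h3⟩ | ⟨h2, h3⟩⟩ := (hl _ _ _).1 he
      · rw [h3]; exact (hcon e h1).1 (h2 ▸ ih)
      · rw [h3]; exact (hcon e h1).2 (h2 ▸ ih)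

end Basic

section Cuts

variable {α β α' β' : Type*}

/-! ### Cuts -/

/-- All edges of the cut `∂(X)` have their `s`-end in `X`, and there are three of them. -/
def IsOut (E : Finset β) (s t : β → α) (X : Set α) : Prop :=
  (∀ e ∈ E, t e ∈ X → s e ∈ X) ∧ #{e ∈ E | s e ∈ X ∧ t e ∉ X} = 3

lemma mem_cut_of_isLink {G : Graph α β} {e : β} {x y : α} (h : G.IsLink e x y) (X : Set α) :
    e ∈ cut G X ↔ ¬ (x ∈ X ↔ y ∈ X) := by
  constructor
  · rintro ⟨u, v, h', hu, hv⟩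
    rcases h.eq_and_eq_or_eq_and_eq h' with ⟨rfl, rfl⟩ | ⟨rfl, rfl⟩ <;> tauto
  · intro h'
    by_cases hx : x ∈ X
    · exact ⟨x, y, h, hx, by tauto⟩
    · exact ⟨y, x, h.symm, by tauto, hx⟩

namespace Rep

variable {G : Graph α β} {A B : Finset α} {E : Finset β} {s t : β → α}

lemma s_mem (h : Rep G A B E s t) {e : β} (he : e ∈ E) : s e ∈ V(G) :=
  h.mem_verts.2 (Or.inl (h.smem e he))

lemma t_mem (h : Rep G A B E s t) {e : β} (he : e ∈ E) : t e ∈ V(G) :=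
  h.mem_verts.2 (Or.inr (h.tmem e he))

lemma mem_cut (h : Rep G A B E s t) {X : Set α} {e : β} :
    e ∈ cut G X ↔ e ∈ E ∧ ¬ (s e ∈ X ↔ t e ∈ X) := by
  constructor
  · intro he
    have he' : e ∈ E := by
      obtain ⟨u, v, h', -, -⟩ := he
      exact h.mem_edgeSet.1 h'.edge_mem
    exact ⟨he', (mem_cut_of_isLink (h.link he') X).1 he⟩
  · rintro ⟨he, h'⟩
    exact (mem_cut_of_isLink (h.link he) X).2 h'

lemma cut_eq (h : Rep G A B E s t) (X : Set α) :
    cut G X = ↑{e ∈ E | ¬ (s e ∈ X ↔ t e ∈ X)} := by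
  ext e
  rw [h.mem_cut]
  simp

lemma cut_finite (h : Rep G A B E s t) (X : Set α) : (cut G X).Finite := by
  rw [h.cut_eq]; exact Finset.finite_toSet _

lemma cut_ncard (h : Rep G A B E s t) (X : Set α) :
    (cut G X).ncard = #{e ∈ E | s e ∈ X ∧ t e ∉ X} + #{e ∈ E | s e ∉ X ∧ t e ∈ X} := by
  rw [h.cut_eq, Set.ncard_coe_finset, ← Finset.card_union_of_disjoint]
  · congr 1
    ext e
    simp only [Finset.mem_filter, Finset.mem_union]
    tauto
  · rw [Finset.disjoint_filter]
    tauto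

/-- Edges with both ends in X contribute equally to both colors and cancel. The two directions
across ∂(X) therefore agree modulo 3, and all later facts on cuts of two or three edges follow from
this. -/
lemma excess (h : Rep G A B E s t) (X : Set α) :
    3 * #{v ∈ A | v ∈ X} + #{e ∈ E | s e ∉ X ∧ t e ∈ X} =
      3 * #{v ∈ B | v ∈ X} + #{e ∈ E | s e ∈ X ∧ t e ∉ X} := by
  have := h.factor_count subset_rfl h.factor_three X
  simp only [Finset.sum_const, smul_eq_mul] at this
  omega

lemma cut_nonempty (h : Rep G A B E s t) {X : Set α} {u v : α} (hu : u ∈ V(G)) (huX : u ∈ X)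
    (hv : v ∈ V(G)) (hvX : v ∉ X) : (cut G X).Nonempty := by
  obtain ⟨e, he, h'⟩ := h.conn X ⟨u, hu, huX⟩ ⟨v, hv, hvX⟩
  exact ⟨e, h.mem_cut.2 ⟨he, h'⟩⟩

/-- Connectedness gives one edge, and a single edge would contradict the congruence modulo 3. -/
lemma two_le_cut (h : Rep G A B E s t) {X : Set α} {u v : α} (hu : u ∈ V(G)) (huX : u ∈ X)
    (hv : v ∈ V(G)) (hvX : v ∉ X) : 2 ≤ (cut G X).ncard := by
  have h1 := (Set.ncard_pos (h.cut_finite X)).2 (h.cut_nonempty hu huX hv hvX)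
  have h2 := h.excess X
  rw [h.cut_ncard] at *
  omega

lemma cut_two (h : Rep G A B E s t) {X : Set α} (hX : (cut G X).ncard = 2) :
    #{e ∈ E | s e ∈ X ∧ t e ∉ X} = 1 ∧ #{e ∈ E | s e ∉ X ∧ t e ∈ X} = 1 := by
  have h2 := h.excess X
  rw [h.cut_ncard] at hX
  omega

/-- Three edges whose two directions agree modulo 3 can only split as 3 + 0 or 0 + 3. One may
therefore assume, exchanging colors or shores, that X has the majority in A. -/
lemma cut_three (h : Rep G A B E s t) {X : Set α} (hX : (cut G X).ncard = 3) :
    IsOut E s t X ∨ IsOut E t s X := by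
  have h2 := h.excess X
  rw [h.cut_ncard] at hX
  have : #{e ∈ E | s e ∉ X ∧ t e ∈ X} = 0 ∨ #{e ∈ E | s e ∈ X ∧ t e ∉ X} = 0 := by omega
  rcases this with h0 | h0
  · left
    refine ⟨?_, by omega⟩
    rw [Finset.card_eq_zero, Finset.filter_eq_empty_iff] at h0
    intro e he h3
    by_contra h4
    exact h0 he ⟨h4, h3⟩
  · right
    refine ⟨?_, by simp only [and_comm (a := t _ ∈ X)]; omega⟩
    rw [Finset.card_eq_zero, Finset.filter_eq_empty_iff] at h0
    intro e he h3
    by_contra h4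
    exact h0 he ⟨h3, h4⟩

lemma cut_of_isOut (h : Rep G A B E s t) {X : Set α} (hX : IsOut E s t X) :
    cut G X = ↑{e ∈ E | s e ∈ X ∧ t e ∉ X} := by
  ext e
  rw [h.mem_cut]
  simp only [Finset.coe_filter, Set.mem_ofPred_eq]
  have := hX.1 e
  tauto

lemma ncard_cut_of_isOut (h : Rep G A B E s t) {X : Set α} (hX : IsOut E s t X) :
    (cut G X).ncard = 3 := by
  rw [h.cut_of_isOut hX, Set.ncard_coe_finset, hX.2]

lemma card_of_isOut (h : Rep G A B E s t) {X : Set α} (hX : IsOut E s t X) :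
    #{v ∈ A | v ∈ X} = #{v ∈ B | v ∈ X} + 1 := by
  have h1 := h.excess X
  have h2 : #{e ∈ E | s e ∉ X ∧ t e ∈ X} = 0 := by
    rw [Finset.card_eq_zero, Finset.filter_eq_empty_iff]
    intro e he h3
    exact h3.1 (hX.1 e he h3.2)
  rw [hX.2] at h1
  omega

lemma isOut_compl (h : Rep G A B E s t) {X : Set α} (hX : IsOut E s t X) :
    IsOut E t s (V(G) \ X) := by
  refine ⟨fun e he h1 => ⟨h.t_mem he, fun h2 => h1.2 (hX.1 e he h2)⟩, ?_⟩
  rw [← hX.2]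
  congr 1
  ext e
  simp only [Finset.mem_filter, Set.mem_sdiff]
  have h1 := @Rep.s_mem _ _ _ _ _ _ _ _ h e
  have h2 := @Rep.t_mem _ _ _ _ _ _ _ _ h e
  tauto

lemma cut_compl (h : Rep G A B E s t) (X : Set α) : cut G (V(G) \ X) = cut G X := by
  ext e
  rw [h.mem_cut, h.mem_cut]
  refine and_congr_right fun he => ?_
  have h1 := h.s_mem he
  have h2 := h.t_mem he
  simp only [Set.mem_sdiff, h1, h2]
  tauto

/-! ### Perfect matchings and tight cuts -/

lemma isPerfectMatching_iff (h : Rep G A B E s t) {M : Set β} :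
    IsPerfectMatching G M ↔ ∃ M' ⊆ E, ↑M' = M ∧ IsFactor A B s t M' 1 := by
  constructor
  · rintro ⟨h1, h2⟩
    rw [h.edgeSet] at h1
    have hf : M.Finite := (Finset.finite_toSet E).subset h1
    refine ⟨hf.toFinset, by simpa using h1, by simp, fun v hv => ?_, fun v hv => ?_⟩
    · rw [← h.deg_restrict (by simpa using h1) hv, Set.Finite.coe_toFinset]
      exact h2 v (h.mem_verts.2 (Or.inl hv))
    · rw [← h.symm.deg_restrict (by simpa using h1) hv, Set.Finite.coe_toFinset]
      exact h2 v (h.mem_verts.2 (Or.inr hv))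
  · rintro ⟨M', h1, rfl, h2⟩
    refine ⟨by rw [h.edgeSet]; exact_mod_cast h1, fun v hv => ?_⟩
    rcases h.mem_verts.1 hv with hv | hv
    · rw [h.deg_restrict h1 hv, h2.1 v hv, Pi.one_apply]
    · rw [h.symm.deg_restrict h1 hv, h2.2 v hv, Pi.one_apply]

/-- A bipartite cubic graph is the disjoint union of three perfect matchings. -/
lemma exists_three_factors (h : Rep G A B E s t) :
    ∃ M₁ M₂ M₃ : Finset β, IsFactor A B s t M₁ 1 ∧ IsFactor A B s t M₂ 1 ∧ IsFactor A B s t M₃ 1 ∧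
      M₁ ⊆ E ∧ M₂ ⊆ E ∧ M₃ ⊆ E ∧ (∀ e ∈ E, e ∈ M₁ ∨ e ∈ M₂ ∨ e ∈ M₃) ∧
      Disjoint M₁ M₂ ∧ Disjoint M₁ M₃ ∧ Disjoint M₂ M₃ := by
  obtain ⟨M₁, h1, f1⟩ := exists_factor_of_regular (by norm_num) h.smem h.tmem h.factor_three
  have g1 := h.factor_three.sdiff f1 h1
  obtain ⟨M₂, h2, f2⟩ := exists_factor_of_regular (k := 2) (by norm_num)
    (fun e he => h.smem e (Finset.mem_sdiff.1 he).1)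
    (fun e he => h.tmem e (Finset.mem_sdiff.1 he).1) g1
  have g2 := g1.sdiff f2 h2
  refine ⟨M₁, M₂, (E \ M₁) \ M₂, f1, f2, g2, h1, h2.trans Finset.sdiff_subset,
    Finset.sdiff_subset.trans Finset.sdiff_subset, ?_, ?_, ?_, ?_⟩
  · intro e he
    simp only [Finset.mem_sdiff]
    tauto
  · rw [Finset.disjoint_right]
    intro e he
    exact (Finset.mem_sdiff.1 (h2 he)).2
  · rw [Finset.disjoint_right]
    intro e he
    simp only [Finset.mem_sdiff] at he
    exact he.1.2
  · exact Finset.disjoint_sdiff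

lemma exists_factor_mem (h : Rep G A B E s t) {e : β} (he : e ∈ E) :
    ∃ M ⊆ E, IsFactor A B s t M 1 ∧ e ∈ M := by
  obtain ⟨M₁, M₂, M₃, f1, f2, f3, h1, h2, h3, hE, -⟩ := h.exists_three_factors
  rcases hE e he with h' | h' | h'
  · exact ⟨M₁, h1, f1, h'⟩
  · exact ⟨M₂, h2, f2, h'⟩
  · exact ⟨M₃, h3, f3, h'⟩

lemma isMatchingCovered (h : Rep G A B E s t) : IsMatchingCovered G := by
  refine ⟨h.isConnected, h.order_pos, fun e he => ?_⟩
  obtain ⟨M, hM, hf, heM⟩ := h.exists_factor_mem (h.mem_edgeSet.1 he)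
  exact ⟨↑M, h.isPerfectMatching_iff.2 ⟨M, hM, rfl, hf⟩, by exact_mod_cast heM⟩

lemma factor_inter_cut (h : Rep G A B E s t) {X : Set α} (hX : IsOut E s t X) {M : Finset β}
    (hM : M ⊆ E) {d : α → ℕ} (hf : IsFactor A B s t M d) :
    ∑ v ∈ A with v ∈ X, d v = (∑ v ∈ B with v ∈ X, d v) + #{e ∈ M | s e ∈ X ∧ t e ∉ X} := by
  have h1 := h.factor_count hM hf X
  have h2 : #{e ∈ M | s e ∉ X ∧ t e ∈ X} = 0 := by
    rw [Finset.card_eq_zero, Finset.filter_eq_empty_iff]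
    intro e he h3
    exact h3.1 (hX.1 e (hM he) h3.2)
  omega

/-- X has exactly one vertex more in A than in B and no edge enters X ∩ B from outside, so a perfect
matching must send just that surplus across the cut. -/
lemma isTightCut_of_isOut (h : Rep G A B E s t) {X : Set α} (hXV : X ⊆ V(G))
    (hX : IsOut E s t X) : IsTightCut G X := by
  refine ⟨hXV, fun M hM => ?_⟩
  obtain ⟨M', hM', rfl, hf⟩ := h.isPerfectMatching_iff.1 hM
  have h1 := h.factor_inter_cut hX hM' hf
  have h2 := h.card_of_isOut hX
  simp only [Pi.one_apply, Finset.sum_const, smul_eq_mul, mul_one] at h1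
  have h3 : cut G X ∩ ↑M' = ↑{e ∈ M' | s e ∈ X ∧ t e ∉ X} := by
    ext e
    rw [h.cut_of_isOut hX]
    simp only [Finset.coe_filter, Set.mem_inter_iff, Set.mem_ofPred_eq, Finset.mem_coe]
    have := @hM' e
    tauto
  rw [h3, Set.ncard_coe_finset]
  omega

/-- In a connected bipartite cubic graph the tight cuts are the cuts with three edges. -/
lemma isTightCut_iff (h : Rep G A B E s t) {X : Set α} :
    IsTightCut G X ↔ X ⊆ V(G) ∧ (cut G X).ncard = 3 := by
  constructor
  · rintro ⟨hXV, hX⟩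
    refine ⟨hXV, ?_⟩
    obtain ⟨M₁, M₂, M₃, f1, f2, f3, h1, h2, h3, hE, d12, d13, d23⟩ := h.exists_three_factors
    have k1 := hX _ (h.isPerfectMatching_iff.2 ⟨M₁, h1, rfl, f1⟩)
    have k2 := hX _ (h.isPerfectMatching_iff.2 ⟨M₂, h2, rfl, f2⟩)
    have k3 := hX _ (h.isPerfectMatching_iff.2 ⟨M₃, h3, rfl, f3⟩)
    -- Three disjoint perfect matchings cover all edges and each meets the cut once.
    have hcut : cut G X = (cut G X ∩ ↑M₁) ∪ ((cut G X ∩ ↑M₂) ∪ (cut G X ∩ ↑M₃)) := by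
      ext e
      have := fun he : e ∈ cut G X => hE e (h.mem_cut.1 he).1
      simp only [Set.mem_union, Set.mem_inter_iff, Finset.mem_coe]
      tauto
    have hfin := h.cut_finite X
    have e12 : ∀ e ∈ M₁, e ∉ M₂ := fun _ => (Finset.disjoint_left.1 d12 ·)
    have e13 : ∀ e ∈ M₁, e ∉ M₃ := fun _ => (Finset.disjoint_left.1 d13 ·)
    have e23 : ∀ e ∈ M₂, e ∉ M₃ := fun _ => (Finset.disjoint_left.1 d23 ·)
    rw [hcut, Set.ncard_union_eq _ (hfin.inter_of_left _)
      ((hfin.inter_of_left _).union (hfin.inter_of_left _)),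
      Set.ncard_union_eq _ (hfin.inter_of_left _) (hfin.inter_of_left _), k1, k2, k3]
    · rw [Set.disjoint_left]
      rintro e ⟨-, h4⟩ ⟨-, h5⟩
      exact e23 e h4 h5
    · rw [Set.disjoint_left]
      rintro e ⟨-, h4⟩ (⟨-, h5⟩ | ⟨-, h5⟩)
      · exact e12 e h4 h5
      · exact e13 e h4 h5
  · rintro ⟨hXV, hX⟩
    rcases h.cut_three hX with hX | hX
    · exact h.isTightCut_of_isOut hXV hX
    · exact h.symm.isTightCut_of_isOut hXV hX

end Rep

/-- The nontrivial cuts with three edges. -/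
def IsNT (G : Graph α β) (X : Set α) : Prop :=
  X ⊆ V(G) ∧ (cut G X).ncard = 3 ∧ X.Nontrivial ∧ (V(G) \ X).Nontrivial

lemma Cub.isNontrivialTightCut_iff {G : Graph α β} (hG : Cub G) {X : Set α} :
    IsNontrivialTightCut G X ↔ IsNT G X := by
  obtain ⟨A, B, E, s, t, h⟩ := hG
  rw [IsNontrivialTightCut, h.isTightCut_iff, IsNT]
  tauto

lemma Cub.isNT_compl {G : Graph α β} (hG : Cub G) {X : Set α} (hX : IsNT G X) :
    IsNT G (V(G) \ X) := by
  obtain ⟨A, B, E, s, t, h⟩ := hG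
  refine ⟨Set.sdiff_subset, by rw [h.cut_compl]; exact hX.2.1, hX.2.2.2, ?_⟩
  rw [Set.sdiff_sdiff_cancel_left hX.1]
  exact hX.2.2.1

/-! ### Contractions -/

/-- The vertex map of a contraction. -/
noncomputable def collapse (X : Set α) (x v : α) : α := if v ∈ X then x else v

lemma collapse_of_mem {X : Set α} {x v : α} (h : v ∈ X) : collapse X x v = x := if_pos h

lemma collapse_of_notMem {X : Set α} {x v : α} (h : v ∉ X) : collapse X x v = v := if_neg h

lemma contract_isLink {G : Graph α β} {X : Set α} {x : α} {e : β} {u v : α} :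
    (contract G X x).IsLink e u v ↔
      ∃ y z, G.IsLink e y z ∧ ¬ (y ∈ X ∧ z ∈ X) ∧ collapse X x y = u ∧ collapse X x z = v := by
  simp only [contract, Graph.map_isLink, Relation.Map, Graph.deleteEdges_isLink, Set.mem_ofPred_eq,
    collapse]
  constructor
  · rintro ⟨y, z, ⟨h1, h2⟩, h3, h4⟩
    exact ⟨y, z, h1, fun h5 => h2 ⟨y, z, h1, h5⟩, h3, h4⟩
  · rintro ⟨y, z, h1, h2, h3, h4⟩
    refine ⟨y, z, ⟨h1, ?_⟩, h3, h4⟩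
    rintro ⟨y', z', h5, h6⟩
    rcases h1.eq_and_eq_or_eq_and_eq h5 with ⟨rfl, rfl⟩ | ⟨rfl, rfl⟩ <;> tauto

lemma contract_verts (G : Graph α β) (X : Set α) (x : α) :
    V(contract G X x) = collapse X x '' V(G) := rfl

lemma contract_verts' {G : Graph α β} {X : Set α} {x : α} (hX : X ⊆ V(G)) (hx : x ∈ X) :
    V(contract G X x) = insert x (V(G) \ X) := by
  rw [contract_verts]
  ext v
  simp only [Set.mem_image, Set.mem_insert_iff, Set.mem_sdiff]
  constructor
  · rintro ⟨w, hw, rfl⟩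
    by_cases h : w ∈ X
    · exact Or.inl (collapse_of_mem h)
    · rw [collapse_of_notMem h]; exact Or.inr ⟨hw, h⟩
  · rintro (rfl | ⟨h1, h2⟩)
    · exact ⟨v, hX hx, collapse_of_mem hx⟩
    · exact ⟨v, h1, collapse_of_notMem h2⟩

/-- The set of vertices of `G` that are mapped to `Z` when `X` is shrunk to `x`. -/
def expand (G : Graph α β) (X : Set α) (x : α) (Z : Set α) : Set α :=
  {v ∈ V(G) | collapse X x v ∈ Z}

/-- Contractions keep the edge labels, so this is an equality of sets: no cut of a contraction is
new. -/
lemma cut_contract {G : Graph α β} {X : Set α} {x : α} (Z : Set α) :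
    cut (contract G X x) Z = cut G (expand G X x Z) := by
  ext e
  constructor
  · rintro ⟨u, v, h, hu, hv⟩
    obtain ⟨y, z, h1, -, rfl, rfl⟩ := contract_isLink.1 h
    exact ⟨y, z, h1, ⟨h1.left_mem, hu⟩, fun h2 => hv h2.2⟩
  · rintro ⟨y, z, h1, ⟨-, hu⟩, hv⟩
    have hv' : collapse X x z ∉ Z := fun h2 => hv ⟨h1.right_mem, h2⟩
    refine ⟨_, _, contract_isLink.2 ⟨y, z, h1, ?_, rfl, rfl⟩, hu, hv'⟩
    rintro ⟨h2, h3⟩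
    rw [collapse_of_mem h2] at hu
    rw [collapse_of_mem h3] at hv'
    exact hv' hu

lemma expand_of_mem {G : Graph α β} {X : Set α} {x : α} {Z : Set α} (hX : X ⊆ V(G))
    (hZ : Z ⊆ V(contract G X x)) (hx : x ∈ X) (hxZ : x ∈ Z) : expand G X x Z = Z ∪ X := by
  rw [contract_verts' hX hx] at hZ
  ext v
  simp only [expand, Set.mem_union]
  by_cases hv : v ∈ X
  · simp [collapse_of_mem hv, hv, hxZ, hX hv]
  · simp only [Set.mem_ofPred_eq, collapse_of_notMem hv, hv, or_false, and_iff_right_iff_imp]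
    intro h
    rcases hZ h with rfl | h
    · exact absurd hx hv
    · exact h.1

lemma expand_of_notMem {G : Graph α β} {X : Set α} {x : α} {Z : Set α} (hX : X ⊆ V(G))
    (hZ : Z ⊆ V(contract G X x)) (hx : x ∈ X) (hxZ : x ∉ Z) : expand G X x Z = Z := by
  rw [contract_verts' hX hx] at hZ
  ext v
  simp only [expand, Set.mem_ofPred_eq]
  by_cases hv : v ∈ X
  · simp only [collapse_of_mem hv, hxZ, and_false, false_iff]
    intro h
    rcases hZ h with rfl | h
    · exact hxZ h
    · exact h.2 hv
  · simp only [collapse_of_notMem hv, and_iff_right_iff_imp]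
    intro h
    rcases hZ h with rfl | h
    · exact absurd hx hv
    · exact h.1

/-- Because the contraction vertex is named by a vertex of the shrunk set, iterated contractions
agree on the nose and not merely up to isomorphism; likewise for `contract_comm`. This is what makes
the refinement argument in `UniqueBelow.nested` a rewriting. -/
lemma contract_contract {G : Graph α β} {X : Set α} {x : α} {Z : Set α} {z : α} (hxZ : x ∈ Z) :
    contract (contract G X x) Z z = contract G (expand G X x Z) z := by
  have key : ∀ v ∈ V(G), collapse Z z (collapse X x v) = collapse (expand G X x Z) z v := by
    intro v hv
    by_cases h : collapse X x v ∈ Z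
    · rw [collapse_of_mem h, collapse_of_mem (X := expand G X x Z) ⟨hv, h⟩]
    · rw [collapse_of_notMem h, collapse_of_notMem (X := expand G X x Z) fun h' => h h'.2]
      by_cases h2 : v ∈ X
      · rw [collapse_of_mem h2] at h; exact absurd hxZ h
      · exact collapse_of_notMem h2
  refine Graph.ext ?_ fun e u v => ?_
  · rw [contract_verts, contract_verts, contract_verts, Set.image_image]
    exact Set.image_congr key
  · rw [contract_isLink, contract_isLink]
    constructor
    · rintro ⟨y, z', h, h2, rfl, rfl⟩
      obtain ⟨p, q, h3, -, rfl, rfl⟩ := contract_isLink.1 h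
      exact ⟨p, q, h3, fun h4 => h2 ⟨h4.1.2, h4.2.2⟩, (key p h3.left_mem).symm,
        (key q h3.right_mem).symm⟩
    · rintro ⟨p, q, h3, h4, rfl, rfl⟩
      refine ⟨_, _, contract_isLink.2 ⟨p, q, h3, ?_, rfl, rfl⟩,
        fun h5 => h4 ⟨⟨h3.left_mem, h5.1⟩, ⟨h3.right_mem, h5.2⟩⟩,
        key p h3.left_mem, key q h3.right_mem⟩
      rintro ⟨h5, h6⟩
      exact h4 ⟨⟨h3.left_mem, by rwa [collapse_of_mem h5]⟩,
        ⟨h3.right_mem, by rwa [collapse_of_mem h6]⟩⟩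

lemma contract_comm {G : Graph α β} {X Z : Set α} {x z : α} (hx : x ∈ X) (hz : z ∈ Z)
    (hXZ : Disjoint X Z) :
    contract (contract G X x) Z z = contract (contract G Z z) X x := by
  have hdis : ∀ v ∈ X, v ∉ Z := fun _ => (Set.disjoint_left.1 hXZ ·)
  have key : ∀ v, collapse Z z (collapse X x v) = collapse X x (collapse Z z v) := by
    intro v
    by_cases h1 : v ∈ X
    · rw [collapse_of_mem h1, collapse_of_notMem (hdis v h1), collapse_of_mem h1,
        collapse_of_notMem (hdis x hx)]
    · rw [collapse_of_notMem h1]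
      by_cases h2 : v ∈ Z
      · rw [collapse_of_mem h2, collapse_of_notMem fun h => hdis z h hz]
      · rw [collapse_of_notMem h2, collapse_of_notMem h1]
  have kX : ∀ v, collapse Z z v ∈ X ↔ v ∈ X := by
    intro v
    by_cases h2 : v ∈ Z
    · rw [collapse_of_mem h2]
      exact ⟨fun h => absurd hz (hdis z h), fun h => absurd h2 (hdis v h)⟩
    · rw [collapse_of_notMem h2]
  have kZ : ∀ v, collapse X x v ∈ Z ↔ v ∈ Z := by
    intro v
    by_cases h2 : v ∈ X
    · rw [collapse_of_mem h2]
      exact ⟨fun h => absurd h (hdis x hx), fun h => absurd h (hdis v h2)⟩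
    · rw [collapse_of_notMem h2]
  refine Graph.ext ?_ fun e u v => ?_
  · simp only [contract_verts, Set.image_image, key]
  · rw [contract_isLink, contract_isLink]
    constructor
    · rintro ⟨y, z', h, h2, rfl, rfl⟩
      obtain ⟨p, q, h3, h4, rfl, rfl⟩ := contract_isLink.1 h
      rw [kZ, kZ] at h2
      exact ⟨_, _, contract_isLink.2 ⟨p, q, h3, h2, rfl, rfl⟩, by rwa [kX, kX], (key p).symm,
        (key q).symm⟩
    · rintro ⟨y, z', h, h2, rfl, rfl⟩
      obtain ⟨p, q, h3, h4, rfl, rfl⟩ := contract_isLink.1 h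
      rw [kX, kX] at h2
      exact ⟨_, _, contract_isLink.2 ⟨p, q, h3, h2, rfl, rfl⟩, by rwa [kZ, kZ], key p, key q⟩

/-- All three cut edges have their `s`-end in X, so the contraction vertex has degree 3 and joins
the class A. The surviving edges are those whose `t`-end lies outside X, since such a `t`-end in X
would force the whole edge into X. -/
lemma Rep.contract {G : Graph α β} {A B : Finset α} {E : Finset β} {s t : β → α}
    (h : Rep G A B E s t) {X : Set α} {x : α} (hXV : X ⊆ V(G)) (hX : IsOut E s t X) (hx : x ∈ X) :
    Rep (contract G X x) (insert x {v ∈ A | v ∉ X}) {v ∈ B | v ∉ X} {e ∈ E | t e ∉ X}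
      (fun e => collapse X x (s e)) t where
  verts := by
    rw [contract_verts' hXV hx, h.verts]
    ext v
    simp only [Set.mem_insert_iff, Set.mem_sdiff, Set.mem_union, Finset.mem_coe, Finset.mem_insert,
      Finset.mem_filter]
    tauto
  disj := by
    rw [Finset.disjoint_left]
    intro v
    simp only [Finset.mem_insert, Finset.mem_filter]
    rintro (rfl | ⟨h1, -⟩) ⟨h2, h3⟩
    · exact h3 hx
    · exact h.notMem_B h1 h2
  isLink e u v := by
    rw [contract_isLink]
    simp only [h.isLink, Finset.mem_filter]
    have hout := hX.1 e
    constructor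
    · rintro ⟨y, z, ⟨he, ⟨rfl, rfl⟩ | ⟨rfl, rfl⟩⟩, h2, rfl, rfl⟩
      · have : t e ∉ X := by tauto
        rw [collapse_of_notMem this]
        exact ⟨⟨he, this⟩, Or.inl ⟨rfl, rfl⟩⟩
      · have : t e ∉ X := by tauto
        rw [collapse_of_notMem this]
        exact ⟨⟨he, this⟩, Or.inr ⟨rfl, rfl⟩⟩
    · rintro ⟨⟨he, h2⟩, ⟨rfl, rfl⟩ | ⟨rfl, rfl⟩⟩
      · exact ⟨s e, t e, ⟨he, Or.inl ⟨rfl, rfl⟩⟩, by tauto, rfl, collapse_of_notMem h2⟩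
      · exact ⟨t e, s e, ⟨he, Or.inr ⟨rfl, rfl⟩⟩, by tauto, collapse_of_notMem h2, rfl⟩
  smem e he := by
    have he' := (Finset.mem_filter.1 he).1
    by_cases hs : s e ∈ X
    · simp [collapse_of_mem hs]
    · simp [collapse_of_notMem hs, h.smem e he', hs]
  tmem e he := by
    rw [Finset.mem_filter] at he ⊢
    exact ⟨h.tmem e he.1, he.2⟩
  degA v hv := by
    rw [Finset.filter_filter]
    rw [Finset.mem_insert, Finset.mem_filter] at hv
    by_cases hvx : v = x
    · subst hvx
      rw [← hX.2]
      congr 1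
      apply Finset.filter_congr
      intro e he
      by_cases hs : s e ∈ X
      · simp [collapse_of_mem hs, hs]
      · simp only [collapse_of_notMem hs, hs, false_and, iff_false, not_and]
        rintro - rfl
        exact hs hx
    · have hv' : v ∈ A ∧ v ∉ X := by tauto
      rw [← h.degA v hv'.1]
      congr 1
      apply Finset.filter_congr
      intro e he
      have hout := hX.1 e he
      by_cases hs : s e ∈ X
      · simp only [collapse_of_mem hs]
        constructor
        · rintro ⟨-, rfl⟩; exact absurd rfl hvx
        · rintro rfl; exact absurd hs hv'.2
      · simp only [collapse_of_notMem hs]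
        constructor
        · rintro ⟨-, h3⟩; exact h3
        · intro h3; exact ⟨fun h4 => hs (hout h4), h3⟩
  degB v hv := by
    rw [Finset.filter_filter]
    rw [Finset.mem_filter] at hv
    rw [← h.degB v hv.1]
    congr 1
    apply Finset.filter_congr
    rintro e he
    constructor
    · exact fun h3 => h3.2
    · rintro rfl; exact ⟨hv.2, rfl⟩
  nonempty := ⟨x, by simp⟩
  conn Z hZ hZ' := by
    obtain ⟨u, hu, huZ⟩ := hZ
    obtain ⟨v, hv, hvZ⟩ := hZ'
    rw [contract_verts] at hu hv
    obtain ⟨u, hu, rfl⟩ := hu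
    obtain ⟨v, hv, rfl⟩ := hv
    obtain ⟨e, he, h1⟩ := h.conn {v | collapse X x v ∈ Z} ⟨u, hu, huZ⟩ ⟨v, hv, hvZ⟩
    simp only [Set.mem_ofPred_eq] at h1
    have ht : t e ∉ X := by
      intro h2
      rw [collapse_of_mem h2, collapse_of_mem (hX.1 e he h2)] at h1
      exact h1 Iff.rfl
    rw [collapse_of_notMem ht] at h1
    exact ⟨e, Finset.mem_filter.2 ⟨he, ht⟩, h1⟩

/-- The complement of a shore with majority in A has majority in B, so this is `Rep.contract` with
the colors exchanged. -/
lemma Rep.contract_compl {G : Graph α β} {A B : Finset α} {E : Finset β} {s t : β → α}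
    (h : Rep G A B E s t) {X : Set α} {y : α} (hX : IsOut E s t X)
    (hy : y ∈ V(G) \ X) :
    Rep (CubicGraph.contract G (V(G) \ X) y) {v ∈ A | v ∈ X} (insert y {v ∈ B | v ∈ X})
      {e ∈ E | s e ∈ X} s (fun e => collapse (V(G) \ X) y (t e)) := by
  have h1 := (h.symm.contract Set.sdiff_subset (h.isOut_compl hX) hy).symm
  convert h1 using 1
  · ext v
    simp only [Finset.mem_filter, Set.mem_sdiff, h.mem_verts]
    tauto
  · congr 1
    ext v
    simp only [Finset.mem_filter, Set.mem_sdiff, h.mem_verts]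
    tauto
  · ext e
    have := @Rep.s_mem _ _ _ _ _ _ _ _ h e
    simp only [Finset.mem_filter, Set.mem_sdiff]
    tauto

lemma Cub.exists_isOut {G : Graph α β} (hG : Cub G) {X : Set α} (hX : (cut G X).ncard = 3) :
    ∃ A B E s t, Rep G A B E s t ∧ IsOut E s t X := by
  obtain ⟨A, B, E, s, t, h⟩ := hG
  rcases h.cut_three hX with hX | hX
  · exact ⟨A, B, E, s, t, h, hX⟩
  · exact ⟨B, A, E, t, s, h.symm, hX⟩

lemma Cub.contract {G : Graph α β} (hG : Cub G) {X : Set α} {x : α} (hXV : X ⊆ V(G))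
    (hX : (cut G X).ncard = 3) (hx : x ∈ X) : Cub (contract G X x) := by
  obtain ⟨A, B, E, s, t, h, hX⟩ := hG.exists_isOut hX
  exact ⟨_, _, _, _, _, h.contract hXV hX hx⟩

lemma Cub.finite {G : Graph α β} (hG : Cub G) : V(G).Finite := by
  obtain ⟨A, B, E, s, t, h⟩ := hG
  exact h.finite

lemma order_contract {G : Graph α β} (hG : V(G).Finite) {X : Set α} {x : α} (hXV : X ⊆ V(G))
    (hx : x ∈ X) : order (contract G X x) + X.ncard = order G + 1 := by
  rw [order, contract_verts' hXV hx, Set.ncard_insert_of_notMem (fun h => h.2 hx) hG.sdiff, order,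
    ← Set.ncard_sdiff_add_ncard_of_subset hXV hG]
  omega

end Cuts

section Isomorphisms

variable {α β α' β' α'' β'' : Type*}

/-! ### Isomorphisms -/

/-- The maps `F` of vertices and `Γ` of edges give an isomorphism from `G` to `G'`. -/
structure IsoVia (G : Graph α β) (G' : Graph α' β') (F : α → α') (Γ : β → β') : Prop where
  injV : Set.InjOn F V(G)
  imgV : F '' V(G) = V(G')
  injE : Set.InjOn Γ E(G)
  imgE : Γ '' E(G) = E(G')
  link : ∀ e x y, G.IsLink e x y → G'.IsLink (Γ e) (F x) (F y)

lemma Iso.exists_isoVia {G : Graph α β} {G' : Graph α' β'} (h : Iso G G') (hV : V(G).Nonempty)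
    (hE : E(G).Nonempty) : ∃ F Γ, IsoVia G G' F Γ := by
  obtain ⟨f, g, h⟩ := h
  obtain ⟨v₀, hv₀⟩ := hV
  obtain ⟨e₀, he₀⟩ := hE
  -- Off the graph the total maps take the value at a fixed vertex or edge, whence the nonemptiness
  -- assumptions.
  refine ⟨fun v => if hv : v ∈ V(G) then f ⟨v, hv⟩ else f ⟨v₀, hv₀⟩,
    fun e => if he : e ∈ E(G) then g ⟨e, he⟩ else g ⟨e₀, he₀⟩, ?_, ?_, ?_, ?_, ?_⟩
  · intro u hu v hv huv
    simpa only [dif_pos hu, dif_pos hv, EmbeddingLike.apply_eq_iff_eq, Subtype.mk.injEq, SetLike.coe_eq_coe, Subtype.coe_inj] using huv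
  · ext w
    constructor
    · rintro ⟨v, hv, rfl⟩
      simp [hv]
    · intro hw
      exact ⟨f.symm ⟨w, hw⟩, (f.symm ⟨w, hw⟩).2, by simp⟩
  · intro u hu v hv huv
    simpa only [dif_pos hu, dif_pos hv, EmbeddingLike.apply_eq_iff_eq, Subtype.mk.injEq, SetLike.coe_eq_coe, Subtype.coe_inj] using huv
  · ext w
    constructor
    · rintro ⟨v, hv, rfl⟩
      simp [hv]
    · intro hw
      exact ⟨g.symm ⟨w, hw⟩, (g.symm ⟨w, hw⟩).2, by simp⟩
  · intro e x y hl
    have := (h ⟨e, hl.edge_mem⟩ ⟨x, hl.left_mem⟩ ⟨y, hl.right_mem⟩).1 hl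
    simpa [hl.edge_mem, hl.left_mem, hl.right_mem] using this

namespace IsoVia

variable {G : Graph α β} {G' : Graph α' β'} {F : α → α'} {Γ : β → β'}

lemma memV (h : IsoVia G G' F Γ) {v : α} (hv : v ∈ V(G)) : F v ∈ V(G') :=
  h.imgV ▸ Set.mem_image_of_mem F hv

lemma memE (h : IsoVia G G' F Γ) {e : β} (he : e ∈ E(G)) : Γ e ∈ E(G') :=
  h.imgE ▸ Set.mem_image_of_mem Γ he

lemma link_iff (h : IsoVia G G' F Γ) {e : β} {x y : α} (he : e ∈ E(G)) (hx : x ∈ V(G))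
    (hy : y ∈ V(G)) : G'.IsLink (Γ e) (F x) (F y) ↔ G.IsLink e x y := by
  refine ⟨fun h' => ?_, h.link e x y⟩
  obtain ⟨u, v, huv⟩ := Graph.exists_isLink_of_mem_edgeSet he
  rcases h'.eq_and_eq_or_eq_and_eq (h.link _ _ _ huv) with ⟨h1, h2⟩ | ⟨h1, h2⟩
  · rwa [h.injV hx huv.left_mem h1, h.injV hy huv.right_mem h2]
  · rw [h.injV hx huv.right_mem h1, h.injV hy huv.left_mem h2]
    exact huv.symm

lemma iso (h : IsoVia G G' F Γ) : Iso G G' := by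
  refine ⟨Set.BijOn.equiv F ⟨fun v hv => h.memV hv, h.injV, h.imgV.ge⟩,
    Set.BijOn.equiv Γ ⟨fun v hv => h.memE hv, h.injE, h.imgE.ge⟩, fun e x y => ?_⟩
  exact (h.link_iff e.2 x.2 y.2).symm

lemma exists_symm (h : IsoVia G G' F Γ) (hV : V(G).Nonempty) (hE : E(G).Nonempty) :
    ∃ F' Γ', IsoVia G' G F' Γ' ∧ (∀ v ∈ V(G), F' (F v) = v) ∧ ∀ e ∈ E(G), Γ' (Γ e) = e := by
  have : Nonempty α := ⟨hV.some⟩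
  have : Nonempty β := ⟨hE.some⟩
  have hF : ∀ v ∈ V(G), Function.invFunOn F V(G) (F v) = v := fun v hv =>
    h.injV.leftInvOn_invFunOn hv
  have hΓ : ∀ e ∈ E(G), Function.invFunOn Γ E(G) (Γ e) = e := fun e he =>
    h.injE.leftInvOn_invFunOn he
  refine ⟨Function.invFunOn F V(G), Function.invFunOn Γ E(G), ⟨?_, ?_, ?_, ?_, ?_⟩, hF, hΓ⟩
  · rw [← h.imgV]
    rintro - ⟨u, hu, rfl⟩ - ⟨v, hv, rfl⟩ huv
    rw [hF u hu, hF v hv] at huv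
    rw [huv]
  · rw [← h.imgV, Set.image_image]
    ext v
    constructor
    · rintro ⟨u, hu, rfl⟩
      simpa [hF u hu]
    · exact fun hv => ⟨v, hv, hF v hv⟩
  · rw [← h.imgE]
    rintro - ⟨u, hu, rfl⟩ - ⟨v, hv, rfl⟩ huv
    rw [hΓ u hu, hΓ v hv] at huv
    rw [huv]
  · rw [← h.imgE, Set.image_image]
    ext v
    constructor
    · rintro ⟨u, hu, rfl⟩
      simpa [hΓ u hu]
    · exact fun hv => ⟨v, hv, hΓ v hv⟩
  · intro e' x' y' hl
    obtain ⟨e, he, rfl⟩ : e' ∈ Γ '' E(G) := h.imgE ▸ hl.edge_mem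
    obtain ⟨x, hx, rfl⟩ : x' ∈ F '' V(G) := h.imgV ▸ hl.left_mem
    obtain ⟨y, hy, rfl⟩ : y' ∈ F '' V(G) := h.imgV ▸ hl.right_mem
    rw [hF x hx, hF y hy, hΓ e he]
    exact (h.link_iff he hx hy).1 hl

lemma order_eq (h : IsoVia G G' F Γ) : order G' = order G := by
  rw [order, ← h.imgV, Set.InjOn.ncard_image h.injV, order]

lemma cut_eq (h : IsoVia G G' F Γ) (X : Set α') : cut G' X = Γ '' cut G (F ⁻¹' X) := by
  ext e'
  constructor
  · rintro ⟨x', y', hl, hx', hy'⟩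
    obtain ⟨e, he, rfl⟩ : e' ∈ Γ '' E(G) := h.imgE ▸ hl.edge_mem
    obtain ⟨x, hx, rfl⟩ : x' ∈ F '' V(G) := h.imgV ▸ hl.left_mem
    obtain ⟨y, hy, rfl⟩ : y' ∈ F '' V(G) := h.imgV ▸ hl.right_mem
    exact ⟨e, ⟨x, y, (h.link_iff he hx hy).1 hl, hx', hy'⟩, rfl⟩
  · rintro ⟨e, ⟨x, y, hl, hx, hy⟩, rfl⟩
    exact ⟨F x, F y, h.link _ _ _ hl, hx, hy⟩

lemma cut_ncard (h : IsoVia G G' F Γ) (X : Set α') :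
    (cut G' X).ncard = (cut G (F ⁻¹' X)).ncard := by
  rw [h.cut_eq, Set.InjOn.ncard_image]
  refine h.injE.mono ?_
  rintro e ⟨x, y, hl, -, -⟩
  exact hl.edge_mem

lemma cut_image_ncard (h : IsoVia G G' F Γ) {X : Set α} (hX : X ⊆ V(G)) :
    (cut G' (F '' X)).ncard = (cut G X).ncard := by
  rw [h.cut_ncard]
  congr 1
  have key : ∀ v ∈ V(G), F v ∈ F '' X ↔ v ∈ X := fun v hv => h.injV.mem_image_iff hX hv
  ext e
  constructor
  · rintro ⟨x, y, hl, hx, hy⟩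
    exact ⟨x, y, hl, (key x hl.left_mem).1 hx, fun h' => hy ((key y hl.right_mem).2 h')⟩
  · rintro ⟨x, y, hl, hx, hy⟩
    exact ⟨x, y, hl, (key x hl.left_mem).2 hx, fun h' => hy ((key y hl.right_mem).1 h')⟩

lemma isNT_image (h : IsoVia G G' F Γ) {X : Set α} (hX : IsNT G X) : IsNT G' (F '' X) := by
  refine ⟨?_, ?_, ?_, ?_⟩
  · rw [← h.imgV]; exact Set.image_mono hX.1
  · rw [h.cut_image_ncard hX.1, hX.2.1]
  · exact hX.2.2.1.image_of_injOn (h.injV.mono hX.1)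
  · rw [← h.imgV, ← h.injV.image_sdiff_subset hX.1]
    exact hX.2.2.2.image_of_injOn (h.injV.mono Set.sdiff_subset)

lemma contract (h : IsoVia G G' F Γ) {X : Set α} {x : α} (hX : X ⊆ V(G)) (hx : x ∈ X) :
    IsoVia (contract G X x) (contract G' (F '' X) (F x)) F Γ := by
  have key : ∀ v ∈ V(G), F v ∈ F '' X ↔ v ∈ X := fun v hv => h.injV.mem_image_iff hX hv
  have hX' : F '' X ⊆ V(G') := h.imgV ▸ Set.image_mono hX
  have hcol : ∀ v ∈ V(G), collapse (F '' X) (F x) (F v) = F (collapse X x v) := by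
    intro v hv
    by_cases hvX : v ∈ X
    · rw [collapse_of_mem hvX, collapse_of_mem ((key v hv).2 hvX)]
    · rw [collapse_of_notMem hvX, collapse_of_notMem fun h' => hvX ((key v hv).1 h')]
  have hsub : V(CubicGraph.contract G X x) ⊆ V(G) := by
    rw [contract_verts' hX hx]
    exact Set.insert_subset (hX hx) Set.sdiff_subset
  have hEsub : E(CubicGraph.contract G X x) ⊆ E(G) := by
    intro e he
    obtain ⟨u, v, hl'⟩ := Graph.exists_isLink_of_mem_edgeSet he
    obtain ⟨y, z, hl, -⟩ := contract_isLink.1 hl'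
    exact hl.edge_mem
  have hlink : ∀ e u v, (CubicGraph.contract G X x).IsLink e u v →
      (CubicGraph.contract G' (F '' X) (F x)).IsLink (Γ e) (F u) (F v) := by
    intro e u v hl'
    obtain ⟨y, z, hl, h2, rfl, rfl⟩ := contract_isLink.1 hl'
    refine contract_isLink.2 ⟨F y, F z, h.link _ _ _ hl, ?_, hcol y hl.left_mem,
      hcol z hl.right_mem⟩
    rwa [key y hl.left_mem, key z hl.right_mem]
  refine ⟨h.injV.mono hsub, ?_, h.injE.mono hEsub, ?_, hlink⟩
  · rw [contract_verts, contract_verts, ← h.imgV, Set.image_image, Set.image_image]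
    exact Set.image_congr fun v hv => (hcol v hv).symm
  · ext e'
    constructor
    · rintro ⟨e, he, rfl⟩
      obtain ⟨u, v, hl⟩ := Graph.exists_isLink_of_mem_edgeSet he
      exact (hlink e u v hl).edge_mem
    · intro he'
      obtain ⟨u', v', hl'⟩ := Graph.exists_isLink_of_mem_edgeSet he'
      obtain ⟨y', z', hl, h2, rfl, rfl⟩ := contract_isLink.1 hl'
      obtain ⟨e, he, rfl⟩ : e' ∈ Γ '' E(G) := h.imgE ▸ hl.edge_mem
      obtain ⟨y, hy, rfl⟩ : y' ∈ F '' V(G) := h.imgV ▸ hl.left_mem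
      obtain ⟨z, hz, rfl⟩ : z' ∈ F '' V(G) := h.imgV ▸ hl.right_mem
      rw [key y hy, key z hz] at h2
      exact ⟨e, (contract_isLink.2 ⟨y, z, (h.link_iff he hy hz).1 hl, h2, rfl, rfl⟩).edge_mem, rfl⟩

lemma rep (h : IsoVia G G' F Γ) {A B : Finset α} {E : Finset β} {s t : β → α}
    (hG : Rep G A B E s t) {Γ' : β' → β} (hΓ : ∀ e ∈ E, Γ' (Γ e) = e) :
    Rep G' (A.image F) (B.image F) (E.image Γ) (fun e => F (s (Γ' e))) (fun e => F (t (Γ' e))) := by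
  have hA : ∀ v ∈ A, v ∈ V(G) := fun v hv => hG.mem_verts.2 (Or.inl hv)
  have hB : ∀ v ∈ B, v ∈ V(G) := fun v hv => hG.mem_verts.2 (Or.inr hv)
  have hE : ∀ e ∈ E, e ∈ E(G) := fun e he => hG.mem_edgeSet.2 he
  have hcard : ∀ (r : β → α) (v : α), v ∈ V(G) → (∀ e ∈ E, r e ∈ V(G)) →
      #{e ∈ E.image Γ | F (r (Γ' e)) = F v} = #{e ∈ E | r e = v} := by
    intro r v hv hr
    have : ({e ∈ E.image Γ | F (r (Γ' e)) = F v} : Finset β') = {e ∈ E | r e = v}.image Γ := by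
      ext e'
      simp only [Finset.mem_filter, Finset.mem_image]
      constructor
      · rintro ⟨⟨e, he, rfl⟩, h2⟩
        rw [hΓ e he] at h2
        exact ⟨e, ⟨he, h.injV (hr e he) hv h2⟩, rfl⟩
      · rintro ⟨e, ⟨he, rfl⟩, rfl⟩
        exact ⟨⟨e, he, rfl⟩, by rw [hΓ e he]⟩
    rw [this, Finset.card_image_of_injOn]
    intro e he e' he'
    simp only [Finset.coe_filter, Set.mem_ofPred_eq] at he he'
    exact h.injE (hE e he.1) (hE e' he'.1)
  refine ⟨?_, ?_, ?_, ?_, ?_, ?_, ?_, hG.nonempty.image F, ?_⟩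
  · rw [← h.imgV, hG.verts, Set.image_union, Finset.coe_image, Finset.coe_image]
  · rw [Finset.disjoint_left]
    intro v' hv hv'
    simp only [Finset.mem_image] at hv hv'
    obtain ⟨u, hu, rfl⟩ := hv
    obtain ⟨v, hv, huv⟩ := hv'
    rw [h.injV (hB v hv) (hA u hu) huv] at hv
    exact hG.notMem_B hu hv
  · intro e' x' y'
    constructor
    · intro hl
      obtain ⟨e, he, rfl⟩ : e' ∈ Γ '' E(G) := h.imgE ▸ hl.edge_mem
      obtain ⟨x, hx, rfl⟩ : x' ∈ F '' V(G) := h.imgV ▸ hl.left_mem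
      obtain ⟨y, hy, rfl⟩ : y' ∈ F '' V(G) := h.imgV ▸ hl.right_mem
      rw [h.link_iff he hx hy, hG.isLink] at hl
      rw [hΓ e hl.1]
      refine ⟨Finset.mem_image_of_mem Γ hl.1, ?_⟩
      rcases hl.2 with ⟨rfl, rfl⟩ | ⟨rfl, rfl⟩
      · exact Or.inl ⟨rfl, rfl⟩
      · exact Or.inr ⟨rfl, rfl⟩
    · rintro ⟨he, h2⟩
      rw [Finset.mem_image] at he
      obtain ⟨e, he, rfl⟩ := he
      rw [hΓ e he] at h2
      rcases h2 with ⟨rfl, rfl⟩ | ⟨rfl, rfl⟩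
      · exact h.link _ _ _ (hG.link he)
      · exact h.link _ _ _ (hG.link he).symm
  · intro e' he
    rw [Finset.mem_image] at he
    obtain ⟨e, he, rfl⟩ := he
    rw [hΓ e he]
    exact Finset.mem_image_of_mem F (hG.smem e he)
  · intro e' he
    rw [Finset.mem_image] at he
    obtain ⟨e, he, rfl⟩ := he
    rw [hΓ e he]
    exact Finset.mem_image_of_mem F (hG.tmem e he)
  · intro v' hv
    rw [Finset.mem_image] at hv
    obtain ⟨v, hv, rfl⟩ := hv
    rw [hcard s v (hA v hv) fun e he => hG.s_mem he, hG.degA v hv]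
  · intro v' hv
    rw [Finset.mem_image] at hv
    obtain ⟨v, hv, rfl⟩ := hv
    rw [hcard t v (hB v hv) fun e he => hG.t_mem he, hG.degB v hv]
  · rintro X ⟨u', hu', huX⟩ ⟨v', hv', hvX⟩
    obtain ⟨u, hu, rfl⟩ : u' ∈ F '' V(G) := h.imgV ▸ hu'
    obtain ⟨v, hv, rfl⟩ : v' ∈ F '' V(G) := h.imgV ▸ hv'
    obtain ⟨e, he, h1⟩ := hG.conn (F ⁻¹' X) ⟨u, hu, huX⟩ ⟨v, hv, hvX⟩
    exact ⟨Γ e, Finset.mem_image_of_mem Γ he, by rw [hΓ e he]; exact h1⟩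

lemma deg_restrict (h : IsoVia G G' F Γ) {M : Set β} (hM : M ⊆ E(G)) {v : α} (hv : v ∈ V(G)) :
    deg (G'.restrict (Γ '' M)) (F v) = deg (G.restrict M) v := by
  rw [deg, deg]
  have : (G'.restrict (Γ '' M)).incidenceSet (F v) = Γ '' (G.restrict M).incidenceSet v := by
    ext e'
    simp only [Graph.mem_incidenceSet, Graph.restrict_inc, Set.mem_image]
    constructor
    · rintro ⟨⟨y', hl⟩, e, he, rfl⟩
      obtain ⟨y, hy, rfl⟩ : y' ∈ F '' V(G) := h.imgV ▸ hl.right_mem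
      exact ⟨e, ⟨⟨y, (h.link_iff (hM he) hv hy).1 hl⟩, he⟩, rfl⟩
    · rintro ⟨e, ⟨⟨y, hl⟩, he⟩, rfl⟩
      exact ⟨⟨F y, h.link _ _ _ hl⟩, e, he, rfl⟩
  rw [this, Set.InjOn.ncard_image]
  refine h.injE.mono fun e he => ?_
  exact (((G.restrict M).mem_incidenceSet v e).1 he).edge_mem.1

lemma isLambdaMatchablePair (h : IsoVia G G' F Γ) {a b : α} (ha : a ∈ V(G)) (hb : b ∈ V(G))
    (hab : IsLambdaMatchablePair G a b) : IsLambdaMatchablePair G' (F a) (F b) := by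
  obtain ⟨M, hM, h1, h2, h3⟩ := hab
  refine ⟨Γ '' M, ?_, by rw [h.deg_restrict hM ha, h1], by rw [h.deg_restrict hM hb, h2], ?_⟩
  · rw [← h.imgE]; exact Set.image_mono hM
  · intro v' hv' hva hvb
    obtain ⟨v, hv, rfl⟩ : v' ∈ F '' V(G) := h.imgV ▸ hv'
    rw [h.deg_restrict hM hv]
    exact h3 v hv (fun h => hva (h ▸ rfl)) fun h => hvb (h ▸ rfl)

end IsoVia

lemma Cub.verts_nonempty {G : Graph α β} (hG : Cub G) : V(G).Nonempty := by
  obtain ⟨A, B, E, s, t, h⟩ := hG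
  exact h.isConnected.1

lemma Cub.edges_nonempty {G : Graph α β} (hG : Cub G) : E(G).Nonempty := by
  obtain ⟨A, B, E, s, t, h⟩ := hG
  obtain ⟨a, ha⟩ := h.nonempty
  have := h.degA a ha
  obtain ⟨e, he⟩ := Finset.card_pos.1 (by omega : 0 < #{e ∈ E | s e = a})
  exact ⟨e, h.mem_edgeSet.2 (Finset.mem_filter.1 he).1⟩

lemma Cub.exists_isoVia {G : Graph α β} (hG : Cub G) {G' : Graph α' β'} (h : Iso G G') :
    ∃ F Γ, IsoVia G G' F Γ := h.exists_isoVia hG.verts_nonempty hG.edges_nonempty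

lemma Cub.of_isoVia {G : Graph α β} (hG : Cub G) {G' : Graph α' β'} {F : α → α'} {Γ : β → β'}
    (h : IsoVia G G' F Γ) : Cub G' := by
  obtain ⟨F', Γ', -, -, hΓ⟩ := h.exists_symm hG.verts_nonempty hG.edges_nonempty
  obtain ⟨A, B, E, s, t, hG⟩ := hG
  exact ⟨_, _, _, _, _, h.rep hG fun e he => hΓ e (hG.mem_edgeSet.2 he)⟩

lemma Cub.isLambdaMatchablePair_iff {G : Graph α β} (hG : Cub G) {G' : Graph α' β'} {F : α → α'}
    {Γ : β → β'} (h : IsoVia G G' F Γ) {a b : α} (ha : a ∈ V(G)) (hb : b ∈ V(G)) :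
    IsLambdaMatchablePair G' (F a) (F b) ↔ IsLambdaMatchablePair G a b := by
  refine ⟨fun h' => ?_, h.isLambdaMatchablePair ha hb⟩
  obtain ⟨F', Γ', h2, hF, -⟩ := h.exists_symm hG.verts_nonempty hG.edges_nonempty
  have := h2.isLambdaMatchablePair (h.memV ha) (h.memV hb) h'
  rwa [hF a ha, hF b hb] at this

lemma Cub.numPartners_eq {G : Graph α β} (hG : Cub G) {G' : Graph α' β'} {F : α → α'}
    {Γ : β → β'} (h : IsoVia G G' F Γ) {u : α} (hu : u ∈ V(G)) :
    numPartners G' (F u) = numPartners G u := by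
  have : {v ∈ V(G') | v ≠ F u ∧ IsLambdaMatchablePair G' (F u) v} =
      F '' {v ∈ V(G) | v ≠ u ∧ IsLambdaMatchablePair G u v} := by
    ext v'
    constructor
    · rintro ⟨hv', h1, h2⟩
      obtain ⟨v, hv, rfl⟩ : v' ∈ F '' V(G) := h.imgV ▸ hv'
      exact ⟨v, ⟨hv, fun h3 => h1 (h3 ▸ rfl), (hG.isLambdaMatchablePair_iff h hu hv).1 h2⟩, rfl⟩
    · rintro ⟨v, ⟨hv, h1, h2⟩, rfl⟩
      exact ⟨h.memV hv, fun h3 => h1 (h.injV hv hu h3), h.isLambdaMatchablePair hu hv h2⟩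
  rw [numPartners, this, Set.InjOn.ncard_image, numPartners]
  exact h.injV.mono fun v hv => hv.1

/-- The number of ordered pairs of distinct vertices that are `λ`-matchable. -/
noncomputable def rhoOrd (G : Graph α β) : ℕ :=
  {p : α × α | p.1 ∈ V(G) ∧ p.2 ∈ V(G) ∧ p.1 ≠ p.2 ∧ IsLambdaMatchablePair G p.1 p.2}.ncard

lemma Cub.rhoOrd_eq {G : Graph α β} (hG : Cub G) {G' : Graph α' β'} {F : α → α'}
    {Γ : β → β'} (h : IsoVia G G' F Γ) : rhoOrd G' = rhoOrd G := by
  have : {p : α' × α' | p.1 ∈ V(G') ∧ p.2 ∈ V(G') ∧ p.1 ≠ p.2 ∧ IsLambdaMatchablePair G' p.1 p.2} =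
      Prod.map F F ''
      {p : α × α | p.1 ∈ V(G) ∧ p.2 ∈ V(G) ∧ p.1 ≠ p.2 ∧ IsLambdaMatchablePair G p.1 p.2} := by
    ext ⟨u', v'⟩
    constructor
    · rintro ⟨hu', hv', h1, h2⟩
      dsimp only at hu' hv' h1 h2
      obtain ⟨v, hv, rfl⟩ : v' ∈ F '' V(G) := h.imgV ▸ hv'
      obtain ⟨u, hu, rfl⟩ : u' ∈ F '' V(G) := h.imgV ▸ hu'
      exact ⟨(u, v), ⟨hu, hv, fun h3 => h1 (by rw [show u = v from h3]),
        (hG.isLambdaMatchablePair_iff h hu hv).1 h2⟩, rfl⟩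
    · rintro ⟨⟨u, v⟩, ⟨hu, hv, h1, h2⟩, h3⟩
      cases h3
      exact ⟨h.memV hu, h.memV hv, fun h3 => h1 (h.injV hu hv h3),
        h.isLambdaMatchablePair hu hv h2⟩
  rw [rhoOrd, this, Set.InjOn.ncard_image, rhoOrd]
  rintro ⟨u, v⟩ ⟨hu, hv, -⟩ ⟨u', v'⟩ ⟨hu', hv', -⟩ h3
  rw [Prod.map_apply, Prod.map_apply, Prod.mk.injEq] at h3
  exact Prod.ext (h.injV hu hu' h3.1) (h.injV hv hv' h3.2)

/-- All cuts have at least three edges. -/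
def TEC (G : Graph α β) : Prop :=
  ∀ X : Set α, (∃ u ∈ V(G), u ∈ X) → (∃ v ∈ V(G), v ∉ X) → 3 ≤ (cut G X).ncard

lemma TEC.of_isoVia {G : Graph α β} (hG : TEC G) {G' : Graph α' β'} {F : α → α'}
    {Γ : β → β'} (h : IsoVia G G' F Γ) : TEC G' := by
  rintro X ⟨u', hu', huX⟩ ⟨v', hv', hvX⟩
  obtain ⟨v, hv, rfl⟩ : v' ∈ F '' V(G) := h.imgV ▸ hv'
  obtain ⟨u, hu, rfl⟩ : u' ∈ F '' V(G) := h.imgV ▸ hu'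
  rw [h.cut_ncard]
  exact hG _ ⟨u, hu, huX⟩ ⟨v, hv, hvX⟩

/-- Every cut of the contraction is a cut of G, by `cut_contract`; so 3-edge-connectedness survives
the whole tight cut procedure. -/
lemma TEC.contract {G : Graph α β} (hG : TEC G) (X : Set α) (x : α) : TEC (contract G X x) := by
  rintro Z ⟨u', hu, huX⟩ ⟨v', hv, hvX⟩
  rw [contract_verts] at hu hv
  obtain ⟨u, hu, rfl⟩ := hu
  obtain ⟨v, hv, rfl⟩ := hv
  rw [cut_contract]
  exact hG _ ⟨u, hu, hu, huX⟩ ⟨v, hv, fun h => hvX h.2⟩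

/-- The name of the contraction vertex does not matter. -/
lemma contract_isoVia {G : Graph α β} {X : Set α} {x x' : α} (hX : X ⊆ V(G)) (hx : x ∈ X)
    (hx' : x' ∈ X) : IsoVia (contract G X x) (contract G X x') (fun v => if v = x then x' else v)
      id := by
  have key : ∀ v, (if collapse X x v = x then x' else collapse X x v) = collapse X x' v := by
    intro v
    by_cases hv : v ∈ X
    · simp [collapse_of_mem hv]
    · rw [collapse_of_notMem hv, collapse_of_notMem hv, if_neg]
      rintro rfl
      exact hv hx
  have hlink : ∀ e u v, (contract G X x).IsLink e u v →
      (contract G X x').IsLink (id e) (if u = x then x' else u) (if v = x then x' else v) := by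
    intro e u v hl'
    obtain ⟨y, z, hl, h2, rfl, rfl⟩ := contract_isLink.1 hl'
    rw [key, key]
    exact contract_isLink.2 ⟨y, z, hl, h2, rfl, rfl⟩
  refine ⟨?_, ?_, Set.injOn_id _, ?_, hlink⟩
  · rw [contract_verts' hX hx]
    intro u hu v hv huv
    dsimp only at huv
    have key2 : ∀ u ∈ insert x (V(G) \ X), u ≠ x → u ∉ X := by
      rintro u (rfl | hu) h
      · exact absurd rfl h
      · exact hu.2
    have := key2 u hu
    have := key2 v hv
    split_ifs at huv with h1 h2 h2
    · rw [h1, h2]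
    · subst huv; tauto
    · subst huv; tauto
    · exact huv
  · rw [contract_verts, contract_verts, Set.image_image]
    exact Set.image_congr fun v _ => key v
  · rw [Set.image_id]
    ext e
    simp only [Graph.edgeSet_eq_setOfPred_exists_isLink, Set.mem_ofPred_eq, contract_isLink]
    constructor
    · rintro ⟨-, -, y, z, h1, h2, -, -⟩
      exact ⟨_, _, y, z, h1, h2, rfl, rfl⟩
    · rintro ⟨-, -, y, z, h1, h2, -, -⟩
      exact ⟨_, _, y, z, h1, h2, rfl, rfl⟩

end Isomorphisms

section TightCutDecompositions

variable {α β α' β' : Type*}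

/-! ### The weight of a tight cut decomposition -/

/-- The contribution of a brace of order `n` to `b̃ + 3 b'`. -/
noncomputable def leafWt (n : ℕ) : ℚ := if 6 ≤ n then ((n : ℚ) / 2) ^ 2 + 3 else 0

/-- The sum of the contributions of the graphs in a list. -/
noncomputable def wt (L : Multiset (Graph α β)) : ℚ := (L.map fun K => leafWt (order K)).sum

lemma wt_add (L L' : Multiset (Graph α β)) : wt (L + L') = wt L + wt L' := by
  simp [wt]

lemma wt_singleton (G : Graph α β) : wt {G} = leafWt (order G) := by
  simp [wt]

lemma order_contract_lt {G : Graph α β} (hG : V(G).Finite) {X : Set α} {x : α} (hXV : X ⊆ V(G))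
    (hX : X.Nontrivial) (hx : x ∈ X) : order (contract G X x) < order G := by
  have h1 := order_contract hG hXV hx
  have h2 : 1 < X.ncard := (Set.one_lt_ncard (hG.subset hXV)).2 hX
  omega

lemma Cub.contract_compl {G : Graph α β} (hG : Cub G) {X : Set α} {y : α}
    (hX : (cut G X).ncard = 3) (hy : y ∈ V(G) \ X) : Cub (CubicGraph.contract G (V(G) \ X) y) := by
  refine hG.contract Set.sdiff_subset ?_ hy
  obtain ⟨A, B, E, s, t, h⟩ := hG
  rw [h.cut_compl, hX]

lemma Cub.exists_tightCutDecomposition {G : Graph α β} (hG : Cub G) :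
    ∃ L, IsTightCutDecomposition G L := by
  induction hn : order G using Nat.strong_induction_on generalizing G with
  | _ n ih =>
    subst hn
    by_cases h : ∃ X, IsNT G X
    · obtain ⟨X, hX⟩ := h
      obtain ⟨x, hx⟩ := hX.2.2.1.nonempty
      obtain ⟨y, hy⟩ := hX.2.2.2.nonempty
      obtain ⟨L₁, h₁⟩ := ih _ (order_contract_lt hG.finite hX.1 hX.2.2.1 hx)
        (hG.contract hX.1 hX.2.1 hx) rfl
      obtain ⟨L₂, h₂⟩ := ih _ (order_contract_lt hG.finite Set.sdiff_subset hX.2.2.2 hy)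
        (hG.contract_compl hX.2.1 hy) rfl
      exact ⟨_, .step G X x y L₁ L₂ (hG.isNontrivialTightCut_iff.2 hX) hx hy h₁ h₂⟩
    · push Not at h
      exact ⟨_, .leaf G fun X hX => h X (hG.isNontrivialTightCut_iff.1 hX)⟩

/-- Transports a decomposition step by step. It is needed because contraction vertices are chosen
arbitrarily, and because crossing cuts yield contractions that are only isomorphic. -/
lemma tightCutDecomposition_of_isoVia {G : Graph α β} {L : Multiset (Graph α β)}
    (hL : IsTightCutDecomposition G L) (hG : Cub G) {G' : Graph α' β'} {F : α → α'} {Γ : β → β'}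
    (h : IsoVia G G' F Γ) : ∃ L', IsTightCutDecomposition G' L' ∧ wt L' = wt L := by
  induction hL generalizing G' with
  | leaf G hl =>
    refine ⟨{G'}, .leaf G' fun X hX => ?_, by rw [wt_singleton, wt_singleton, h.order_eq]⟩
    obtain ⟨F', Γ', h', -⟩ := h.exists_symm hG.verts_nonempty hG.edges_nonempty
    exact hl _ (hG.isNontrivialTightCut_iff.2
      (h'.isNT_image ((hG.of_isoVia h).isNontrivialTightCut_iff.1 hX)))
  | step G X x y L₁ L₂ hX hx hy h₁ h₂ ih₁ ih₂ =>
    rw [hG.isNontrivialTightCut_iff] at hX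
    obtain ⟨L₁', k₁, e₁⟩ := ih₁ (hG.contract hX.1 hX.2.1 hx) (h.contract hX.1 hx)
    obtain ⟨L₂', k₂, e₂⟩ := ih₂ (hG.contract_compl hX.2.1 hy) (h.contract Set.sdiff_subset hy)
    rw [h.injV.image_sdiff_subset hX.1, h.imgV] at k₂
    refine ⟨L₁' + L₂', .step G' (F '' X) (F x) (F y) L₁' L₂'
      ((hG.of_isoVia h).isNontrivialTightCut_iff.2 (h.isNT_image hX))
      (Set.mem_image_of_mem F hx) ?_ k₁ k₂, by rw [wt_add, wt_add, e₁, e₂]⟩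
    rw [← h.imgV, ← h.injV.image_sdiff_subset hX.1]
    exact Set.mem_image_of_mem F hy

/-- The weight of any tight cut decomposition of `G`. -/
noncomputable def tv (G : Graph α β) : ℚ :=
  if h : ∃ L, IsTightCutDecomposition G L then wt h.choose else 0

/-- The weight of tight cut decompositions is unique for graphs of order less than `n`. -/
def UniqueBelow (α β : Type*) (n : ℕ) : Prop :=
  ∀ G : Graph α β, Cub G → order G < n → ∀ L, IsTightCutDecomposition G L → wt L = tv G

lemma UniqueBelow.isoVia {n : ℕ} (hn : UniqueBelow α β n) {G G' : Graph α β} (hG : Cub G)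
    (ho : order G < n) {F : α → α} {Γ : β → β} (h : IsoVia G G' F Γ) : tv G' = tv G := by
  obtain ⟨L, hL⟩ := hG.exists_tightCutDecomposition
  obtain ⟨L', hL', e⟩ := tightCutDecomposition_of_isoVia hL hG h
  rw [← hn G hG ho L hL, ← hn G' (hG.of_isoVia h) (h.order_eq ▸ ho) L' hL', e]

lemma UniqueBelow.step {n : ℕ} (hn : UniqueBelow α β n) {G : Graph α β} (hG : Cub G)
    (ho : order G < n) {X : Set α} {x y : α} (hX : IsNT G X) (hx : x ∈ X) (hy : y ∈ V(G) \ X) :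
    tv G = tv (contract G X x) + tv (contract G (V(G) \ X) y) := by
  obtain ⟨L₁, h₁⟩ := (hG.contract hX.1 hX.2.1 hx).exists_tightCutDecomposition
  obtain ⟨L₂, h₂⟩ := (hG.contract_compl hX.2.1 hy).exists_tightCutDecomposition
  rw [← hn G hG ho _ (.step G X x y L₁ L₂ (hG.isNontrivialTightCut_iff.2 hX) hx hy h₁ h₂), wt_add,
    hn _ (hG.contract hX.1 hX.2.1 hx)
      ((order_contract_lt hG.finite hX.1 hX.2.2.1 hx).trans ho) _ h₁,
    hn _ (hG.contract_compl hX.2.1 hy)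
      ((order_contract_lt hG.finite Set.sdiff_subset hX.2.2.2 hy).trans ho) _ h₂]

/-- The weight obtained by first using the cut `∂(X)`, for some choice of contraction vertices. -/
noncomputable def cutWt (G : Graph α β) (X : Set α) : ℚ :=
  (if h : X.Nonempty then tv (contract G X h.some) else 0) +
  if h : (V(G) \ X).Nonempty then tv (contract G (V(G) \ X) h.some) else 0

lemma UniqueBelow.cutWt_eq {n : ℕ} (hn : UniqueBelow α β n) {G : Graph α β} (hG : Cub G)
    (ho : order G ≤ n) {X : Set α} {x y : α} (hX : IsNT G X) (hx : x ∈ X) (hy : y ∈ V(G) \ X) :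
    cutWt G X = tv (contract G X x) + tv (contract G (V(G) \ X) y) := by
  have h1 : X.Nonempty := ⟨x, hx⟩
  have h2 : (V(G) \ X).Nonempty := ⟨y, hy⟩
  rw [cutWt, dif_pos h1, dif_pos h2]
  congr 1
  · exact hn.isoVia (hG.contract hX.1 hX.2.1 hx)
      ((order_contract_lt hG.finite hX.1 hX.2.2.1 hx).trans_le ho)
      (contract_isoVia hX.1 hx h1.some_mem)
  · exact hn.isoVia (hG.contract_compl hX.2.1 hy)
      ((order_contract_lt hG.finite Set.sdiff_subset hX.2.2.2 hy).trans_le ho)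
      (contract_isoVia Set.sdiff_subset hy h2.some_mem)

lemma cutWt_compl {G : Graph α β} {X : Set α} (hX : X ⊆ V(G)) :
    cutWt G (V(G) \ X) = cutWt G X := by
  rw [cutWt, cutWt, add_comm, Set.sdiff_sdiff_cancel_left hX]

/-- Both first steps can be refined to the same three graphs: shrink Y, shrink the complement of X,
or shrink both X and the complement of Y. Indeed ∂(Y) survives as a nontrivial tight cut when X is
shrunk, and ∂(X) survives when the complement of Y is shrunk; uniqueness for the smaller graphs
allows the use of these cuts. -/
lemma UniqueBelow.nested {n : ℕ} (hn : UniqueBelow α β n) {G : Graph α β} (hG : Cub G)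
    (ho : order G ≤ n) {X Y : Set α} (hX : IsNT G X) (hY : IsNT G Y) (hXY : X ⊆ Y) :
    cutWt G X = cutWt G Y := by
  by_cases hne : X = Y
  · rw [hne]
  obtain ⟨y, hyY, hyX⟩ : ∃ y ∈ Y, y ∉ X := by
    by_contra hcon
    push Not at hcon
    exact hne (hXY.antisymm hcon)
  obtain ⟨x, hx⟩ := hX.2.2.1.nonempty
  obtain ⟨w, hw⟩ := hY.2.2.2.nonempty
  have hwX : w ∈ V(G) \ X := ⟨hw.1, fun h => hw.2 (hXY h)⟩
  have hc : (cut G (V(G) \ Y)).ncard = 3 := (hG.isNT_compl hY).2.1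
  rw [hn.cutWt_eq hG ho hX hx hwX, hn.cutWt_eq hG ho hY (hXY hx) hw]
  have v1 : V(contract G X x) = insert x (V(G) \ X) := contract_verts' hX.1 hx
  have v2 : V(contract G (V(G) \ Y) w) = insert w Y := by
    rw [contract_verts' Set.sdiff_subset hw, Set.sdiff_sdiff_cancel_left hY.1]
  have hZsub : insert x (Y \ X) ⊆ V(contract G X x) := by
    rw [v1]
    exact Set.insert_subset_insert (Set.sdiff_subset_sdiff_left hY.1)
  have hZexp : expand G X x (insert x (Y \ X)) = Y := by
    rw [expand_of_mem hX.1 hZsub hx (Set.mem_insert _ _), Set.insert_union,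
      Set.sdiff_union_of_subset hXY, Set.insert_eq_of_mem (hXY hx)]
  have hZc : V(contract G X x) \ insert x (Y \ X) = V(G) \ Y := by
    rw [v1]
    ext v
    have := @hXY v
    have : v = x → v ∈ X := fun h => h ▸ hx
    simp only [Set.mem_sdiff, Set.mem_insert_iff]
    tauto
  have nt1 : IsNT (contract G X x) (insert x (Y \ X)) := by
    refine ⟨hZsub, ?_, ?_, ?_⟩
    · rw [cut_contract, hZexp, hY.2.1]
    · exact ⟨x, Set.mem_insert _ _, y, Set.mem_insert_of_mem _ ⟨hyY, hyX⟩, fun h => hyX (h ▸ hx)⟩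
    · rw [hZc]; exact hY.2.2.2
  have hXsub : X ⊆ V(contract G (V(G) \ Y) w) := by
    rw [v2]; exact hXY.trans (Set.subset_insert _ _)
  have hwnX : w ∉ X := hwX.2
  have hwc : w ∈ V(contract G (V(G) \ Y) w) \ X := ⟨by rw [v2]; exact Set.mem_insert _ _, hwnX⟩
  have nt2 : IsNT (contract G (V(G) \ Y) w) X := by
    refine ⟨hXsub, ?_, hX.2.2.1, ?_⟩
    · rw [cut_contract, expand_of_notMem Set.sdiff_subset hXsub hw hwnX, hX.2.1]
    · exact ⟨w, hwc, y, ⟨by rw [v2]; exact Set.mem_insert_of_mem _ hyY, hyX⟩,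
        fun h => hw.2 (h ▸ hyY)⟩
  have o1 := (order_contract_lt hG.finite hX.1 hX.2.2.1 hx).trans_le ho
  have o2 := (order_contract_lt hG.finite Set.sdiff_subset hY.2.2.2 hw).trans_le ho
  have e2 : expand G (V(G) \ Y) w (V(contract G (V(G) \ Y) w) \ X) = V(G) \ X := by
    rw [expand_of_mem Set.sdiff_subset Set.sdiff_subset hw hwc, v2]
    ext v
    have := @hXY v
    have : v = w → v ∉ Y ∧ v ∈ V(G) := fun h => h ▸ hw.symm
    have := @hY.1 v
    simp only [Set.mem_sdiff, Set.mem_insert_iff, Set.mem_union]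
    tauto
  rw [hn.step (hG.contract hX.1 hX.2.1 hx) o1 nt1 (Set.mem_insert _ _) (hZc ▸ hw),
    hn.step (hG.contract Set.sdiff_subset hc hw) o2 nt2 hx hwc,
    contract_contract (Set.mem_insert _ _), hZexp, hZc,
    contract_contract hwc, e2, contract_comm hx hw]
  · ring
  · rw [Set.disjoint_left]
    exact fun v h1 h2 => h2.2 (hXY h1)

/-! ### Uncrossing tight cuts: the total weight is independent of the choices. -/

lemma isoVia_of_rep {G : Graph α β} {A B : Finset α} {E : Finset β} {s t : β → α}
    {G' : Graph α' β'} {A' B' : Finset α'} {E' : Finset β'} {s' t' : β' → α'}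
    (h : Rep G A B E s t) (h' : Rep G' A' B' E' s' t') {F : α → α'} {Γ : β → β'}
    (hF : Set.InjOn F V(G)) (hF' : F '' V(G) = V(G')) (hΓ : Set.BijOn Γ E E')
    (hs : ∀ e ∈ E, s' (Γ e) = F (s e)) (ht : ∀ e ∈ E, t' (Γ e) = F (t e)) : IsoVia G G' F Γ := by
  refine ⟨hF, hF', by rw [h.edgeSet]; exact hΓ.injOn, by rw [h.edgeSet, h'.edgeSet, hΓ.image_eq],
    fun e x y hl => ?_⟩
  obtain ⟨he, h1⟩ := (h.isLink _ _ _).1 hl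
  refine (h'.isLink _ _ _).2 ⟨hΓ.mapsTo he, ?_⟩
  rw [hs e he, ht e he]
  rcases h1 with ⟨rfl, rfl⟩ | ⟨rfl, rfl⟩
  · exact Or.inl ⟨rfl, rfl⟩
  · exact Or.inr ⟨rfl, rfl⟩

namespace Rep

variable {G : Graph α β} {A B : Finset α} {E : Finset β} {s t : β → α}

/-- If two crossing tight cuts have trivial corners then two of their contractions are
isomorphic. -/
lemma exists_isoVia_of_crossing (h : Rep G A B E s t) {X Y : Set α} (hXV : X ⊆ V(G))
    (hYV : Y ⊆ V(G)) (hX : IsOut E s t X) (hY : IsOut E s t Y) {u v : α} (hu : X ∩ Y = {u})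
    (hv : V(G) \ (X ∪ Y) = {v}) (huA : u ∈ A) :
    ∃ F Γ, IsoVia (CubicGraph.contract G X u) (CubicGraph.contract G (V(G) \ Y) v) F Γ := by
  have hu1 : ∀ w, w ∈ X ∧ w ∈ Y ↔ w = u := fun w => by
    rw [← Set.mem_inter_iff, hu, Set.mem_singleton_iff]
  have hv1 : ∀ w, w ∈ V(G) ∧ w ∉ X ∧ w ∉ Y ↔ w = v := fun w => by
    rw [← Set.mem_singleton_iff, ← hv, Set.mem_sdiff, Set.mem_union, not_or]
  have huX := (hu1 u).2 rfl
  have hvX := (hv1 v).2 rfl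
  have hvc : v ∈ V(G) \ Y := ⟨hvX.1, hvX.2.2⟩
  set P' : Finset β := {e ∈ E | (s e ∈ X ∧ s e ∉ Y) ∧ t e = v} with hP'
  set P : Finset β := {e ∈ E | s e = u ∧ t e ∈ X} with hP
  -- Both contractions have the vertex set (Y \ X) ∪ {u, v}; they differ only in which edges become
  -- parallel edges from u to v. These are P' when X is shrunk and P when the complement of Y is
  -- shrunk, besides common ones. Both numbers equal 3 minus the number of edges from u that leave
  -- X: one by the degree of u, the other by the size of ∂(X).
  have hcard : #P' = #P := by
    have h1 : #P + #{e ∈ E | s e = u ∧ t e ∉ X} = 3 := by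
      rw [← h.degA u huA,
        ← Finset.card_filter_add_card_filter_not (s := {e ∈ E | s e = u}) (fun e => t e ∈ X)]
      congr 2 <;> ext e <;> simp only [hP, Finset.mem_filter] <;> tauto
    have h2 : #{e ∈ E | s e = u ∧ t e ∉ X} + #P' = 3 := by
      rw [← hX.2, ← Finset.card_filter_add_card_filter_not (s := {e ∈ E | s e ∈ X ∧ t e ∉ X})
        (fun e => s e = u), Finset.filter_filter, Finset.filter_filter]
      congr 2
      · ext e
        simp only [Finset.mem_filter]
        have : s e = u → s e ∈ X := fun h => h ▸ huX.1
        tauto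
      · ext e
        simp only [hP', Finset.mem_filter]
        constructor
        · rintro ⟨he, ⟨h1, h2⟩, h3⟩
          exact ⟨he, ⟨h1, h3 ▸ hvX.2.1⟩, fun h4 => h2 (h4 ▸ huX.2)⟩
        · rintro ⟨he, ⟨h1, h2⟩, h3⟩
          have h4 : s e ∉ Y := fun h4 => h3 ((hu1 _).1 ⟨h1, h4⟩)
          exact ⟨he, ⟨h1, h4⟩, (hv1 _).1 ⟨h.t_mem he, h2, fun h5 => h4 (hY.1 e he h5)⟩⟩
    omega
  let f : P' ≃ P := Finset.equivOfCardEq hcard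
  -- Exchange P' for P by any bijection and fix all other edges; the vertices are fixed as well.
  set Γ : β → β := fun e => if he : e ∈ P' then (f ⟨e, he⟩ : β) else e with hΓ
  have Γ1 : ∀ (e) (he : e ∈ P'), Γ e = (f ⟨e, he⟩ : β) := fun e he => dif_pos he
  have Γ2 : ∀ e, e ∉ P' → Γ e = e := fun e he => dif_neg he
  have r1 := h.contract hXV hX huX.1
  have r2 := h.contract_compl hY hvc
  have hPE : ∀ e ∈ P, e ∈ E ∧ s e = u ∧ t e ∈ X ∧ t e ∉ Y := by
    intro e he
    simp only [hP, Finset.mem_filter] at he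
    refine ⟨he.1, he.2.1, he.2.2, fun h3 => ?_⟩
    exact h.notMem_B huA ((hu1 _).1 ⟨he.2.2, h3⟩ ▸ h.tmem e he.1)
  have hout : ∀ e ∈ E, t e ∉ X → e ∉ P' → s e ∈ Y ∧ (t e = v ∨ t e ∈ Y) := by
    intro e he h1 h2
    simp only [hP', Finset.mem_filter] at h2
    have h3 := hY.1 e he
    have h4 := hv1 (t e)
    have h5 := h.t_mem he
    have h6 := hv1 (s e)
    have h7 := h.s_mem he
    have h8 : s e ≠ v := by
      intro h8
      have : v ∈ B := by
        by_cases h9 : t e ∈ Y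
        · exact absurd (h3 h9) (h8 ▸ hvX.2.2)
        · have := h4.1 ⟨h5, h1, h9⟩
          rw [← this]; exact h.tmem e he
      exact h.notMem_A this (h8 ▸ h.smem e he)
    tauto
  have hV1 : V(CubicGraph.contract G X u) = V(CubicGraph.contract G (V(G) \ Y) v) := by
    rw [contract_verts' hXV huX.1, contract_verts' Set.sdiff_subset hvc,
      Set.sdiff_sdiff_cancel_left hYV]
    ext w
    have := hu1 w
    have := hv1 w
    have := @hXV w
    have := @hYV w
    simp only [Set.mem_insert_iff, Set.mem_sdiff]
    tauto
  refine ⟨id, Γ, isoVia_of_rep r1 r2 (Set.injOn_id _) (by rw [Set.image_id, hV1]) ⟨?_, ?_, ?_⟩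
    ?_ ?_⟩
  · intro e he
    simp only [Finset.coe_filter, Set.mem_ofPred_eq] at he ⊢
    by_cases hep : e ∈ P'
    · rw [Γ1 e hep]
      have := hPE _ (f ⟨e, hep⟩).2
      exact ⟨this.1, this.2.1 ▸ huX.2⟩
    · rw [Γ2 e hep]
      exact ⟨he.1, (hout e he.1 he.2 hep).1⟩
  · intro e he e' he' hee
    simp only [Finset.coe_filter, Set.mem_ofPred_eq] at he he'
    by_cases hep : e ∈ P' <;> by_cases hep' : e' ∈ P'
    · rw [Γ1 e hep, Γ1 e' hep', Subtype.coe_inj, EmbeddingLike.apply_eq_iff_eq,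
        Subtype.mk.injEq] at hee
      exact hee
    · rw [Γ1 e hep, Γ2 e' hep'] at hee
      have := hPE _ (f ⟨e, hep⟩).2
      rw [hee] at this
      exact absurd this.2.2.1 he'.2
    · rw [Γ2 e hep, Γ1 e' hep'] at hee
      have := hPE _ (f ⟨e', hep'⟩).2
      rw [← hee] at this
      exact absurd this.2.2.1 he.2
    · rwa [Γ2 e hep, Γ2 e' hep'] at hee
  · intro e he
    simp only [Finset.coe_filter, Set.mem_ofPred_eq] at he
    by_cases hep : e ∈ P
    · refine ⟨(f.symm ⟨e, hep⟩ : β), ?_, ?_⟩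
      · have := (f.symm ⟨e, hep⟩).2
        simp only [hP', Finset.mem_filter] at this
        simp only [Finset.coe_filter, Set.mem_ofPred_eq]
        exact ⟨this.1, this.2.2 ▸ hvX.2.1⟩
      · rw [Γ1 _ (f.symm ⟨e, hep⟩).2]
        simp
    · refine ⟨e, ?_, Γ2 e ?_⟩
      · simp only [Finset.coe_filter, Set.mem_ofPred_eq]
        refine ⟨he.1, fun h1 => hep ?_⟩
        simp only [hP, Finset.mem_filter]
        exact ⟨he.1, (hu1 _).1 ⟨hX.1 e he.1 h1, he.2⟩, h1⟩
      · simp only [hP', Finset.mem_filter]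
        tauto
  · intro e he
    simp only [Finset.mem_filter] at he
    by_cases hep : e ∈ P'
    · rw [Γ1 e hep, (hPE _ (f ⟨e, hep⟩).2).2.1]
      simp only [hP', Finset.mem_filter] at hep
      rw [collapse_of_mem hep.2.1.1, id]
    · rw [Γ2 e hep, id]
      have h1 := hout e he.1 he.2 hep
      by_cases h2 : s e ∈ X
      · rw [collapse_of_mem h2]; exact (hu1 _).1 ⟨h2, h1.1⟩
      · rw [collapse_of_notMem h2]
  · intro e he
    simp only [Finset.mem_filter] at he
    by_cases hep : e ∈ P'
    · have h1 := hPE _ (f ⟨e, hep⟩).2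
      rw [Γ1 e hep, collapse_of_mem (X := V(G) \ Y) ⟨h.t_mem h1.1, h1.2.2.2⟩]
      simp only [hP', Finset.mem_filter] at hep
      rw [hep.2.2, id]
    · rw [Γ2 e hep, id]
      by_cases h2 : t e ∈ Y
      · rw [collapse_of_notMem fun h3 => h3.2 h2]
      · rw [collapse_of_mem (X := V(G) \ Y) ⟨h.t_mem he.1, h2⟩]
        exact ((hv1 _).1 ⟨h.t_mem he.1, he.2, h2⟩).symm

lemma exists_mem_of_isOut (h : Rep G A B E s t) {X : Set α} (hX : IsOut E s t X) :
    ∃ v ∈ A, v ∈ X := by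
  have := h.card_of_isOut hX
  obtain ⟨w, hw⟩ := Finset.card_pos.1 (by omega : 0 < #{v ∈ A | v ∈ X})
  exact ⟨w, (Finset.mem_filter.1 hw).1, (Finset.mem_filter.1 hw).2⟩

/-- Edges cannot enter X ∩ Y or X ∪ Y at a B-vertex, so by `excess` each of these sets has a
positive surplus of A-vertices, its cut being nonempty. The surplus is modular and sums to 1 + 1, so
each surplus is 1 and each cut has three edges. -/
lemma isOut_inter_union (h : Rep G A B E s t) {X Y : Set α}
    (hX : IsOut E s t X) (hY : IsOut E s t Y) {u v : α} (hu : u ∈ V(G)) (huX : u ∈ X ∩ Y)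
    (hv : v ∈ V(G)) (hvX : v ∉ X ∪ Y) : IsOut E s t (X ∩ Y) ∧ IsOut E s t (X ∪ Y) := by
  have o1 : ∀ e ∈ E, t e ∈ X ∩ Y → s e ∈ X ∩ Y := fun e he h1 =>
    ⟨hX.1 e he h1.1, hY.1 e he h1.2⟩
  have o2 : ∀ e ∈ E, t e ∈ X ∪ Y → s e ∈ X ∪ Y := fun e he h1 =>
    h1.imp (hX.1 e he) (hY.1 e he)
  have zero : ∀ Z : Set α, (∀ e ∈ E, t e ∈ Z → s e ∈ Z) → #{e ∈ E | s e ∉ Z ∧ t e ∈ Z} = 0 := by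
    intro Z hZ
    rw [Finset.card_eq_zero, Finset.filter_eq_empty_iff]
    intro e he h3
    exact h3.1 (hZ e he h3.2)
  have c1 := h.two_le_cut hu huX hv (fun h1 => hvX (Or.inl h1.1))
  have c2 := h.two_le_cut hu (Or.inl huX.1 : u ∈ X ∪ Y) hv hvX
  rw [h.cut_ncard, zero _ o1] at c1
  rw [h.cut_ncard, zero _ o2] at c2
  have x1 := h.excess (X ∩ Y)
  have x2 := h.excess (X ∪ Y)
  rw [zero _ o1] at x1
  rw [zero _ o2] at x2
  have key : ∀ (C : Finset α) (I U : Set α), (∀ w, w ∈ I ↔ w ∈ X ∧ w ∈ Y) →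
      (∀ w, w ∈ U ↔ w ∈ X ∨ w ∈ Y) →
      #{v ∈ C | v ∈ I} + #{v ∈ C | v ∈ U} = #{v ∈ C | v ∈ X} + #{v ∈ C | v ∈ Y} := by
    intro C I U hI hU
    rw [add_comm, ← Finset.card_union_add_card_inter {v ∈ C | v ∈ X}]
    congr 2 <;> ext w <;> simp only [Finset.mem_filter, Finset.mem_union, Finset.mem_inter,
      hI, hU] <;> tauto
  have k1 := key A (X ∩ Y) (X ∪ Y) (fun _ => Iff.rfl) (fun _ => Iff.rfl)
  have k2 := key B (X ∩ Y) (X ∪ Y) (fun _ => Iff.rfl) (fun _ => Iff.rfl)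
  have k3 := h.card_of_isOut hX
  have k4 := h.card_of_isOut hY
  exact ⟨⟨o1, by omega⟩, ⟨o2, by omega⟩⟩

/-- If one of the four corners is empty, the cuts are nested up to complements. Otherwise X ∩ Y or X
∪ Y, if it defines a nontrivial cut, is nested with both X and Y and links their weights. In the
remaining case X ∩ Y and the complement of X ∪ Y are single vertices, and the contractions are
isomorphic in pairs. -/
lemma cutWt_eq_of_isOut {n : ℕ} (hn : UniqueBelow α β n) (h : Rep G A B E s t)
    (ho : order G ≤ n) {X Y : Set α} (hX : IsNT G X) (hY : IsNT G Y) (oX : IsOut E s t X)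
    (oY : IsOut E s t Y) : cutWt G X = cutWt G Y := by
  have hG : Cub G := ⟨_, _, _, _, _, h⟩
  by_cases h1 : X ⊆ Y
  · exact hn.nested hG ho hX hY h1
  by_cases h2 : Y ⊆ X
  · exact (hn.nested hG ho hY hX h2).symm
  by_cases h3 : X ∩ Y = ∅
  · rw [← cutWt_compl hY.1]
    exact hn.nested hG ho hX (hG.isNT_compl hY) fun v hv =>
      ⟨hX.1 hv, fun h4 => (h3 ▸ ⟨hv, h4⟩ : v ∈ (∅ : Set α))⟩
  by_cases h4 : V(G) \ (X ∪ Y) = ∅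
  · rw [← cutWt_compl hX.1]
    refine hn.nested hG ho (hG.isNT_compl hX) hY fun v hv => ?_
    by_contra h5
    have : v ∈ V(G) \ (X ∪ Y) := ⟨hv.1, fun h6 => h6.elim hv.2 h5⟩
    rw [h4] at this
    exact this
  obtain ⟨u, hu⟩ := Set.nonempty_iff_ne_empty.2 h3
  obtain ⟨v, hv⟩ := Set.nonempty_iff_ne_empty.2 h4
  obtain ⟨oi, ou⟩ := h.isOut_inter_union oX oY (hX.1 hu.1) hu hv.1 hv.2
  have siU : X ∪ Y ⊆ V(G) := Set.union_subset hX.1 hY.1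
  have siI : X ∩ Y ⊆ V(G) := Set.inter_subset_left.trans hX.1
  by_cases h5 : (X ∩ Y).Nontrivial
  · have nt : IsNT G (X ∩ Y) := ⟨siI, h.ncard_cut_of_isOut oi, h5,
      hX.2.2.2.mono (Set.sdiff_subset_sdiff_right Set.inter_subset_left)⟩
    rw [← hn.nested hG ho nt hX Set.inter_subset_left,
      ← hn.nested hG ho nt hY Set.inter_subset_right]
  by_cases h6 : (V(G) \ (X ∪ Y)).Nontrivial
  · have nt : IsNT G (X ∪ Y) := ⟨siU, h.ncard_cut_of_isOut ou,
      hX.2.2.1.mono Set.subset_union_left, h6⟩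
    rw [hn.nested hG ho hX nt Set.subset_union_left,
      hn.nested hG ho hY nt Set.subset_union_right]
  have e1 : X ∩ Y = {u} := (Set.not_nontrivial_iff.1 h5).eq_singleton_of_mem hu
  have e2 : V(G) \ (X ∪ Y) = {v} := (Set.not_nontrivial_iff.1 h6).eq_singleton_of_mem hv
  -- X ∩ Y has a surplus in A, so its only vertex belongs to A.
  have huA : u ∈ A := by
    obtain ⟨w, hwA, hw⟩ := h.exists_mem_of_isOut oi
    rw [e1, Set.mem_singleton_iff] at hw
    exact hw ▸ hwA
  have hvX : v ∈ V(G) \ X := ⟨hv.1, fun h => hv.2 (Or.inl h)⟩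
  have hvY : v ∈ V(G) \ Y := ⟨hv.1, fun h => hv.2 (Or.inr h)⟩
  obtain ⟨F, Γ, i1⟩ := h.exists_isoVia_of_crossing hX.1 hY.1 oX oY e1 e2 huA
  obtain ⟨F', Γ', i2⟩ := h.exists_isoVia_of_crossing hY.1 hX.1 oY oX
    (by rwa [Set.inter_comm]) (by rwa [Set.union_comm]) huA
  rw [hn.cutWt_eq hG ho hX hu.1 hvX, hn.cutWt_eq hG ho hY hu.2 hvY,
    hn.isoVia (hG.contract hX.1 hX.2.1 hu.1)
      ((order_contract_lt hG.finite hX.1 hX.2.2.1 hu.1).trans_le ho) i1,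
    hn.isoVia (hG.contract hY.1 hY.2.1 hu.2)
      ((order_contract_lt hG.finite hY.1 hY.2.2.1 hu.2).trans_le ho) i2, add_comm]

end Rep

lemma UniqueBelow.cutWt_unique {n : ℕ} (hn : UniqueBelow α β n) {G : Graph α β} (hG : Cub G)
    (ho : order G ≤ n) {X Y : Set α} (hX : IsNT G X) (hY : IsNT G Y) :
    cutWt G X = cutWt G Y := by
  obtain ⟨A, B, E, s, t, h, oX⟩ := hG.exists_isOut hX.2.1
  rcases h.cut_three hY.2.1 with oY | oY
  · exact h.cutWt_eq_of_isOut hn ho hX hY oX oY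
  · rw [← cutWt_compl hY.1]
    exact h.cutWt_eq_of_isOut hn ho hX (hG.isNT_compl hY) oX (h.symm.isOut_compl oY)

/-- Induction on the order: both contractions are smaller, so the weight depends at most on the cut
used first, and by `UniqueBelow.cutWt_unique` not even on that. -/
lemma uniqueBelow (α β : Type*) (n : ℕ) : UniqueBelow α β n := by
  induction n with
  | zero => exact fun G _ ho => absurd ho (Nat.not_lt_zero _)
  | succ n ih =>
    have key : ∀ G : Graph α β, Cub G → order G ≤ n → ∀ L L', IsTightCutDecomposition G L →
        IsTightCutDecomposition G L' → wt L = wt L' := by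
      have aux : ∀ G : Graph α β, Cub G → order G ≤ n → ∀ L, IsTightCutDecomposition G L →
          (∀ X, ¬ IsNT G X) ∧ wt L = leafWt (order G) ∨ ∃ X, IsNT G X ∧ wt L = cutWt G X := by
        intro G hG ho L hL
        cases hL with
        | leaf _ hl =>
          exact Or.inl ⟨fun X hX => hl X (hG.isNontrivialTightCut_iff.2 hX), wt_singleton G⟩
        | step _ X x y L₁ L₂ hX hx hy h₁ h₂ =>
          rw [hG.isNontrivialTightCut_iff] at hX
          refine Or.inr ⟨X, hX, ?_⟩
          rw [wt_add, ih.cutWt_eq hG ho hX hx hy, ih _ (hG.contract hX.1 hX.2.1 hx)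
            ((order_contract_lt hG.finite hX.1 hX.2.2.1 hx).trans_le ho) _ h₁,
            ih _ (hG.contract_compl hX.2.1 hy)
            ((order_contract_lt hG.finite Set.sdiff_subset hX.2.2.2 hy).trans_le ho) _ h₂]
      intro G hG ho L L' hL hL'
      rcases aux G hG ho L hL with ⟨h1, h2⟩ | ⟨X, h1, h2⟩ <;>
      rcases aux G hG ho L' hL' with ⟨k1, k2⟩ | ⟨Y, k1, k2⟩
      · rw [h2, k2]
      · exact absurd k1 (h1 Y)
      · exact absurd h1 (k1 X)
      · rw [h2, k2, ih.cutWt_unique hG ho h1 k1]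
    intro G hG ho L hL
    have hex : ∃ L, IsTightCutDecomposition G L := ⟨L, hL⟩
    rw [tv, dif_pos hex]
    exact key G hG (Nat.lt_succ_iff.1 ho) _ _ hL hex.choose_spec

/-- Any two tight cut decompositions have the same weight. -/
lemma Cub.wt_eq {G : Graph α β} (hG : Cub G) {L : Multiset (Graph α β)}
    (hL : IsTightCutDecomposition G L) : wt L = tv G :=
  uniqueBelow α β (order G + 1) G hG (Nat.lt_succ_self _) L hL

lemma Cub.tv_isoVia {G : Graph α β} (hG : Cub G) {G' : Graph α' β'} {F : α → α'} {Γ : β → β'}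
    (h : IsoVia G G' F Γ) : tv G' = tv G := by
  obtain ⟨L, hL⟩ := hG.exists_tightCutDecomposition
  obtain ⟨L', hL', e⟩ := tightCutDecomposition_of_isoVia hL hG h
  rw [← hG.wt_eq hL, ← (hG.of_isoVia h).wt_eq hL', e]

lemma Cub.tv_step {G : Graph α β} (hG : Cub G) {X : Set α} {x y : α} (hX : IsNT G X)
    (hx : x ∈ X) (hy : y ∈ V(G) \ X) :
    tv G = tv (CubicGraph.contract G X x) + tv (CubicGraph.contract G (V(G) \ X) y) :=
  (uniqueBelow α β (order G + 1)).step hG (Nat.lt_succ_self _) hX hx hy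

lemma Cub.tv_leaf {G : Graph α β} (hG : Cub G) (h : ∀ X, ¬ IsNT G X) :
    tv G = leafWt (order G) := by
  rw [← hG.wt_eq (.leaf G fun X hX => h X (hG.isNontrivialTightCut_iff.1 hX)), wt_singleton]

lemma Cub.tv_small {G : Graph α β} (hG : Cub G) (h : order G < 6) : tv G = 0 := by
  induction hn : order G using Nat.strong_induction_on generalizing G with
  | _ n ih =>
    subst hn
    by_cases hX : ∃ X, IsNT G X
    · obtain ⟨X, hX⟩ := hX
      obtain ⟨x, hx⟩ := hX.2.2.1.nonempty
      obtain ⟨y, hy⟩ := hX.2.2.2.nonempty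
      have o1 := order_contract_lt hG.finite hX.1 hX.2.2.1 hx
      have o2 := order_contract_lt hG.finite Set.sdiff_subset hX.2.2.2 hy
      rw [hG.tv_step hX hx hy, ih _ o1 (hG.contract hX.1 hX.2.1 hx) (o1.trans h) rfl,
        ih _ o2 (hG.contract_compl hX.2.1 hy) (o2.trans h) rfl, add_zero]
    · push Not at hX
      rw [hG.tv_leaf hX, leafWt, if_neg (by omega)]

lemma tightCutDecomposition_mem {G : Graph α β} {L : Multiset (Graph α β)}
    (hL : IsTightCutDecomposition G L) (hG : Cub G) : ∀ K ∈ L, Cub K ∧ IsBrace K := by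
  induction hL with
  | leaf G hl =>
    intro K hK
    rw [Multiset.mem_singleton] at hK
    subst hK
    refine ⟨hG, ?_⟩
    obtain ⟨A, B, E, s, t, h⟩ := hG
    exact ⟨h.isMatchingCovered, ⟨_, _, h.isBipartition⟩, hl⟩
  | step G X x y L₁ L₂ hX hx hy h₁ h₂ ih₁ ih₂ =>
    rw [hG.isNontrivialTightCut_iff] at hX
    intro K hK
    rcases Multiset.mem_add.1 hK with hK | hK
    · exact ih₁ (hG.contract hX.1 hX.2.1 hx) K hK
    · exact ih₂ (hG.contract_compl hX.2.1 hy) K hK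

lemma bTilde_add_bPrime {G : Graph α β} {L : Multiset (Graph α β)}
    (hL : IsTightCutDecomposition G L) (hG : Cub G) : bTilde L + 3 * bPrime L = tv G := by
  rw [← hG.wt_eq hL]
  have hb : ∀ K ∈ L, IsBrace K := fun K hK => (tightCutDecomposition_mem hL hG K hK).2
  clear hL
  induction L using Multiset.induction_on with
  | empty => simp [bTilde, bPrime, largeBraces, wt]
  | cons K L ih =>
    have ih := ih fun K hK => hb K (Multiset.mem_cons_of_mem hK)
    have hK := hb K (Multiset.mem_cons_self K L)
    rw [← Multiset.singleton_add, wt_add, wt_singleton, ← ih]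
    simp only [bTilde, bPrime, largeBraces, Multiset.filter_add, Multiset.map_add,
      Multiset.sum_add, Multiset.card_add, leafWt]
    by_cases h6 : 6 ≤ order K
    · rw [Multiset.filter_singleton, if_pos ⟨hK, h6⟩, if_pos h6]
      simp
      ring
    · rw [Multiset.filter_singleton, if_neg (fun h => h6 h.2), if_neg h6]
      simp

end TightCutDecompositions

section Matchings

variable {α β α' β' : Type*}

/-! ### `λ`-matchable pairs and tight cuts -/

/-- The degrees prescribed by an `(a, b)`-matching. -/
noncomputable def pairDeg (a b v : α) : ℕ := if v = a ∨ v = b then 3 else 1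

lemma pairDeg_comm (a b : α) : pairDeg a b = pairDeg b a := by
  ext v; simp only [pairDeg, or_comm]

lemma isLambdaMatchablePair_comm {G : Graph α β} {a b : α} :
    IsLambdaMatchablePair G a b ↔ IsLambdaMatchablePair G b a := by
  constructor <;>
  · rintro ⟨M, h1, h2, h3, h4⟩
    exact ⟨M, h1, h3, h2, fun v hv ha hb => h4 v hv hb ha⟩

lemma sum_pairDeg {a b : α} {S : Finset α} (hb : b ∉ S) :
    ∑ v ∈ S, pairDeg a b v = #S + if a ∈ S then 2 else 0 := by
  have : ∀ v ∈ S, pairDeg a b v = 1 + if v = a then 2 else 0 := by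
    intro v hv
    have hvb : v ≠ b := fun h => hb (h ▸ hv)
    by_cases hva : v = a <;> simp [pairDeg, hva, hvb]
  rw [Finset.sum_congr rfl this, Finset.sum_add_distrib, Finset.sum_ite_eq']
  simp

lemma sum_pairDeg' {a b : α} {S : Finset α} (ha : a ∉ S) :
    ∑ v ∈ S, pairDeg a b v = #S + if b ∈ S then 2 else 0 := by
  rw [pairDeg_comm, sum_pairDeg ha]

namespace Rep

variable {G : Graph α β} {A B : Finset α} {E : Finset β} {s t : β → α}

lemma isLambdaMatchablePair_iff (h : Rep G A B E s t) {a b : α} :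
    IsLambdaMatchablePair G a b ↔
      a ∈ V(G) ∧ b ∈ V(G) ∧ ∃ M ⊆ E, IsFactor A B s t M (pairDeg a b) := by
  constructor
  · rintro ⟨M, h1, h2, h3, h4⟩
    have hmem : ∀ v, deg (G.restrict M) v = 3 → v ∈ V(G) := by
      intro v hv
      obtain ⟨e, he⟩ : ((G.restrict M).incidenceSet v).Nonempty :=
        Set.nonempty_of_ncard_ne_zero (by rw [deg] at hv; omega)
      exact (((G.restrict M).mem_incidenceSet v e).1 he).vertex_mem
    have h1' : M ⊆ ↑E := by rwa [h.edgeSet] at h1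
    have hf : M.Finite := (Finset.finite_toSet E).subset h1'
    have key : ∀ v ∈ V(G), deg (G.restrict M) v = pairDeg a b v := by
      intro v hv
      rw [pairDeg]
      split_ifs with hab
      · rcases hab with rfl | rfl
        · exact h2
        · exact h3
      · push Not at hab
        exact h4 v hv hab.1 hab.2
    refine ⟨hmem a h2, hmem b h3, hf.toFinset, by simpa using h1', fun v hv => ?_, fun v hv => ?_⟩
    · rw [← h.deg_restrict (by simpa using h1') hv, Set.Finite.coe_toFinset]
      exact key v (h.mem_verts.2 (Or.inl hv))
    · rw [← h.symm.deg_restrict (by simpa using h1') hv, Set.Finite.coe_toFinset]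
      exact key v (h.mem_verts.2 (Or.inr hv))
  · rintro ⟨ha, hb, M, h1, h2⟩
    have key : ∀ v ∈ V(G), deg (G.restrict (M : Set β)) v = pairDeg a b v := by
      intro v hv
      rcases h.mem_verts.1 hv with hv | hv
      · rw [h.deg_restrict h1 hv, h2.1 v hv]
      · rw [h.symm.deg_restrict h1 hv, h2.2 v hv]
    refine ⟨↑M, by rw [h.edgeSet]; exact_mod_cast h1, ?_, ?_, fun v hv hva hvb => ?_⟩
    · rw [key a ha]; simp [pairDeg]
    · rw [key b hb]; simp [pairDeg]
    · rw [key v hv]; simp [pairDeg, hva, hvb]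

/-- The edges of such a matching number |A| + 4 when counted in A but |B| = |A| when counted in B.
-/
lemma not_isLambdaMatchablePair_same (h : Rep G A B E s t) {a b : α} (ha : a ∈ A) (hb : b ∈ A)
    (hab : a ≠ b) : ¬ IsLambdaMatchablePair G a b := by
  rw [h.isLambdaMatchablePair_iff]
  rintro ⟨-, -, M, hM, hf⟩
  have h1 := h.factor_count hM hf Set.univ
  simp only [Set.mem_univ, not_true_eq_false, false_and, and_false, Finset.filter_false,
    Finset.card_empty, add_zero, Finset.filter_true] at h1
  rw [sum_pairDeg (h.notMem_B hb), if_neg (h.notMem_B ha), ← Finset.sum_erase_add _ _ hb,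
    sum_pairDeg (Finset.notMem_erase b A), if_pos (Finset.mem_erase.2 ⟨hab, ha⟩)] at h1
  have h2 : pairDeg a b b = 3 := by simp [pairDeg]
  have h3 := Finset.card_erase_add_one hb
  have h4 := h.card_eq
  omega

variable {X : Set α} {x y : α}

lemma collapse_compl_eq (h : Rep G A B E s t) (hy : y ∈ V(G) \ X) {e : β} (he : e ∈ E) :
    collapse (V(G) \ X) y (t e) = y ↔ t e ∉ X := by
  by_cases ht : t e ∈ X
  · rw [collapse_of_notMem fun h => h.2 ht]
    exact ⟨fun h1 => absurd (h1 ▸ ht) hy.2, fun h1 => absurd ht h1⟩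
  · rw [collapse_of_mem (X := V(G) \ X) ⟨h.t_mem he, ht⟩]
    simp [ht]

lemma collapse_eq_iff (hx : x ∈ X) {v : α} : collapse X x v = x ↔ v ∈ X := by
  by_cases hv : v ∈ X
  · simp [collapse_of_mem hv, hv]
  · rw [collapse_of_notMem hv]
    exact ⟨fun h => h ▸ hx, fun h => absurd h hv⟩

/-- Edge sets of the two contractions that agree on the cut edges combine to one of G. The degrees
prescribed at the contraction vertices x and y are forgotten. -/
lemma factor_glue (h : Rep G A B E s t) (hx : x ∈ X) (hy : y ∈ V(G) \ X)
    {M₁ M₂ : Finset β} {d₁ d₂ : α → ℕ} (hM₁ : M₁ ⊆ {e ∈ E | s e ∈ X})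
    (hM₂ : M₂ ⊆ {e ∈ E | t e ∉ X})
    (h₁ : IsFactor {v ∈ A | v ∈ X} (insert y {v ∈ B | v ∈ X}) s
      (fun e => collapse (V(G) \ X) y (t e)) M₁ d₁)
    (h₂ : IsFactor (insert x {v ∈ A | v ∉ X}) {v ∈ B | v ∉ X} (fun e => collapse X x (s e)) t M₂ d₂)
    (h₁₂ : ∀ e ∈ E, s e ∈ X → t e ∉ X → (e ∈ M₁ ↔ e ∈ M₂)) :
    IsFactor A B s t (M₁ ∪ M₂) fun v => if v ∈ X then d₁ v else d₂ v := by
  have k₁ : ∀ e ∈ M₁, e ∈ E ∧ s e ∈ X := fun e he => by simpa using hM₁ he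
  have k₂ : ∀ e ∈ M₂, e ∈ E ∧ t e ∉ X := fun e he => by simpa using hM₂ he
  constructor
  · intro v hv
    by_cases hvX : v ∈ X
    · simp only [hvX, if_true]
      rw [← h₁.1 v (Finset.mem_filter.2 ⟨hv, hvX⟩)]
      congr 1
      ext e
      simp only [Finset.mem_filter, Finset.mem_union]
      constructor
      · rintro ⟨h3 | h3, rfl⟩
        · exact ⟨h3, rfl⟩
        · exact ⟨(h₁₂ e (k₂ e h3).1 hvX (k₂ e h3).2).2 h3, rfl⟩
      · rintro ⟨h3, h4⟩
        exact ⟨Or.inl h3, h4⟩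
    · simp only [hvX, if_false]
      rw [← h₂.1 v (Finset.mem_insert_of_mem (Finset.mem_filter.2 ⟨hv, hvX⟩))]
      congr 1
      ext e
      simp only [Finset.mem_filter, Finset.mem_union]
      constructor
      · rintro ⟨h3 | h3, rfl⟩
        · exact absurd (k₁ e h3).2 hvX
        · exact ⟨h3, collapse_of_notMem hvX⟩
      · rintro ⟨h3, h4⟩
        refine ⟨Or.inr h3, ?_⟩
        by_cases h5 : s e ∈ X
        · rw [collapse_of_mem h5] at h4
          exact absurd (h4 ▸ hx) hvX
        · rwa [collapse_of_notMem h5] at h4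
  · intro v hv
    by_cases hvX : v ∈ X
    · simp only [hvX, if_true]
      rw [← h₁.2 v (Finset.mem_insert_of_mem (Finset.mem_filter.2 ⟨hv, hvX⟩))]
      congr 1
      ext e
      simp only [Finset.mem_filter, Finset.mem_union]
      constructor
      · rintro ⟨h3 | h3, rfl⟩
        · exact ⟨h3, collapse_of_notMem fun h => h.2 hvX⟩
        · exact absurd hvX (k₂ e h3).2
      · rintro ⟨h3, h4⟩
        refine ⟨Or.inl h3, ?_⟩
        by_cases h5 : t e ∈ X
        · rwa [collapse_of_notMem fun h => h.2 h5] at h4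
        · rw [collapse_of_mem (X := V(G) \ X) ⟨h.t_mem (k₁ e h3).1, h5⟩] at h4
          exact absurd (h4 ▸ hvX) hy.2
    · simp only [hvX, if_false]
      rw [← h₂.2 v (Finset.mem_filter.2 ⟨hv, hvX⟩)]
      congr 1
      ext e
      simp only [Finset.mem_filter, Finset.mem_union]
      constructor
      · rintro ⟨h3 | h3, rfl⟩
        · exact ⟨(h₁₂ e (k₁ e h3).1 (k₁ e h3).2 hvX).1 h3, rfl⟩
        · exact ⟨h3, rfl⟩
      · rintro ⟨h3, h4⟩
        exact ⟨Or.inr h3, h4⟩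

/-- The converse of `factor_glue`: each contraction vertex inherits as its degree the number of cut
edges used. -/
lemma factor_restrict (h : Rep G A B E s t) (oX : IsOut E s t X) (hx : x ∈ X)
    (hy : y ∈ V(G) \ X) {M : Finset β} (hM : M ⊆ E) {d d₁ d₂ : α → ℕ}
    (hd : IsFactor A B s t M d) (h₁ : ∀ v ∈ X, d₁ v = d v) (h₂ : ∀ v ∉ X, d₂ v = d v)
    (h₁y : d₁ y = #{e ∈ M | s e ∈ X ∧ t e ∉ X}) (h₂x : d₂ x = #{e ∈ M | s e ∈ X ∧ t e ∉ X}) :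
    IsFactor {v ∈ A | v ∈ X} (insert y {v ∈ B | v ∈ X}) s
      (fun e => collapse (V(G) \ X) y (t e)) {e ∈ M | s e ∈ X} d₁ ∧
    IsFactor (insert x {v ∈ A | v ∉ X}) {v ∈ B | v ∉ X} (fun e => collapse X x (s e)) t
      {e ∈ M | t e ∉ X} d₂ := by
  refine ⟨⟨?_, ?_⟩, ?_, ?_⟩
  · intro v hv
    rw [Finset.mem_filter] at hv
    rw [h₁ v hv.2, ← hd.1 v hv.1, Finset.filter_filter]
    congr 1
    ext e
    simp only [Finset.mem_filter]
    have : s e = v → s e ∈ X := fun h => h ▸ hv.2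
    tauto
  · intro v hv
    rw [Finset.filter_filter]
    by_cases hvX : v ∈ X
    · have hvB : v ∈ B := by
        rw [Finset.mem_insert, Finset.mem_filter] at hv
        rcases hv with rfl | hv
        · exact absurd hvX hy.2
        · exact hv.1
      rw [h₁ v hvX, ← hd.2 v hvB]
      congr 1
      ext e
      simp only [Finset.mem_filter]
      constructor
      · rintro ⟨h3, h4, h5⟩
        refine ⟨h3, ?_⟩
        by_cases h6 : t e ∈ X
        · rwa [collapse_of_notMem fun h => h.2 h6] at h5
        · rw [collapse_of_mem (X := V(G) \ X) ⟨h.t_mem (hM h3), h6⟩] at h5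
          exact absurd (h5 ▸ hvX) hy.2
      · rintro ⟨h3, rfl⟩
        exact ⟨h3, oX.1 e (hM h3) hvX, collapse_of_notMem fun h => h.2 hvX⟩
    · have hvy : v = y := by
        rw [Finset.mem_insert, Finset.mem_filter] at hv
        tauto
      subst hvy
      rw [h₁y]
      congr 1
      ext e
      simp only [Finset.mem_filter]
      refine and_congr_right fun he => and_congr_right fun _ => ?_
      exact h.collapse_compl_eq hy (hM he)
  · intro v hv
    rw [Finset.filter_filter]
    by_cases hvX : v ∈ X
    · have hvx : v = x := by
        rw [Finset.mem_insert, Finset.mem_filter] at hv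
        tauto
      subst hvx
      rw [h₂x]
      congr 1
      ext e
      simp only [Finset.mem_filter, collapse_eq_iff hx]
      tauto
    · have hvA : v ∈ A := by
        rw [Finset.mem_insert, Finset.mem_filter] at hv
        rcases hv with rfl | hv
        · exact absurd hx hvX
        · exact hv.1
      rw [h₂ v hvX, ← hd.1 v hvA]
      congr 1
      ext e
      simp only [Finset.mem_filter]
      constructor
      · rintro ⟨h3, h4, h5⟩
        refine ⟨h3, ?_⟩
        by_cases h6 : s e ∈ X
        · rw [collapse_of_mem h6] at h5
          exact absurd (h5 ▸ hx) hvX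
        · rwa [collapse_of_notMem h6] at h5
      · rintro ⟨h3, rfl⟩
        exact ⟨h3, fun h4 => hvX (oX.1 e (hM h3) h4), collapse_of_notMem hvX⟩
  · intro v hv
    rw [Finset.mem_filter] at hv
    rw [h₂ v hv.2, ← hd.2 v hv.1, Finset.filter_filter]
    congr 1
    ext e
    simp only [Finset.mem_filter]
    have : t e = v → t e ∉ X := fun h => h ▸ hv.2
    tauto

/-- The number of cut edges in an `(a, b)`-matching. -/
lemma pair_inter_cut (h : Rep G A B E s t) (oX : IsOut E s t X) {M : Finset β} (hM : M ⊆ E)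
    {a b : α} (ha : a ∈ A) (hb : b ∈ B) (hf : IsFactor A B s t M (pairDeg a b)) :
    (1 + if a ∈ X then 2 else 0) = (if b ∈ X then 2 else 0) + #{e ∈ M | s e ∈ X ∧ t e ∉ X} := by
  have h1 := h.factor_inter_cut oX hM hf
  rw [sum_pairDeg fun h' => h.notMem_A hb (Finset.mem_filter.1 h').1,
    sum_pairDeg' fun h' => h.notMem_B ha (Finset.mem_filter.1 h').1] at h1
  have h2 := h.card_of_isOut oX
  simp only [Finset.mem_filter, ha, hb, true_and] at h1
  omega

/-- With both a and b in X the matching uses exactly one cut edge (`pair_inter_cut`), so it looks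
like an ordinary edge of a perfect matching to y. Conversely, that one edge extends to a perfect
matching of the other contraction, which is matching covered. -/
lemma pair_inside (h : Rep G A B E s t) (hXV : X ⊆ V(G)) (oX : IsOut E s t X) (hy : y ∈ V(G) \ X)
    {a b : α} (ha : a ∈ A) (hb : b ∈ B) (haX : a ∈ X) (hbX : b ∈ X) :
    IsLambdaMatchablePair G a b ↔ IsLambdaMatchablePair (CubicGraph.contract G (V(G) \ X) y) a b := by
  have hx := haX
  have r1 := h.contract_compl oX hy
  have r2 := h.contract hXV oX hx
  have hya : y ≠ a := fun h => hy.2 (h ▸ haX)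
  have hyb : y ≠ b := fun h => hy.2 (h ▸ hbX)
  rw [h.isLambdaMatchablePair_iff, r1.isLambdaMatchablePair_iff]
  have haV : a ∈ V(G) := hXV haX
  have hbV : b ∈ V(G) := hXV hbX
  have haV' : a ∈ V(CubicGraph.contract G (V(G) \ X) y) :=
    r1.mem_verts.2 (Or.inl (Finset.mem_filter.2 ⟨ha, haX⟩))
  have hbV' : b ∈ V(CubicGraph.contract G (V(G) \ X) y) :=
    r1.mem_verts.2 (Or.inr (Finset.mem_insert_of_mem (Finset.mem_filter.2 ⟨hb, hbX⟩)))
  simp only [haV, hbV, haV', hbV', true_and]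
  constructor
  · rintro ⟨M, hM, hf⟩
    have h1 := h.pair_inter_cut oX hM ha hb hf
    rw [if_pos haX, if_pos hbX] at h1
    refine ⟨_, Finset.filter_subset_filter _ hM,
      (h.factor_restrict oX hx hy hM hf (d₂ := fun v => if v ∈ X then
        #{e ∈ M | s e ∈ X ∧ t e ∉ X} else pairDeg a b v) (fun _ _ => rfl)
        (fun v hv => if_neg hv) ?_ (if_pos hx)).1⟩
    rw [pairDeg, if_neg (by tauto)]
    omega
  · rintro ⟨M₁, hM₁, hf₁⟩
    have k₁ : ∀ e ∈ M₁, e ∈ E ∧ s e ∈ X := fun e he => by simpa using hM₁ he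
    have h1 := hf₁.2 y (Finset.mem_insert_self _ _)
    rw [pairDeg, if_neg (by tauto), Finset.card_eq_one] at h1
    obtain ⟨e₀, he₀⟩ := h1
    have m1 : ∀ e, (e ∈ M₁ ∧ t e ∉ X) ↔ e = e₀ := by
      intro e
      rw [← Finset.mem_singleton, ← he₀, Finset.mem_filter]
      exact and_congr_right fun he => (h.collapse_compl_eq hy (k₁ e he).1).symm
    have he₁ := (m1 e₀).2 rfl
    obtain ⟨M₂, hM₂, hf₂, he₂⟩ := r2.exists_factor_mem
      (Finset.mem_filter.2 ⟨(k₁ _ he₁.1).1, he₁.2⟩)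
    have h2 := hf₂.1 a (Finset.mem_insert_self _ _)
    rw [Pi.one_apply, Finset.card_eq_one] at h2
    obtain ⟨e₂, he₂'⟩ := h2
    have m2 : ∀ e, (e ∈ M₂ ∧ s e ∈ X) ↔ e = e₂ := by
      intro e
      rw [← Finset.mem_singleton, ← he₂', Finset.mem_filter, collapse_eq_iff hx]
    have : e₀ = e₂ := (m2 e₀).1 ⟨he₂, (k₁ _ he₁.1).2⟩
    subst this
    refine ⟨M₁ ∪ M₂, Finset.union_subset (hM₁.trans (Finset.filter_subset _ _))
      (hM₂.trans (Finset.filter_subset _ _)), ?_⟩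
    have key := h.factor_glue hx hy hM₁ hM₂ hf₁ hf₂ (fun e he h3 h4 => by
      have := m1 e
      have := m2 e
      tauto)
    convert key using 2 with v
    by_cases hv : v ∈ X
    · rw [if_pos hv]
    · rw [if_neg hv, pairDeg, if_neg, Pi.one_apply]
      rintro (rfl | rfl)
      · exact hv haX
      · exact hv hbX

lemma pair_outside (h : Rep G A B E s t) (hXV : X ⊆ V(G)) (oX : IsOut E s t X) (hx : x ∈ X)
    {a b : α} (ha : a ∈ A) (hb : b ∈ B) (haX : a ∉ X) (hbX : b ∉ X) :
    IsLambdaMatchablePair G a b ↔ IsLambdaMatchablePair (CubicGraph.contract G X x) a b := by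
  have haV : a ∈ V(G) := h.mem_verts.2 (Or.inl ha)
  have hbV : b ∈ V(G) := h.mem_verts.2 (Or.inr hb)
  have e1 := Set.sdiff_sdiff_cancel_left hXV
  have := h.symm.pair_inside Set.sdiff_subset (h.isOut_compl oX) (y := x) (by rwa [e1]) hb ha
    ⟨hbV, hbX⟩ ⟨haV, haX⟩
  rwa [e1, isLambdaMatchablePair_comm, isLambdaMatchablePair_comm (a := b)] at this

/-- Here the matching must use all three cut edges, so each contraction vertex takes over the role
of the missing end. Conversely any two such matchings glue, since each contains the whole cut. -/
lemma pair_across (h : Rep G A B E s t) (hXV : X ⊆ V(G)) (oX : IsOut E s t X) (hx : x ∈ X)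
    (hy : y ∈ V(G) \ X) {a b : α} (ha : a ∈ A) (hb : b ∈ B) (haX : a ∈ X) (hbX : b ∉ X) :
    IsLambdaMatchablePair G a b ↔ IsLambdaMatchablePair (CubicGraph.contract G (V(G) \ X) y) a y ∧
      IsLambdaMatchablePair (CubicGraph.contract G X x) x b := by
  have r1 := h.contract_compl oX hy
  have r2 := h.contract hXV oX hx
  have haV : a ∈ V(G) := h.mem_verts.2 (Or.inl ha)
  have hbV : b ∈ V(G) := h.mem_verts.2 (Or.inr hb)
  rw [h.isLambdaMatchablePair_iff, r1.isLambdaMatchablePair_iff, r2.isLambdaMatchablePair_iff]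
  have m1 : a ∈ V(CubicGraph.contract G (V(G) \ X) y) :=
    r1.mem_verts.2 (Or.inl (Finset.mem_filter.2 ⟨ha, haX⟩))
  have m2 : y ∈ V(CubicGraph.contract G (V(G) \ X) y) :=
    r1.mem_verts.2 (Or.inr (Finset.mem_insert_self _ _))
  have m3 : x ∈ V(CubicGraph.contract G X x) :=
    r2.mem_verts.2 (Or.inl (Finset.mem_insert_self _ _))
  have m4 : b ∈ V(CubicGraph.contract G X x) :=
    r2.mem_verts.2 (Or.inr (Finset.mem_filter.2 ⟨hb, hbX⟩))
  simp only [haV, hbV, m1, m2, m3, m4, true_and]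
  constructor
  · rintro ⟨M, hM, hf⟩
    have h1 := h.pair_inter_cut oX hM ha hb hf
    rw [if_pos haX, if_neg hbX] at h1
    have key := h.factor_restrict oX hx hy hM hf (d₁ := pairDeg a y) (d₂ := pairDeg x b) ?_ ?_ ?_ ?_
    · exact ⟨⟨_, Finset.filter_subset_filter _ hM, key.1⟩,
        ⟨_, Finset.filter_subset_filter _ hM, key.2⟩⟩
    · intro v hv
      have h2 : v ≠ y := fun h => hy.2 (h ▸ hv)
      have h3 : v ≠ b := fun h => hbX (h ▸ hv)
      simp [pairDeg, h2, h3]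
    · intro v hv
      have h2 : v ≠ x := fun h => hv (h ▸ hx)
      have h3 : v ≠ a := fun h => hv (h ▸ haX)
      simp [pairDeg, h2, h3]
    · simp only [pairDeg, or_true, if_true]; omega
    · simp only [pairDeg, true_or, if_true]; omega
  · rintro ⟨⟨M₁, hM₁, hf₁⟩, M₂, hM₂, hf₂⟩
    have k₁ : ∀ e ∈ M₁, e ∈ E ∧ s e ∈ X := fun e he => by simpa using hM₁ he
    have k₂ : ∀ e ∈ M₂, e ∈ E ∧ t e ∉ X := fun e he => by simpa using hM₂ he
    have h1 := hf₁.2 y (Finset.mem_insert_self _ _)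
    have h2 := hf₂.1 x (Finset.mem_insert_self _ _)
    rw [pairDeg, if_pos (by tauto)] at h1 h2
    -- Degree 3 at y exhausts the three edges of the cut; similarly at x.
    have f1 : ({e ∈ M₁ | collapse (V(G) \ X) y (t e) = y} : Finset β) =
        {e ∈ E | s e ∈ X ∧ t e ∉ X} := Finset.eq_of_subset_of_card_le (by
      intro e he
      rw [Finset.mem_filter] at he ⊢
      exact ⟨(k₁ e he.1).1, (k₁ e he.1).2, (h.collapse_compl_eq hy (k₁ e he.1).1).1 he.2⟩)
      (by rw [h1, oX.2])
    have f2 : ({e ∈ M₂ | collapse X x (s e) = x} : Finset β) =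
        {e ∈ E | s e ∈ X ∧ t e ∉ X} := Finset.eq_of_subset_of_card_le (by
      intro e he
      rw [Finset.mem_filter] at he ⊢
      exact ⟨(k₂ e he.1).1, (collapse_eq_iff hx).1 he.2, (k₂ e he.1).2⟩)
      (by rw [h2, oX.2])
    refine ⟨M₁ ∪ M₂, Finset.union_subset (hM₁.trans (Finset.filter_subset _ _))
      (hM₂.trans (Finset.filter_subset _ _)), ?_⟩
    have key := h.factor_glue hx hy hM₁ hM₂ hf₁ hf₂ (fun e he h3 h4 => by
      have m : e ∈ ({e ∈ E | s e ∈ X ∧ t e ∉ X} : Finset β) := Finset.mem_filter.2 ⟨he, h3, h4⟩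
      have m1 := (Finset.mem_filter.1 (f1 ▸ m)).1
      have m2 := (Finset.mem_filter.1 (f2 ▸ m)).1
      exact ⟨fun _ => m2, fun _ => m1⟩)
    convert key using 2 with v
    by_cases hv : v ∈ X
    · have h2 : v ≠ y := fun h => hy.2 (h ▸ hv)
      have h3 : v ≠ b := fun h => hbX (h ▸ hv)
      simp [pairDeg, h2, h3, hv]
    · have h2 : v ≠ x := fun h => hv (h ▸ hx)
      have h3 : v ≠ a := fun h => hv (h ▸ haX)
      simp [pairDeg, h2, h3, hv]

/-- The count in `pair_inter_cut` would require −1 cut edges. -/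
lemma not_pair_back (h : Rep G A B E s t) (oX : IsOut E s t X) {a b : α} (ha : a ∈ A) (hb : b ∈ B)
    (haX : a ∉ X) (hbX : b ∈ X) : ¬ IsLambdaMatchablePair G a b := by
  rw [h.isLambdaMatchablePair_iff]
  rintro ⟨-, -, M, hM, hf⟩
  have h1 := h.pair_inter_cut oX hM ha hb hf
  rw [if_neg haX, if_pos hbX] at h1
  omega

end Rep

/-! ### Counting `λ`-matchable pairs -/

/-- The indicator of `λ`-matchable pairs. -/
noncomputable def lam (G : Graph α β) (a b : α) : ℕ := if IsLambdaMatchablePair G a b then 1 else 0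

namespace Rep

variable {G : Graph α β} {A B : Finset α} {E : Finset β} {s t : β → α}

lemma numPartners_left (h : Rep G A B E s t) {a : α} (ha : a ∈ A) :
    numPartners G a = ∑ b ∈ B, lam G a b := by
  simp only [lam, Finset.sum_boole, Nat.cast_id]
  rw [numPartners, ← Set.ncard_coe_finset]
  congr 1
  ext v
  simp only [Set.mem_ofPred_eq, Finset.coe_filter, h.mem_verts]
  constructor
  · rintro ⟨hv | hv, h1, h2⟩
    · exact absurd h2 (h.not_isLambdaMatchablePair_same ha hv h1.symm)
    · exact ⟨hv, h2⟩
  · rintro ⟨hv, h2⟩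
    exact ⟨Or.inr hv, fun h3 => h.notMem_B ha (h3 ▸ hv), h2⟩

lemma lam_comm (G : Graph α β) (a b : α) : lam G a b = lam G b a := by
  simp only [lam, isLambdaMatchablePair_comm (a := a)]

lemma numPartners_right (h : Rep G A B E s t) {b : α} (hb : b ∈ B) :
    numPartners G b = ∑ a ∈ A, lam G a b := by
  rw [h.symm.numPartners_left hb]
  exact Finset.sum_congr rfl fun a _ => lam_comm G b a

lemma rho_eq (G : Graph α β) (A B : Finset α) : rho G ↑A ↑B = ∑ a ∈ A, ∑ b ∈ B, lam G a b := by
  rw [← Finset.sum_product']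
  simp only [lam, Finset.sum_boole, Nat.cast_id]
  rw [rho, ← Set.ncard_coe_finset]
  congr 1
  ext p
  simp only [Set.mem_ofPred_eq, Finset.coe_filter, Finset.mem_coe, Finset.mem_product, and_assoc]

/-- Pairs of equal color are never λ-matchable, so each pair counted by ρ appears in both orders.
The ordered count needs no choice of color classes and is thus an isomorphism invariant by
definition. -/
lemma rhoOrd_eq (h : Rep G A B E s t) : rhoOrd G = 2 * rho G ↑A ↑B := by
  have e1 : {p : α × α | p.1 ∈ V(G) ∧ p.2 ∈ V(G) ∧ p.1 ≠ p.2 ∧ IsLambdaMatchablePair G p.1 p.2} =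
      ↑({p ∈ A ×ˢ B | IsLambdaMatchablePair G p.1 p.2} ∪
        {p ∈ B ×ˢ A | IsLambdaMatchablePair G p.1 p.2} : Finset (α × α)) := by
    ext ⟨u, v⟩
    simp only [Set.mem_ofPred_eq, Finset.coe_union, Finset.coe_filter, Finset.mem_product,
      Set.mem_union, h.mem_verts]
    constructor
    · rintro ⟨h1 | h1, h2 | h2, h3, h4⟩
      · exact absurd h4 (h.not_isLambdaMatchablePair_same h1 h2 h3)
      · exact Or.inl ⟨⟨h1, h2⟩, h4⟩
      · exact Or.inr ⟨⟨h1, h2⟩, h4⟩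
      · exact absurd h4 (h.symm.not_isLambdaMatchablePair_same h1 h2 h3)
    · rintro (⟨⟨h1, h2⟩, h3⟩ | ⟨⟨h1, h2⟩, h3⟩)
      · exact ⟨Or.inl h1, Or.inr h2, fun h4 => h.notMem_B h1 (h4 ▸ h2), h3⟩
      · exact ⟨Or.inr h1, Or.inl h2, fun h4 => h.notMem_B h2 (h4 ▸ h1), h3⟩
  have hdis : Disjoint ({p ∈ A ×ˢ B | IsLambdaMatchablePair G p.1 p.2} : Finset (α × α))
      {p ∈ B ×ˢ A | IsLambdaMatchablePair G p.1 p.2} := by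
    rw [Finset.disjoint_left]
    intro p h1 h2
    rw [Finset.mem_filter, Finset.mem_product] at h1 h2
    exact h.notMem_B h1.1.1 h2.1.1
  have e2 : ∀ (C D : Finset α), #{p ∈ C ×ˢ D | IsLambdaMatchablePair G p.1 p.2} =
      ∑ a ∈ C, ∑ b ∈ D, lam G a b := by
    intro C D
    rw [← Finset.sum_product']
    simp only [lam, Finset.sum_boole, Nat.cast_id]
  rw [rhoOrd, e1, Set.ncard_coe_finset, Finset.card_union_of_disjoint hdis, e2, e2, rho_eq,
    Finset.sum_comm (s := B)]
  rw [two_mul]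
  congr 1
  exact Finset.sum_congr rfl fun a _ => Finset.sum_congr rfl fun b _ => lam_comm G b a

variable {X : Set α} {x y : α}

lemma lam_inside (h : Rep G A B E s t) (hXV : X ⊆ V(G)) (oX : IsOut E s t X) (hy : y ∈ V(G) \ X)
    {a b : α} (ha : a ∈ A) (hb : b ∈ B) (haX : a ∈ X) (hbX : b ∈ X) :
    lam G a b = lam (CubicGraph.contract G (V(G) \ X) y) a b := by
  simp only [lam, h.pair_inside hXV oX hy ha hb haX hbX]

lemma lam_outside (h : Rep G A B E s t) (hXV : X ⊆ V(G)) (oX : IsOut E s t X) (hx : x ∈ X)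
    {a b : α} (ha : a ∈ A) (hb : b ∈ B) (haX : a ∉ X) (hbX : b ∉ X) :
    lam G a b = lam (CubicGraph.contract G X x) a b := by
  simp only [lam, h.pair_outside hXV oX hx ha hb haX hbX]

lemma lam_across (h : Rep G A B E s t) (hXV : X ⊆ V(G)) (oX : IsOut E s t X) (hx : x ∈ X)
    (hy : y ∈ V(G) \ X) {a b : α} (ha : a ∈ A) (hb : b ∈ B) (haX : a ∈ X) (hbX : b ∉ X) :
    lam G a b = lam (CubicGraph.contract G (V(G) \ X) y) a y *
      lam (CubicGraph.contract G X x) x b := by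
  simp only [lam, h.pair_across hXV oX hx hy ha hb haX hbX]
  split_ifs <;> simp_all

lemma lam_back (h : Rep G A B E s t) (oX : IsOut E s t X) {a b : α} (ha : a ∈ A) (hb : b ∈ B)
    (haX : a ∉ X) (hbX : b ∈ X) : lam G a b = 0 :=
  if_neg (h.not_pair_back oX ha hb haX hbX)

lemma sum_B_of_mem (h : Rep G A B E s t) (hXV : X ⊆ V(G)) (oX : IsOut E s t X) (hx : x ∈ X)
    (hy : y ∈ V(G) \ X) {a : α} (ha : a ∈ A) (haX : a ∈ X) :
    ∑ b ∈ B, lam G a b = ∑ b ∈ B with b ∈ X, lam (CubicGraph.contract G (V(G) \ X) y) a b +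
      lam (CubicGraph.contract G (V(G) \ X) y) a y * numPartners (CubicGraph.contract G X x) x := by
  rw [(h.contract hXV oX hx).numPartners_left (Finset.mem_insert_self _ _), Finset.mul_sum,
    ← Finset.sum_filter_add_sum_filter_not B (fun b => b ∈ X)]
  congr 1
  · refine Finset.sum_congr rfl fun b hb => ?_
    rw [Finset.mem_filter] at hb
    exact h.lam_inside hXV oX hy ha hb.1 haX hb.2
  · refine Finset.sum_congr rfl fun b hb => ?_
    rw [Finset.mem_filter] at hb
    exact h.lam_across hXV oX hx hy ha hb.1 haX hb.2

lemma sum_B_of_notMem (h : Rep G A B E s t) (hXV : X ⊆ V(G)) (oX : IsOut E s t X) (hx : x ∈ X)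
    {a : α} (ha : a ∈ A) (haX : a ∉ X) :
    ∑ b ∈ B, lam G a b = ∑ b ∈ B with b ∉ X, lam (CubicGraph.contract G X x) a b := by
  rw [← Finset.sum_filter_add_sum_filter_not B (fun b => b ∈ X), Finset.sum_eq_zero, zero_add]
  · refine Finset.sum_congr rfl fun b hb => ?_
    rw [Finset.mem_filter] at hb
    exact h.lam_outside hXV oX hx ha hb.1 haX hb.2
  · intro b hb
    rw [Finset.mem_filter] at hb
    exact h.lam_back oX ha hb.1 haX hb.2

lemma notMem_filter_compl (hy : y ∈ V(G) \ X) : y ∉ ({v ∈ B | v ∈ X} : Finset α) :=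
  fun h => hy.2 (Finset.mem_filter.1 h).2

lemma notMem_filter (hx : x ∈ X) : x ∉ ({v ∈ A | v ∉ X} : Finset α) :=
  fun h => (Finset.mem_filter.1 h).2 hx

/-- The number of `λ`-matchable pairs in terms of the two contractions at a tight cut. -/
lemma rho_step (h : Rep G A B E s t) (hXV : X ⊆ V(G)) (oX : IsOut E s t X) (hx : x ∈ X)
    (hy : y ∈ V(G) \ X) :
    rhoOrd G + 2 * numPartners (CubicGraph.contract G X x) x +
        2 * numPartners (CubicGraph.contract G (V(G) \ X) y) y =
      rhoOrd (CubicGraph.contract G X x) + rhoOrd (CubicGraph.contract G (V(G) \ X) y) +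
      2 * (numPartners (CubicGraph.contract G X x) x *
        numPartners (CubicGraph.contract G (V(G) \ X) y) y) := by
  have r1 := h.contract_compl oX hy
  have r2 := h.contract hXV oX hx
  rw [h.rhoOrd_eq, r1.rhoOrd_eq, r2.rhoOrd_eq, rho_eq, rho_eq, rho_eq]
  rw [← Finset.sum_filter_add_sum_filter_not A (fun a => a ∈ X)]
  have e1 : ∑ a ∈ A with a ∈ X, ∑ b ∈ B, lam G a b =
      ∑ a ∈ A with a ∈ X, ∑ b ∈ B with b ∈ X, lam (CubicGraph.contract G (V(G) \ X) y) a b +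
      numPartners (CubicGraph.contract G (V(G) \ X) y) y *
        numPartners (CubicGraph.contract G X x) x := by
    rw [r1.numPartners_right (Finset.mem_insert_self _ _), Finset.sum_mul, ← Finset.sum_add_distrib]
    refine Finset.sum_congr rfl fun a ha => ?_
    rw [Finset.mem_filter] at ha
    exact h.sum_B_of_mem hXV oX hx hy ha.1 ha.2
  have e2 : ∑ a ∈ A with a ∉ X, ∑ b ∈ B, lam G a b =
      ∑ a ∈ A with a ∉ X, ∑ b ∈ B with b ∉ X, lam (CubicGraph.contract G X x) a b := by
    refine Finset.sum_congr rfl fun a ha => ?_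
    rw [Finset.mem_filter] at ha
    exact h.sum_B_of_notMem hXV oX hx ha.1 ha.2
  have e3 : ∑ a ∈ A with a ∈ X, ∑ b ∈ insert y {b ∈ B | b ∈ X},
      lam (CubicGraph.contract G (V(G) \ X) y) a b =
      numPartners (CubicGraph.contract G (V(G) \ X) y) y +
      ∑ a ∈ A with a ∈ X, ∑ b ∈ B with b ∈ X, lam (CubicGraph.contract G (V(G) \ X) y) a b := by
    rw [r1.numPartners_right (Finset.mem_insert_self _ _), ← Finset.sum_add_distrib]
    exact Finset.sum_congr rfl fun a _ => Finset.sum_insert (notMem_filter_compl hy)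
  have e4 : ∑ a ∈ insert x {a ∈ A | a ∉ X}, ∑ b ∈ B with b ∉ X,
      lam (CubicGraph.contract G X x) a b =
      numPartners (CubicGraph.contract G X x) x +
      ∑ a ∈ A with a ∉ X, ∑ b ∈ B with b ∉ X, lam (CubicGraph.contract G X x) a b := by
    rw [r2.numPartners_left (Finset.mem_insert_self _ _), Finset.sum_insert (notMem_filter hx)]
  -- With p, q the partner numbers of x and y: the inner pairs of the two contractions number ρ₂ − q
  -- and ρ₁ − p, and pq pairs cross the cut. The identity is kept additive to avoid subtraction in
  -- ℕ.
  rw [e1, e2, e3, e4]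
  ring

/-- Partners of u inside X remain partners in G. If y is a partner of an A-vertex u, it is replaced
by all partners of x in the other contraction, of which there is at least one. -/
lemma numPartners_left_le (h : Rep G A B E s t) (hXV : X ⊆ V(G)) (oX : IsOut E s t X) (hx : x ∈ X)
    (hy : y ∈ V(G) \ X) (h2 : 1 ≤ numPartners (CubicGraph.contract G X x) x) {u : α} (huX : u ∈ X) :
    numPartners (CubicGraph.contract G (V(G) \ X) y) u ≤ numPartners G u := by
  have r1 := h.contract_compl oX hy
  rcases h.mem_verts.1 (hXV huX) with hu | hu
  · rw [h.numPartners_left hu, r1.numPartners_left (Finset.mem_filter.2 ⟨hu, huX⟩),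
      h.sum_B_of_mem hXV oX hx hy hu huX, Finset.sum_insert (notMem_filter_compl hy), add_comm]
    gcongr
    exact Nat.le_mul_of_pos_right _ h2
  · rw [h.numPartners_right hu, r1.numPartners_right
      (Finset.mem_insert_of_mem (Finset.mem_filter.2 ⟨hu, huX⟩))]
    rw [← Finset.sum_filter_add_sum_filter_not A (fun a => a ∈ X)]
    refine le_trans (le_of_eq ?_) (Nat.le_add_right _ _)
    refine Finset.sum_congr rfl fun a ha => ?_
    rw [Finset.mem_filter] at ha
    exact (h.lam_inside hXV oX hy ha.1 hu ha.2 huX).symm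

end Rep

/-- The laws relating `λ`-matchable pairs of a graph and its contractions at a tight cut. -/
lemma Cub.rho_step {G : Graph α β} (hG : Cub G) {X : Set α} {x y : α} (hXV : X ⊆ V(G))
    (hX : (cut G X).ncard = 3) (hx : x ∈ X) (hy : y ∈ V(G) \ X) :
    rhoOrd G + 2 * numPartners (CubicGraph.contract G X x) x +
        2 * numPartners (CubicGraph.contract G (V(G) \ X) y) y =
      rhoOrd (CubicGraph.contract G X x) + rhoOrd (CubicGraph.contract G (V(G) \ X) y) +
      2 * (numPartners (CubicGraph.contract G X x) x *
        numPartners (CubicGraph.contract G (V(G) \ X) y) y) := by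
  obtain ⟨A, B, E, s, t, h, oX⟩ := hG.exists_isOut hX
  exact h.rho_step hXV oX hx hy

lemma Cub.numPartners_le {G : Graph α β} (hG : Cub G) {X : Set α} {x y : α} (hXV : X ⊆ V(G))
    (hX : (cut G X).ncard = 3) (hx : x ∈ X) (hy : y ∈ V(G) \ X)
    (h2 : 1 ≤ numPartners (CubicGraph.contract G X x) x) {u : α} (hu : u ∈ X) :
    numPartners (CubicGraph.contract G (V(G) \ X) y) u ≤ numPartners G u := by
  obtain ⟨A, B, E, s, t, h, oX⟩ := hG.exists_isOut hX
  exact h.numPartners_left_le hXV oX hx hy h2 hu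

end Matchings

section Connectivity

variable {α β α' β' : Type*}

/-! ### `3`-connectedness of cubic graphs -/

lemma TEC.of_isKConnected {G : Graph α β} (hG : Cub G) (hK : IsKConnected 3 G) : TEC G := by
  rintro X ⟨u, hu, huX⟩ ⟨v, hv, hvX⟩
  by_contra hcon
  push Not at hcon
  obtain ⟨A, B, E, s, t, h⟩ := hG
  have hfin := h.cut_finite X
  have key := hK.2 u hu v hv (fun h => hvX (h ▸ huX)) ∅ hfin.toFinset (by simp) (by simp) (by
    rw [Finset.card_empty, zero_add, ← Set.ncard_eq_toFinset_card _ hfin]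
    exact hcon)
  have : ∀ w, ReflTransGen ((G.deleteVerts ((∅ : Finset α) : Set α)).deleteEdges
      (hfin.toFinset : Set β)).Adj u w → w ∈ X := by
    intro w hw
    induction hw with
    | refl => exact huX
    | @tail p q _ hpq ih =>
      obtain ⟨e, he⟩ := hpq
      simp only [Finset.coe_empty, Graph.deleteVerts_empty, Graph.deleteEdges_isLink,
        Set.Finite.coe_toFinset] at he
      by_contra hq
      exact he.2 ⟨p, q, he.1, ih, hq⟩
  exact hvX (this v key)

/-- In a cubic graph, each vertex of a mixed separator can be replaced by an edge. -/
lemma Rep.exists_cut_of_separator {G : Graph α β} {A B : Finset α} {E : Finset β} {s t : β → α}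
    (h : Rep G A B E s t) (S : Finset α) {u v : α} (huS : u ∉ S) (hvS : v ∉ S) (F : Finset β)
    (W : Set α) (hu : u ∈ W) (hv : v ∉ W)
    (hW : ∀ e p q, G.IsLink e p q → p ∈ W → q ∉ W → e ∉ F → q ∈ S) :
    ∃ (F' : Finset β) (W' : Set α), #F' ≤ #F + #S ∧ u ∈ W' ∧ v ∉ W' ∧ cut G W' ⊆ F' := by
  induction S using Finset.induction_on generalizing F W with
  | empty =>
    refine ⟨F, W, by simp, hu, hv, ?_⟩
    rintro e ⟨p, q, hl, hp, hq⟩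
    by_contra he
    exact Finset.notMem_empty _ (hW e p q hl hp hq he)
  | insert z S hz ih =>
    rw [Finset.mem_insert, not_or] at huS hvS
    -- I and J are the edges from z into W and out of W. Together they number at most three, so one
    -- of them has at most one edge: delete the edges of that set instead of z, and put z outside or
    -- inside W accordingly.
    set I : Finset β := {e ∈ E | ∃ q ∈ W, G.IsLink e z q} with hI
    set J : Finset β := {e ∈ E | ∃ q ∉ W, G.IsLink e z q} with hJ
    have hIJ : #I + #J ≤ 3 := by
      rw [← Finset.card_union_of_disjoint]
      · by_cases hzV : z ∈ V(G)
        · rw [← h.deg_eq hzV, deg, ← Set.ncard_coe_finset]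
          apply Set.ncard_le_ncard
          · intro e he
            simp only [hI, hJ, Finset.coe_union, Finset.coe_filter, Set.mem_union,
              Set.mem_ofPred_eq] at he
            rcases he with ⟨-, q, -, hl⟩ | ⟨-, q, -, hl⟩ <;> exact hl.inc_left
          · have : G.incidenceSet z ⊆ ↑E := by
              rw [← h.edgeSet]; exact G.incidenceSet_subset_edgeSet z
            exact (Finset.finite_toSet E).subset this
        · have : I ∪ J = ∅ := by
            rw [Finset.eq_empty_iff_forall_notMem]
            intro e he
            simp only [hI, hJ, Finset.mem_union, Finset.mem_filter] at he
            rcases he with ⟨-, q, -, hl⟩ | ⟨-, q, -, hl⟩ <;> exact hzV hl.left_mem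
          rw [this]; simp
      · rw [Finset.disjoint_left]
        intro e h1 h2
        simp only [hI, hJ, Finset.mem_filter] at h1 h2
        obtain ⟨-, q, hq, hl⟩ := h1
        obtain ⟨-, q', hq', hl'⟩ := h2
        exact hq' (hl.right_unique hl' ▸ hq)
    rw [Finset.card_insert_of_notMem hz]
    by_cases h1 : #I ≤ 1
    · obtain ⟨F', W', k1, k2⟩ := ih huS.2 hvS.2 (F ∪ I) W hu hv (by
        intro e p q hl hp hq he
        rw [Finset.mem_union, not_or] at he
        rcases Finset.mem_insert.1 (hW e p q hl hp hq he.1) with rfl | h3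
        · exact absurd (Finset.mem_filter.2 ⟨h.mem_edgeSet.1 hl.edge_mem, p, hp, hl.symm⟩) he.2
        · exact h3)
      have := Finset.card_union_le F I
      exact ⟨F', W', by omega, k2⟩
    · obtain ⟨F', W', k1, k2⟩ := ih huS.2 hvS.2 (F ∪ J) (insert z W) (Set.mem_insert_of_mem _ hu)
        (by rw [Set.mem_insert_iff, not_or]; exact ⟨hvS.1, hv⟩) (by
        intro e p q hl hp hq he
        rw [Finset.mem_union, not_or] at he
        rw [Set.mem_insert_iff, not_or] at hq
        rcases hp with rfl | hp
        · exact absurd (Finset.mem_filter.2 ⟨h.mem_edgeSet.1 hl.edge_mem, q, hq.2, hl⟩) he.2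
        · rcases Finset.mem_insert.1 (hW e p q hl hp hq.2 he.1) with h3 | h3
          · exact absurd h3 hq.1
          · exact h3)
      have := Finset.card_union_le F J
      exact ⟨F', W', by omega, k2⟩

lemma TEC.isKConnected {G : Graph α β} (hG : Cub G) (hT : TEC G) : IsKConnected 3 G := by
  obtain ⟨A, B, E, s, t, h⟩ := hG
  refine ⟨?_, fun u hu v hv huv S F huS hvS hSF => ?_⟩
  · exact (Set.one_lt_ncard h.finite).1 (by have := h.order_pos; rw [order] at this; omega)
  · by_contra hcon
    obtain ⟨F', W', h1, h2, h3, h4⟩ := h.exists_cut_of_separator S huS hvS F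
      {w | ReflTransGen ((G.deleteVerts (S : Set α)).deleteEdges (F : Set β)).Adj u w}
      ReflTransGen.refl hcon (by
        intro e p q hl hp hq he
        by_contra hqS
        apply hq
        refine ReflTransGen.tail hp ⟨e, ?_⟩
        rw [Graph.deleteEdges_isLink, Graph.deleteVerts_isLink]
        refine ⟨⟨hl, ?_, by exact_mod_cast hqS⟩, by exact_mod_cast he⟩
        rcases ReflTransGen.cases_tail hp with rfl | ⟨c, -, e', h'⟩
        · exact_mod_cast huS
        · rw [Graph.deleteEdges_isLink, Graph.deleteVerts_isLink] at h'
          exact h'.1.2.2)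
    have h5 := hT W' ⟨u, hu, h2⟩ ⟨v, hv, h3⟩
    have h6 := Set.ncard_le_ncard h4 (Finset.finite_toSet F')
    rw [Set.ncard_coe_finset] at h6
    omega

/-! ### Simplicity of 3-connected pieces, and λ-matchable pairs of braces. -/

/-- No two parallel edges. -/
def NoParallel (E : Finset β) (s t : β → α) : Prop :=
  ∀ e ∈ E, ∀ f ∈ E, s e = s f → t e = t f → e = f

namespace Rep

variable {G : Graph α β} {A B : Finset α} {E : Finset β} {s t : β → α}

/-- The ends of two parallel edges form a set whose cut has at most two edges, one at each end, and
some vertex lies outside it because the order exceeds two. -/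
lemma noParallel (h : Rep G A B E s t) (hT : TEC G) (ho : 2 < order G) : NoParallel E s t := by
  intro e he f hf hs ht
  by_contra hef
  have hA : 1 < #A := by rw [h.order_eq] at ho; omega
  obtain ⟨a, ha, hae⟩ := Finset.exists_mem_ne hA (s e)
  obtain ⟨X, hX⟩ : ∃ X : Set α, ∀ v, v ∈ X ↔ v = s e ∨ v = t e := ⟨{s e, t e}, fun _ => Iff.rfl⟩
  have h1 := hT X ⟨s e, h.s_mem he, (hX _).2 (Or.inl rfl)⟩ ⟨a, h.mem_verts.2 (Or.inl ha), by
    rw [hX, not_or]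
    exact ⟨hae, fun h2 => h.notMem_B ha (h2 ▸ h.tmem e he)⟩⟩
  rw [h.cut_ncard] at h1
  have key : ∀ (r : β → α) (p : β → Prop), #{x ∈ E | r x = r e} = 3 → r e = r f →
      ¬ p e → ¬ p f → #{x ∈ E | r x = r e ∧ p x} ≤ 1 := by
    intro r p h2 h3 h4 h5
    have : ({x ∈ E | r x = r e ∧ p x} : Finset β) ⊆ ({x ∈ E | r x = r e} \ {e, f}) := by
      intro x hx
      simp only [Finset.mem_filter, Finset.mem_sdiff, Finset.mem_insert,
        Finset.mem_singleton, not_or] at hx ⊢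
      refine ⟨⟨hx.1, hx.2.1⟩, ?_, ?_⟩
      · rintro rfl; exact h4 hx.2.2
      · rintro rfl; exact h5 hx.2.2
    have h6 := Finset.card_le_card this
    rw [Finset.card_sdiff_of_subset, h2, Finset.card_pair hef] at h6
    · exact h6
    · intro x hx
      simp only [Finset.mem_insert, Finset.mem_singleton] at hx
      rcases hx with rfl | rfl
      · simp [he]
      · simp [hf, h3]
  have hst : ∀ x ∈ E, ∀ y ∈ E, s x ≠ t y := fun x hx y hy h2 =>
    h.notMem_B (h.smem x hx) (h2 ▸ h.tmem y hy)
  have k1 : #{x ∈ E | s x = s e ∧ t x ≠ t e} ≤ 1 := by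
    convert key s (fun x => t x ≠ t e) (h.degA _ (h.smem e he)) hs (by simp) (by simp [ht])
  have k2 : #{x ∈ E | t x = t e ∧ s x ≠ s e} ≤ 1 := by
    convert key t (fun x => s x ≠ s e) (h.degB _ (h.tmem e he)) ht (by simp) (by simp [hs])
  have e1 : #{x ∈ E | s x ∈ X ∧ t x ∉ X} ≤
      #{x ∈ E | s x = s e ∧ t x ≠ t e} := by
    apply Finset.card_le_card
    intro x hx
    simp only [Finset.mem_filter, hX] at hx ⊢
    have := hst x hx.1 e he
    tauto
  have e2 : #{x ∈ E | s x ∉ X ∧ t x ∈ X} ≤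
      #{x ∈ E | t x = t e ∧ s x ≠ s e} := by
    apply Finset.card_le_card
    intro x hx
    simp only [Finset.mem_filter, hX] at hx ⊢
    have := (hst e he x hx.1).symm
    tauto
  omega

lemma noParallel_symm (hs : NoParallel E s t) : NoParallel E t s :=
  fun e he f hf h1 h2 => hs e he f hf h2 h1

lemma card_nbrs (h : Rep G A B E s t) (hs : NoParallel E s t) {a : α} (ha : a ∈ A) :
    #({e ∈ E | s e = a}.image t) = 3 := by
  rw [Finset.card_image_of_injOn, h.degA a ha]
  intro e he f hf hef
  simp only [Finset.coe_filter, Set.mem_ofPred_eq] at he hf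
  exact hs e he.1 f hf.1 (he.2.trans hf.2.symm) hef

lemma three_le_card (h : Rep G A B E s t) (hs : NoParallel E s t) : 3 ≤ #A := by
  obtain ⟨a, ha⟩ := h.nonempty
  rw [h.card_eq, ← h.card_nbrs hs ha]
  apply Finset.card_le_card
  intro b hb
  simp only [Finset.mem_image, Finset.mem_filter] at hb
  obtain ⟨e, ⟨he, -⟩, rfl⟩ := hb
  exact h.tmem e he

/-- The degree check for adding to M all edges at a and all edges at b, where M matches the vertices
other than a and the neighbors of b. Such a neighbor, if different from a, gets only its edge to b,
which is unique as there are no parallel edges. Used for both colors. -/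
lemma pair_degree (h : Rep G A B E s t) (hs : NoParallel E s t) {a b : α} (ha : a ∈ A) (hb : b ∈ B)
    {M : Finset β} (hM : ∀ e ∈ M, e ∈ E ∧ s e ≠ a ∧ ∀ f ∈ E, t f = b → s f ≠ s e)
    (hM' : ∀ v ∈ A, v ≠ a → (∀ f ∈ E, t f = b → s f ≠ v) → #{e ∈ M | s e = v} = 1) :
    ∀ v ∈ A, #{e ∈ {e ∈ E | e ∈ M ∨ s e = a ∨ t e = b} | s e = v} = pairDeg a b v := by
  intro v hv
  have hvb : v ≠ b := fun h1 => h.notMem_B hv (h1 ▸ hb)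
  by_cases hva : v = a
  · subst hva
    rw [Finset.filter_filter, pairDeg, if_pos (Or.inl rfl), ← h.degA v ha]
    congr 1
    ext e
    simp only [Finset.mem_filter]
    tauto
  rw [pairDeg, if_neg (by tauto)]
  by_cases hN : ∃ f ∈ E, t f = b ∧ s f = v
  · obtain ⟨f, hf, hfb, hfv⟩ := hN
    rw [Finset.card_eq_one]
    refine ⟨f, ?_⟩
    ext e
    simp only [Finset.mem_filter, Finset.mem_singleton]
    constructor
    · rintro ⟨⟨he, h1 | h1 | h1⟩, h2⟩
      · exact absurd (hfv.trans h2.symm) ((hM e h1).2.2 f hf hfb)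
      · exact absurd (h2.symm.trans h1) hva
      · exact hs e he f hf (h2.trans hfv.symm) (h1.trans hfb.symm)
    · rintro rfl
      exact ⟨⟨hf, Or.inr (Or.inr hfb)⟩, hfv⟩
  · push Not at hN
    rw [← hM' v hv hva hN]
    congr 1
    ext e
    simp only [Finset.mem_filter]
    constructor
    · rintro ⟨⟨he, h1 | h1 | h1⟩, h2⟩
      · exact ⟨h1, h2⟩
      · exact absurd (h2.symm.trans h1) hva
      · exact absurd h2 (hN e he h1)
    · rintro ⟨h1, h2⟩
      exact ⟨⟨(hM e h1).1, Or.inl h1⟩, h2⟩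

/-- In a simple cubic brace every pair of vertices of different colors is `λ`-matchable. -/
lemma isLambdaMatchablePair_of_leaf (h : Rep G A B E s t) (hs : NoParallel E s t)
    (hleaf : ∀ X, ¬ IsNT G X) {a b : α} (ha : a ∈ A) (hb : b ∈ B) : IsLambdaMatchablePair G a b := by
  set Na : Finset α := {e ∈ E | s e = a}.image t with hNa
  set Nb : Finset α := {e ∈ E | t e = b}.image s with hNb
  have mNa : ∀ v, v ∈ Na ↔ ∃ e ∈ E, s e = a ∧ t e = v := by
    intro v; simp only [hNa, Finset.mem_image, Finset.mem_filter, and_assoc]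
  have mNb : ∀ v, v ∈ Nb ↔ ∃ e ∈ E, t e = b ∧ s e = v := by
    intro v; simp only [hNb, Finset.mem_image, Finset.mem_filter, and_assoc]
  have cNa : #Na = 3 := h.card_nbrs hs ha
  have cNb : #Nb = 3 := h.symm.card_nbrs (noParallel_symm hs) hb
  have NaB : Na ⊆ B := by
    intro v hv
    obtain ⟨e, he, -, rfl⟩ := (mNa v).1 hv
    exact h.tmem e he
  have NbA : Nb ⊆ A := by
    intro v hv
    obtain ⟨e, he, -, rfl⟩ := (mNb v).1 hv
    exact h.smem e he
  -- All edges at a and b are forced, which saturates their neighbors. What remains is a perfect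
  -- matching of the graph without a, b and these neighbors.
  set A' : Finset α := A \ insert a Nb with hA'
  set B' : Finset α := B \ insert b Na with hB'
  set E' : Finset β := {e ∈ E | s e ∈ A' ∧ t e ∈ B'} with hE'
  have mA' : ∀ v, v ∈ A' ↔ v ∈ A ∧ v ≠ a ∧ v ∉ Nb := by
    intro v; simp only [hA', Finset.mem_sdiff, Finset.mem_insert, not_or]
  have mB' : ∀ v, v ∈ B' ↔ v ∈ B ∧ v ≠ b ∧ v ∉ Na := by
    intro v; simp only [hB', Finset.mem_sdiff, Finset.mem_insert, not_or]
  -- Adjacent a and b belong to each other's neighborhoods, so in either case equally many vertices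
  -- of each color are removed.
  have cAB : #A' = #B' := by
    rw [hA', hB', Finset.card_sdiff_of_subset (Finset.insert_subset ha NbA),
      Finset.card_sdiff_of_subset (Finset.insert_subset hb NaB), h.card_eq]
    congr 1
    by_cases hab : ∃ e ∈ E, s e = a ∧ t e = b
    · rw [Finset.insert_eq_of_mem ((mNb a).2 (by tauto)),
        Finset.insert_eq_of_mem ((mNa b).2 hab), cNa, cNb]
    · rw [Finset.card_insert_of_notMem fun h1 => hab (by have := (mNb a).1 h1; tauto),
        Finset.card_insert_of_notMem fun h1 => hab ((mNa b).1 h1), cNa, cNb]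
  obtain ⟨M, hM, -, hf⟩ := exists_factor_of_hall (A := A') (B := B') (E := E') (s := s) (t := t)
    (fun e he => (Finset.mem_filter.1 he).2.2) cAB (by
    intro S hS
    by_contra hlt
    push Not at hlt
    set T : Finset α := {e ∈ E' | s e ∈ S}.image t with hT
    have mT : ∀ v, v ∈ T ↔ ∃ e ∈ E, s e ∈ S ∧ t e = v ∧ v ∈ B' := by
      intro v
      simp only [hT, hE', Finset.mem_image, Finset.mem_filter]
      constructor
      · rintro ⟨e, ⟨⟨h1, h2, h3⟩, h4⟩, rfl⟩
        exact ⟨e, h1, h4, rfl, h3⟩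
      · rintro ⟨e, h1, h2, rfl, h3⟩
        exact ⟨e, ⟨⟨h1, hS h2, h3⟩, h2⟩, rfl⟩
    -- For a violator S of Hall's condition, with neighbors T in B', take Y = S ∪ {a} ∪ T ∪ N(a).
    -- Vertices of S have no edge to b, so no edge leaves Y from its A-side.
    obtain ⟨Y, hY⟩ : ∃ Y : Set α, ∀ v, v ∈ Y ↔ v ∈ insert a S ∨ v ∈ T ∪ Na :=
      ⟨{v | v ∈ insert a S ∨ v ∈ T ∪ Na}, fun _ => Iff.rfl⟩
    have YA : ∀ v ∈ A, v ∈ Y ↔ v ∈ insert a S := by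
      intro v hv
      refine ⟨fun h1 => ((hY v).1 h1).resolve_right fun h2 => ?_, fun h1 => (hY v).2 (Or.inl h1)⟩
      rcases Finset.mem_union.1 h2 with h2 | h2
      · obtain ⟨e, he, -, -, h3⟩ := (mT v).1 h2
        exact h.notMem_B hv ((mB' v).1 h3).1
      · exact h.notMem_B hv (NaB h2)
    have SA : insert a S ⊆ A := Finset.insert_subset ha fun v hv => ((mA' v).1 (hS hv)).1
    have TB : T ∪ Na ⊆ B := by
      refine Finset.union_subset (fun v hv => ?_) NaB
      obtain ⟨e, he, -, -, h3⟩ := (mT v).1 hv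
      exact ((mB' v).1 h3).1
    have YB : ∀ v ∈ B, v ∈ Y ↔ v ∈ T ∪ Na := fun v hv =>
      ⟨fun h1 => ((hY v).1 h1).resolve_left fun h2 => h.notMem_B (SA h2) hv,
        fun h1 => (hY v).2 (Or.inr h1)⟩
    have hclosed : ∀ e ∈ E, s e ∈ Y → t e ∈ Y := by
      intro e he h1
      rw [YA _ (h.smem e he), Finset.mem_insert] at h1
      rw [YB _ (h.tmem e he), Finset.mem_union]
      rcases h1 with h1 | h1
      · exact Or.inr ((mNa _).2 ⟨e, he, h1, rfl⟩)
      · by_cases h2 : t e ∈ Na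
        · exact Or.inr h2
        · refine Or.inl ((mT _).2 ⟨e, he, h1, rfl, (mB' _).2 ⟨h.tmem e he, ?_, h2⟩⟩)
          intro h3
          exact ((mA' _).1 (hS h1)).2.2 ((mNb _).2 ⟨e, he, h3, rfl⟩)
    -- The cut has 3(|T| + 3) − 3(|S| + 1) ≤ 3 edges because |T| < |S|; having at least two, it has
    -- exactly three. Two neighbors of b other than a lie outside Y, and a with a neighbor lies
    -- inside, so the tight cut is nontrivial, contrary to the brace property.
    have hx := h.excess Y
    have c1 : #{v ∈ A | v ∈ Y} = #S + 1 := by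
      rw [← Finset.card_insert_of_notMem (s := S) (a := a) fun h1 => ((mA' a).1 (hS h1)).2.1 rfl]
      congr 1
      ext v
      rw [Finset.mem_filter]
      exact ⟨fun h1 => (YA v h1.1).1 h1.2, fun h1 => ⟨SA h1, (YA v (SA h1)).2 h1⟩⟩
    have c2 : #{v ∈ B | v ∈ Y} = #T + 3 := by
      rw [← cNa, ← Finset.card_union_of_disjoint]
      · congr 1
        ext v
        rw [Finset.mem_filter]
        exact ⟨fun h1 => (YB v h1.1).1 h1.2, fun h1 => ⟨TB h1, (YB v (TB h1)).2 h1⟩⟩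
      · rw [Finset.disjoint_left]
        intro v hv
        obtain ⟨e, he, -, -, h3⟩ := (mT v).1 hv
        exact ((mB' v).1 h3).2.2
    have c3 : #{e ∈ E | s e ∈ Y ∧ t e ∉ Y} = 0 := by
      rw [Finset.card_eq_zero, Finset.filter_eq_empty_iff]
      intro e he h3
      exact h3.2 (hclosed e he h3.1)
    have aY : a ∈ Y := (YA a ha).2 (Finset.mem_insert_self _ _)
    obtain ⟨w, hw⟩ : Na.Nonempty := Finset.card_pos.1 (by omega)
    have wY : w ∈ Y := (hY w).2 <| Or.inr (Finset.mem_union_right _ hw)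
    obtain ⟨p, hp, q, hq, hpq⟩ := Finset.one_lt_card.1
      (show 1 < #(Nb.erase a) by have := Finset.pred_card_le_card_erase (a := a) (s := Nb); omega)
    have hout : ∀ v ∈ Nb.erase a, v ∈ V(G) \ Y := by
      intro v hv
      rw [Finset.mem_erase] at hv
      refine ⟨h.mem_verts.2 (Or.inl (NbA hv.2)), fun h1 => ?_⟩
      rcases Finset.mem_insert.1 ((YA v (NbA hv.2)).1 h1) with h2 | h2
      · exact hv.1 h2
      · exact ((mA' v).1 (hS h2)).2.2 hv.2
    have h2c := h.two_le_cut (h.mem_verts.2 (Or.inl ha)) aY (hout p hp).1 (hout p hp).2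
    rw [h.cut_ncard, c3] at h2c
    refine hleaf Y ⟨?_, ?_, ⟨a, aY, w, wY, ?_⟩, ⟨p, hout p hp, q, hout q hq, hpq⟩⟩
    · intro v hv
      rcases (hY v).1 hv with h1 | h1
      · exact h.mem_verts.2 (Or.inl (SA h1))
      · exact h.mem_verts.2 (Or.inr (TB h1))
    · rw [h.cut_ncard, c3]
      omega
    · rintro rfl
      exact h.notMem_B ha (NaB hw))
  have mM : ∀ e ∈ M, e ∈ E ∧ s e ∈ A' ∧ t e ∈ B' := fun e he => by simpa [hE'] using hM he
  rw [h.isLambdaMatchablePair_iff]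
  refine ⟨h.mem_verts.2 (Or.inl ha), h.mem_verts.2 (Or.inr hb),
    {e ∈ E | e ∈ M ∨ s e = a ∨ t e = b}, Finset.filter_subset _ _, ?_, ?_⟩
  · refine h.pair_degree hs ha hb (fun e he => ⟨(mM e he).1, ((mA' _).1 (mM e he).2.1).2.1, ?_⟩) ?_
    · intro f hf hfb hfe
      exact ((mA' _).1 (mM e he).2.1).2.2 ((mNb _).2 ⟨f, hf, hfb, hfe⟩)
    · intro v hv hva hvN
      refine hf.1 v ((mA' v).2 ⟨hv, hva, fun h1 => ?_⟩)
      obtain ⟨e, he, h2, h3⟩ := (mNb v).1 h1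
      exact hvN e he h2 h3
  · have := h.symm.pair_degree (noParallel_symm hs) hb ha (M := M)
      (fun e he => ⟨(mM e he).1, ((mB' _).1 (mM e he).2.2).2.1, ?_⟩) ?_
    · simp only [or_comm (a := t _ = b)] at this
      rwa [pairDeg_comm]
    · intro f hf hfb hfe
      exact ((mB' _).1 (mM e he).2.2).2.2 ((mNa _).2 ⟨f, hf, hfb, hfe⟩)
    · intro v hv hva hvN
      refine hf.2 v ((mB' v).2 ⟨hv, hva, fun h1 => ?_⟩)
      obtain ⟨e, he, h2, h3⟩ := (mNa v).1 h1
      exact hvN e he h2 h3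

end Rep

lemma Cub.numPartners_of_leaf {G : Graph α β} (hG : Cub G) (hT : TEC G) (ho : 2 < order G)
    (hleaf : ∀ X, ¬ IsNT G X) {u : α} (hu : u ∈ V(G)) : 2 * numPartners G u = order G := by
  obtain ⟨A, B, E, s, t, h⟩ := hG
  have hs := h.noParallel hT ho
  have key : ∀ a ∈ A, ∀ b ∈ B, lam G a b = 1 := fun a ha b hb =>
    if_pos (h.isLambdaMatchablePair_of_leaf hs hleaf ha hb)
  rw [h.order_eq]
  rcases h.mem_verts.1 hu with hu | hu
  · rw [h.numPartners_left hu, Finset.sum_congr rfl (key u hu)]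
    simp [h.card_eq]
  · rw [h.numPartners_right hu, Finset.sum_congr rfl fun a ha => key a ha u hu]
    simp

lemma Cub.rhoOrd_of_leaf {G : Graph α β} (hG : Cub G) (hT : TEC G) (ho : 2 < order G)
    (hleaf : ∀ X, ¬ IsNT G X) : 2 * rhoOrd G = order G ^ 2 := by
  obtain ⟨A, B, E, s, t, h⟩ := hG
  have hs := h.noParallel hT ho
  have key : ∀ a ∈ A, ∑ b ∈ B, lam G a b = #B := fun a ha => by
    rw [Finset.sum_congr rfl fun b hb =>
      show lam G a b = 1 from if_pos (h.isLambdaMatchablePair_of_leaf hs hleaf ha hb)]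
    simp
  rw [h.order_eq, h.rhoOrd_eq, Rep.rho_eq, Finset.sum_congr rfl key, ← h.card_eq]
  simp
  ring

lemma Cub.six_le_order {G : Graph α β} (hG : Cub G) (hT : TEC G) (ho : 2 < order G) :
    6 ≤ order G := by
  obtain ⟨A, B, E, s, t, h⟩ := hG
  have := h.three_le_card (h.noParallel hT ho)
  rw [h.order_eq]
  omega

end Connectivity

section Splicings

variable {α β α' β' : Type*}

/-! ### The graph `K₃,₃` -/

lemma K33_isLink {e : Sym2 (Fin 3 ⊕ Fin 3)} {x y : Fin 3 ⊕ Fin 3} :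
    K33.IsLink e x y ↔ e = s(x, y) ∧ (x.isLeft ∧ y.isRight ∨ x.isRight ∧ y.isLeft) := by
  simp only [K33, Graph.ofSimpleGraph]
  refine and_congr_right ?_
  rintro rfl
  simp

lemma K33_verts : V(K33) = Set.univ := rfl

lemma K33_not_loop {e : Sym2 (Fin 3 ⊕ Fin 3)} {x : Fin 3 ⊕ Fin 3} : ¬ K33.IsLink e x x := by
  rw [K33_isLink]
  rcases x with x | x <;> simp

lemma order_K33 : order K33 = 6 := by
  rw [order, K33_verts, Set.ncard_univ, Nat.card_eq_fintype_card]
  simp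

lemma deg_K33 (w : Fin 3 ⊕ Fin 3) : deg K33 w = 3 := by
  have key : ∀ f : Fin 3 → Fin 3 ⊕ Fin 3, Function.Injective f →
      K33.incidenceSet w = Set.range (fun j => s(w, f j)) → deg K33 w = 3 := by
    intro f hf h
    rw [deg, h, ← Set.image_univ, Set.ncard_image_of_injective]
    · simp
    · intro i j hij
      exact hf (Sym2.congr_right.1 hij)
  rcases w with i | i
  · refine key Sum.inr Sum.inr_injective ?_
    ext e
    simp only [Graph.mem_incidenceSet, Graph.Inc, K33_isLink, Set.mem_range]
    constructor
    · rintro ⟨y | y, rfl, h⟩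
      · simp at h
      · exact ⟨y, rfl⟩
    · rintro ⟨j, rfl⟩
      exact ⟨_, rfl, by simp⟩
  · refine key Sum.inl Sum.inl_injective ?_
    ext e
    simp only [Graph.mem_incidenceSet, Graph.Inc, K33_isLink, Set.mem_range]
    constructor
    · rintro ⟨y | y, rfl, h⟩
      · exact ⟨y, rfl⟩
      · simp at h
    · rintro ⟨j, rfl⟩
      exact ⟨_, rfl, by simp⟩

/-- A simple bipartite cubic graph of order six is isomorphic to `K₃,₃`. -/
lemma Rep.exists_isoVia_K33 {G : Graph α β} {A B : Finset α} {E : Finset β} {s t : β → α}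
    (h : Rep G A B E s t) (hs : NoParallel E s t) (ho : order G = 6) :
    ∃ F Γ, IsoVia G K33 F Γ := by
  have hA : #A = 3 := by rw [h.order_eq] at ho; omega
  have hB : #B = 3 := by rw [← h.card_eq, hA]
  let f : A ≃ Fin 3 := A.equivFinOfCardEq hA
  let g : B ≃ Fin 3 := B.equivFinOfCardEq hB
  set F : α → Fin 3 ⊕ Fin 3 := fun v => if hv : v ∈ A then Sum.inl (f ⟨v, hv⟩) else
    if hv : v ∈ B then Sum.inr (g ⟨v, hv⟩) else Sum.inl 0 with hF
  have FA : ∀ v (hv : v ∈ A), F v = Sum.inl (f ⟨v, hv⟩) := fun v hv => dif_pos hv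
  have FB : ∀ v (hv : v ∈ B), F v = Sum.inr (g ⟨v, hv⟩) := fun v hv => by
    rw [hF]; dsimp only; rw [dif_neg (h.notMem_A hv), dif_pos hv]
  have hinj : Set.InjOn F V(G) := by
    intro u hu v hv huv
    rcases h.mem_verts.1 hu with hu | hu <;> rcases h.mem_verts.1 hv with hv | hv
    · rw [FA u hu, FA v hv, Sum.inl.injEq, f.apply_eq_iff_eq, Subtype.mk.injEq] at huv
      exact huv
    · rw [FA u hu, FB v hv] at huv; cases huv
    · rw [FB u hu, FA v hv] at huv; cases huv
    · rw [FB u hu, FB v hv, Sum.inr.injEq, g.apply_eq_iff_eq, Subtype.mk.injEq] at huv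
      exact huv
  have hadj : ∀ a ∈ A, ∀ b ∈ B, ∃ e ∈ E, s e = a ∧ t e = b := by
    intro a ha b hb
    have h1 : {e ∈ E | s e = a}.image t = B := by
      refine Finset.eq_of_subset_of_card_le ?_ (by rw [h.card_nbrs hs ha, hB])
      intro v hv
      simp only [Finset.mem_image, Finset.mem_filter] at hv
      obtain ⟨e, ⟨he, -⟩, rfl⟩ := hv
      exact h.tmem e he
    rw [← h1] at hb
    simp only [Finset.mem_image, Finset.mem_filter] at hb
    obtain ⟨e, ⟨he, h2⟩, h3⟩ := hb
    exact ⟨e, he, h2, h3⟩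
  have hlink : ∀ e ∈ E, K33.IsLink s(F (s e), F (t e)) (F (s e)) (F (t e)) := by
    intro e he
    rw [K33_isLink, FA _ (h.smem e he), FB _ (h.tmem e he)]
    simp
  refine ⟨F, fun e => s(F (s e), F (t e)), hinj, ?_, ?_, ?_, ?_⟩
  · rw [K33_verts, Set.eq_univ_iff_forall]
    rintro (i | i)
    · refine ⟨f.symm i, h.mem_verts.2 (Or.inl (f.symm i).2), ?_⟩
      rw [FA _ (f.symm i).2]
      simp
    · refine ⟨g.symm i, h.mem_verts.2 (Or.inr (g.symm i).2), ?_⟩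
      rw [FB _ (g.symm i).2]
      simp
  · intro e he e' he' hee
    rw [h.mem_edgeSet] at he he'
    rcases Sym2.eq_iff.1 hee with ⟨h1, h2⟩ | ⟨h1, h2⟩
    · exact hs e he e' he' (hinj (h.s_mem he) (h.s_mem he') h1) (hinj (h.t_mem he) (h.t_mem he') h2)
    · exact absurd (hinj (h.s_mem he) (h.t_mem he') h1)
        fun h3 => h.notMem_B (h.smem e he) (h3 ▸ h.tmem e' he')
  · ext e'
    constructor
    · rintro ⟨e, he, rfl⟩
      exact (hlink e (h.mem_edgeSet.1 he)).edge_mem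
    · intro he'
      obtain ⟨x, y, hl⟩ := Graph.exists_isLink_of_mem_edgeSet he'
      obtain ⟨i, j, rfl⟩ : ∃ i j, e' = s(Sum.inl i, Sum.inr j) := by
        rw [K33_isLink] at hl
        obtain ⟨rfl, h1⟩ := hl
        rcases x with x | x <;> rcases y with y | y <;> simp at h1
        · exact ⟨x, y, rfl⟩
        · exact ⟨y, x, Sym2.eq_swap⟩
      obtain ⟨e, he, h1, h2⟩ := hadj _ (f.symm i).2 _ (g.symm j).2
      refine ⟨e, h.mem_edgeSet.2 he, ?_⟩
      dsimp only
      rw [h1, h2, FA _ (f.symm i).2, FB _ (g.symm j).2]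
      simp
  · intro e x y hl
    obtain ⟨he, ⟨rfl, rfl⟩ | ⟨rfl, rfl⟩⟩ := (h.isLink _ _ _).1 hl
    · exact hlink e he
    · exact (hlink e he).symm

/-! ### Splicings and contractions -/

lemma incidenceSet_contract {G : Graph α β} {X : Set α} {x : α} (hx : x ∈ X) :
    (contract G X x).incidenceSet x = cut G X := by
  have key : ∀ y, collapse X x y = x ↔ y ∈ X := by
    intro y
    by_cases hy : y ∈ X
    · simp [collapse_of_mem hy, hy]
    · rw [collapse_of_notMem hy]
      exact ⟨fun h => h ▸ hx, fun h => absurd h hy⟩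
  ext e
  rw [Graph.mem_incidenceSet]
  constructor
  · rintro ⟨u, hl⟩
    obtain ⟨y, z, h1, h2, h3, -⟩ := contract_isLink.1 hl
    exact ⟨y, z, h1, (key y).1 h3, fun h4 => h2 ⟨(key y).1 h3, h4⟩⟩
  · rintro ⟨y, z, h1, h2, h3⟩
    exact ⟨_, contract_isLink.2 ⟨y, z, h1, fun h4 => h3 h4.2, (key y).2 h2, rfl⟩⟩

lemma IsoVia.incidenceSet {G : Graph α β} {G' : Graph α' β'} {F : α → α'} {Γ : β → β'}
    (h : IsoVia G G' F Γ) {v : α} (hv : v ∈ V(G)) :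
    Set.BijOn Γ (G.incidenceSet v) (G'.incidenceSet (F v)) := by
  refine ⟨?_, h.injE.mono (G.incidenceSet_subset_edgeSet v), ?_⟩
  · rintro e ⟨y, hl⟩
    exact ⟨F y, h.link _ _ _ hl⟩
  · rintro e' ⟨y', hl⟩
    obtain ⟨e, he, rfl⟩ : e' ∈ Γ '' E(G) := h.imgE ▸ hl.edge_mem
    obtain ⟨y, hy, rfl⟩ : y' ∈ F '' V(G) := h.imgV ▸ hl.right_mem
    exact ⟨e, ⟨y, (h.link_iff he hv hy).1 hl⟩, rfl⟩

/-- A graph is a splicing of its contractions at a cut. -/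
lemma isSplicing_contract {G : Graph α β} {X : Set α} {x y : α} (hXV : X ⊆ V(G)) (hx : x ∈ X)
    (hy : y ∈ V(G) \ X) {K : Graph α' β'} {F : α → α'} {Γ : β → β'}
    (h : IsoVia (contract G (V(G) \ X) y) K F Γ) :
    IsSplicing G (contract G X x) x K (F y) := by
  have hcut : cut G (V(G) \ X) = cut G X := by
    ext e
    constructor
    · rintro ⟨u, v, hl, hu, hv⟩
      exact ⟨v, u, hl.symm, by_contra fun h1 => hv ⟨hl.right_mem, h1⟩, hu.2⟩
    · rintro ⟨u, v, hl, hu, hv⟩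
      exact ⟨v, u, hl.symm, ⟨hl.right_mem, hv⟩, fun h1 => h1.2 hu⟩
  have v1 : V(contract G X x) = insert x (V(G) \ X) := contract_verts' hXV hx
  have v2 : V(contract G (V(G) \ X) y) = insert y X := by
    rw [contract_verts' Set.sdiff_subset hy, Set.sdiff_sdiff_cancel_left hXV]
  have hy2 : y ∈ V(contract G (V(G) \ X) y) := v2 ▸ Set.mem_insert _ _
  have hXm : ∀ v ∈ X, v ∈ V(contract G (V(G) \ X) y) := fun v hv => v2 ▸ Set.mem_insert_of_mem _ hv
  have hFy : ∀ v ∈ X, F v ≠ F y := fun v hv h1 => hy.2 (h.injV (hXm v hv) hy2 h1 ▸ hv)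
  have hb := h.incidenceSet hy2
  rw [incidenceSet_contract hy, hcut] at hb
  have cX : ∀ v ∈ X, collapse (V(G) \ X) y v = v := fun v hv => collapse_of_notMem fun h1 => h1.2 hv
  have cX' : ∀ v ∈ V(G), v ∉ X → collapse (V(G) \ X) y v = y := fun v hv h1 =>
    collapse_of_mem ⟨hv, h1⟩
  have hne : ∀ v, v ∉ X → v ≠ x := fun v h1 h2 => h1 (h2 ▸ hx)
  -- the links of the two contractions
  have l1 : ∀ e u v, u ∉ X → v ∉ X → G.IsLink e u v → (contract G X x).IsLink e u v :=
    fun e u v hu hv hl => contract_isLink.2 ⟨u, v, hl, fun h1 => hu h1.1, collapse_of_notMem hu,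
      collapse_of_notMem hv⟩
  have l2 : ∀ e u v, u ∈ X → v ∉ X → G.IsLink e u v → (contract G X x).IsLink e x v :=
    fun e u v hu hv hl => contract_isLink.2 ⟨u, v, hl, fun h1 => hv h1.2, collapse_of_mem hu,
      collapse_of_notMem hv⟩
  have l3 : ∀ e u v, u ∈ X → v ∈ X → G.IsLink e u v → (contract G (V(G) \ X) y).IsLink e u v :=
    fun e u v hu hv hl => contract_isLink.2 ⟨u, v, hl, fun h1 => h1.1.2 hu, cX u hu, cX v hv⟩
  have l4 : ∀ e u v, u ∉ X → v ∈ X → G.IsLink e u v → (contract G (V(G) \ X) y).IsLink e y v :=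
    fun e u v hu hv hl => contract_isLink.2 ⟨u, v, hl, fun h1 => h1.2.2 hv,
      cX' u hl.left_mem hu, cX v hv⟩
  have m1 : ∀ e u v, (contract G X x).IsLink e u v → u ≠ x → v ≠ x → G.IsLink e u v := by
    intro e u v hl hu hv
    obtain ⟨p, q, h1, h2, rfl, rfl⟩ := contract_isLink.1 hl
    have hp : p ∉ X := fun h3 => hu (collapse_of_mem h3)
    have hq : q ∉ X := fun h3 => hv (collapse_of_mem h3)
    rwa [collapse_of_notMem hp, collapse_of_notMem hq]
  have m2 : ∀ e v, (contract G X x).IsLink e x v → v ≠ x → ∃ u ∈ X, G.IsLink e u v := by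
    intro e v hl hv
    obtain ⟨p, q, h1, h2, h3, rfl⟩ := contract_isLink.1 hl
    have hq : q ∉ X := fun h3 => hv (collapse_of_mem h3)
    rw [collapse_of_notMem hq]
    refine ⟨p, by_contra fun h4 => ?_, h1⟩
    rw [collapse_of_notMem h4] at h3
    exact hne p h4 h3
  have cutE : ∀ e u v, G.IsLink e u v → (e ∈ cut G X ↔ ¬ (u ∈ X ↔ v ∈ X)) :=
    fun e u v hl => mem_cut_of_isLink hl X
  -- Edges inside X become edges of K away from the contraction vertex; cut edges and edges outside
  -- X keep their labels. This is the splicing with respect to Γ itself.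
  set P : β → Prop := fun e => ∃ u v, G.IsLink e u v ∧ u ∈ X ∧ v ∈ X with hP
  have Piff : ∀ e u v, G.IsLink e u v → (P e ↔ u ∈ X ∧ v ∈ X) := by
    intro e u v hl
    constructor
    · rintro ⟨p, q, h1, h2, h3⟩
      rcases hl.eq_and_eq_or_eq_and_eq h1 with ⟨rfl, rfl⟩ | ⟨rfl, rfl⟩ <;> tauto
    · exact fun h1 => ⟨u, v, hl, h1⟩
  have PE : ∀ e, P e → e ∈ E(contract G (V(G) \ X) y) := by
    rintro e ⟨u, v, hl, hu, hv⟩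
    exact (l3 e u v hu hv hl).edge_mem
  have L1 : ∀ e u v, G.IsLink e u v → u ∉ X → v ∈ X →
      (splice (contract G X x) x K (F y) Γ).IsLink (Sum.inl e) (Sum.inl u) (Sum.inr (F v)) :=
    fun e u v hl hu hv => ⟨l2 e v u hv hu hl.symm, h.link _ _ _ (l4 e u v hu hv hl), hne u hu,
      hFy v hv⟩
  refine ⟨v1 ▸ Set.mem_insert _ _, h.memV hy2, Γ, ?_, ?_⟩
  · rw [incidenceSet_contract hx]; exact hb
  apply IsoVia.iso (F := fun v => if v ∈ X then Sum.inr (F v) else Sum.inl v)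
    (Γ := fun e => if P e then Sum.inr (Γ e) else Sum.inl e)
  have hlink : ∀ e u v, G.IsLink e u v → (splice (contract G X x) x K (F y) Γ).IsLink
      (if P e then Sum.inr (Γ e) else Sum.inl e) (if u ∈ X then Sum.inr (F u) else Sum.inl u)
      (if v ∈ X then Sum.inr (F v) else Sum.inl v) := by
    intro e u v hl
    by_cases hu : u ∈ X <;> by_cases hv : v ∈ X
    · rw [if_pos ((Piff e u v hl).2 ⟨hu, hv⟩), if_pos hu, if_pos hv]
      exact ⟨h.link _ _ _ (l3 e u v hu hv hl), hFy u hu, hFy v hv⟩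
    · rw [if_neg fun h1 => hv ((Piff e u v hl).1 h1).2, if_pos hu, if_neg hv]
      exact (L1 e v u hl.symm hv hu).symm
    · rw [if_neg fun h1 => hu ((Piff e u v hl).1 h1).1, if_neg hu, if_pos hv]
      exact L1 e u v hl hu hv
    · rw [if_neg fun h1 => hu ((Piff e u v hl).1 h1).1, if_neg hu, if_neg hv]
      exact ⟨l1 e u v hu hv hl, hne u hu, hne v hv⟩
  refine ⟨?_, ?_, ?_, ?_, hlink⟩
  · intro u hu v hv huv
    dsimp only at huv
    split_ifs at huv with h1 h2 h2
    · exact h.injV (hXm u h1) (hXm v h2) (Sum.inr_injective huv)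
    · exact Sum.inl_injective huv
  · ext p
    simp only [splice, Set.mem_image, Set.mem_union, Set.mem_sdiff, Set.mem_singleton_iff, v1]
    constructor
    · rintro ⟨v, hv, rfl⟩
      by_cases hvX : v ∈ X
      · rw [if_pos hvX]
        exact Or.inr ⟨F v, ⟨h.memV (hXm v hvX), hFy v hvX⟩, rfl⟩
      · rw [if_neg hvX]
        exact Or.inl ⟨v, ⟨Or.inr ⟨hv, hvX⟩, hne v hvX⟩, rfl⟩
    · rintro (⟨v, ⟨h1, h2⟩, rfl⟩ | ⟨v', ⟨h1, h2⟩, rfl⟩)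
      · have h3 := h1.resolve_left h2
        exact ⟨v, h3.1, if_neg h3.2⟩
      · obtain ⟨v, hv, rfl⟩ : v' ∈ F '' V(contract G (V(G) \ X) y) := h.imgV ▸ h1
        rw [v2] at hv
        rcases hv with rfl | hv
        · exact absurd rfl h2
        · exact ⟨v, hXV hv, if_pos hv⟩
  · intro e he e' he' hee
    dsimp only at hee
    split_ifs at hee with h1 h2 h2
    · exact h.injE (PE e h1) (PE e' h2) (Sum.inr_injective hee)
    · exact Sum.inl_injective hee
  · ext p
    constructor
    · rintro ⟨e, he, rfl⟩
      obtain ⟨u, v, hl⟩ := Graph.exists_isLink_of_mem_edgeSet he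
      exact (hlink e u v hl).edge_mem
    · intro hp
      obtain ⟨u, v, hl⟩ := Graph.exists_isLink_of_mem_edgeSet hp
      have r1 : ∀ e u v, (contract G X x).IsLink e u v → u ≠ x → v ≠ x →
          Sum.inl e ∈ (fun e => if P e then (Sum.inr (Γ e) : β ⊕ β') else Sum.inl e) '' E(G) := by
        intro e u v hl hu hv
        have h1 := m1 e u v hl hu hv
        have hu' : u ∉ X := by
          have := hl.left_mem
          rw [v1] at this
          exact (this.resolve_left hu).2
        exact ⟨e, h1.edge_mem, if_neg fun h2 => hu' ((Piff e u v h1).1 h2).1⟩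
      have r2 : ∀ e v, (contract G X x).IsLink e x v → v ≠ x →
          Sum.inl e ∈ (fun e => if P e then (Sum.inr (Γ e) : β ⊕ β') else Sum.inl e) '' E(G) := by
        intro e v hl hv
        obtain ⟨u, hu, h1⟩ := m2 e v hl hv
        have hv' : v ∉ X := by
          have := hl.right_mem
          rw [v1] at this
          exact (this.resolve_left hv).2
        exact ⟨e, h1.edge_mem, if_neg fun h2 => hv' ((Piff e u v h1).1 h2).2⟩
      rcases p with e | f <;> rcases u with u | u <;> rcases v with v | v
      · exact r1 e u v hl.1 hl.2.1 hl.2.2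
      · exact r2 e u hl.1 hl.2.2.1
      · exact r2 e v hl.1 hl.2.2.1
      · exact hl.elim
      · exact hl.elim
      · exact hl.elim
      · exact hl.elim
      · obtain ⟨h1, h2, h3⟩ := hl
        obtain ⟨e, he, rfl⟩ : f ∈ Γ '' E(contract G (V(G) \ X) y) := h.imgE ▸ h1.edge_mem
        obtain ⟨p, q, hpq⟩ := Graph.exists_isLink_of_mem_edgeSet he
        obtain ⟨p', q', h5, h6, rfl, rfl⟩ := contract_isLink.1 hpq
        have hcase := (h.link _ _ _ hpq).eq_and_eq_or_eq_and_eq h1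
        have k : p' ∈ X ∧ q' ∈ X := by
          constructor
          · by_contra h7
            rw [cX' p' h5.left_mem h7] at hcase
            rcases hcase with ⟨h8, -⟩ | ⟨h8, -⟩
            · exact h2 h8.symm
            · exact h3 h8.symm
          · by_contra h7
            rw [cX' q' h5.right_mem h7] at hcase
            rcases hcase with ⟨-, h8⟩ | ⟨-, h8⟩
            · exact h3 h8.symm
            · exact h2 h8.symm
        exact ⟨e, h5.edge_mem, if_pos ((Piff e p' q' h5).2 k)⟩

lemma splice_not_loop {G : Graph α β} {v : α} {K : Graph α' β'} {w : α'} {π : β → β'}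
    (hG : ∀ e x, ¬ G.IsLink e x x) (hK : ∀ e x, ¬ K.IsLink e x x) (e : β ⊕ β') (x : α ⊕ α') :
    ¬ (splice G v K w π).IsLink e x x := by
  rcases e with e | e <;> rcases x with x | x
  · exact fun h => hG _ _ h.1
  · exact id
  · exact id
  · exact fun h => hK _ _ h.1

/-- The contraction of a splicing at the shore of the second graph is the first graph. -/
lemma splice_contract_isoVia {G : Graph α β} {v : α} {K : Graph α' β'} {w : α'} {π : β → β'}
    (hG : ∀ e x, ¬ G.IsLink e x x) (hK : ∀ e x, ¬ K.IsLink e x x) (hv : v ∈ V(G))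
    (hπ : Set.BijOn π (G.incidenceSet v) (K.incidenceSet w)) (e₀ : β) {x : α'} (hx : x ∈ V(K) \ {w}) :
    IsoVia (contract (splice G v K w π) (Sum.inr '' (V(K) \ {w})) (Sum.inr x)) G
      (Sum.elim id fun _ => v) (Sum.elim id fun _ => e₀) := by
  set X : Set (α ⊕ α') := Sum.inr '' (V(K) \ {w}) with hX
  have hXV : X ⊆ V(splice G v K w π) := Set.subset_union_right
  have hxX : Sum.inr x ∈ X := ⟨x, hx, rfl⟩
  have nl : ∀ u, Sum.inl u ∉ X := by rintro u ⟨z, -, h⟩; cases h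
  have vs : V(contract (splice G v K w π) X (Sum.inr x)) =
      insert (Sum.inr x) (Sum.inl '' (V(G) \ {v})) := by
    rw [contract_verts' hXV hxX]
    congr 1
    ext p
    constructor
    · rintro ⟨h1 | h1, h2⟩
      · exact h1
      · exact absurd h1 h2
    · rintro ⟨u, hu, rfl⟩
      exact ⟨Or.inl ⟨u, hu, rfl⟩, nl u⟩
  have mX : ∀ e u, (splice G v K w π).IsLink e u u → False := fun e u =>
    splice_not_loop hG hK e u
  have rX : ∀ e p q, (splice G v K w π).IsLink e p (Sum.inr q) → Sum.inr q ∈ X := by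
    intro e p q h
    rcases h.right_mem with ⟨z, -, h1⟩ | h1
    · cases h1
    · exact h1
  -- links at the contraction vertex
  have hcl : ∀ e u, G.IsLink e v u → (contract (splice G v K w π) X (Sum.inr x)).IsLink (Sum.inl e)
      (Sum.inr x) (Sum.inl u) := by
    intro e u hl
    have hu : u ≠ v := by rintro rfl; exact hG _ _ hl
    obtain ⟨z, hz⟩ := hπ.mapsTo (show e ∈ G.incidenceSet v from ⟨u, hl⟩)
    have hzw : z ≠ w := by rintro rfl; exact hK _ _ hz
    have h1 : (splice G v K w π).IsLink (Sum.inl e) (Sum.inr z) (Sum.inl u) := ⟨hl, hz, hu, hzw⟩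
    exact contract_isLink.2 ⟨_, _, h1, fun h2 => nl u h2.2, collapse_of_mem (rX _ _ _ h1.symm),
      collapse_of_notMem (nl u)⟩
  have hcl2 : ∀ e p q, G.IsLink e p q → p ≠ v → q ≠ v →
      (contract (splice G v K w π) X (Sum.inr x)).IsLink (Sum.inl e) (Sum.inl p) (Sum.inl q) := by
    intro e p q hl hp hq
    have h1 : (splice G v K w π).IsLink (Sum.inl e) (Sum.inl p) (Sum.inl q) := ⟨hl, hp, hq⟩
    exact contract_isLink.2 ⟨_, _, h1, fun h2 => nl p h2.1, collapse_of_notMem (nl p),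
      collapse_of_notMem (nl q)⟩
  have hlink : ∀ e p q, (contract (splice G v K w π) X (Sum.inr x)).IsLink e p q →
      G.IsLink (Sum.elim id (fun _ => e₀) e) (Sum.elim id (fun _ => v) p)
        (Sum.elim id (fun _ => v) q) := by
    intro e p q hl
    obtain ⟨a, b, h1, h2, rfl, rfl⟩ := contract_isLink.1 hl
    rcases e with e | e <;> rcases a with a | a <;> rcases b with b | b
    · rw [collapse_of_notMem (nl a), collapse_of_notMem (nl b)]
      exact h1.1
    · rw [collapse_of_notMem (nl a), collapse_of_mem (rX _ _ _ h1)]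
      exact h1.1.symm
    · rw [collapse_of_notMem (nl b), collapse_of_mem (rX _ _ _ h1.symm)]
      exact h1.1
    · exact h1.elim
    · exact h1.elim
    · exact h1.elim
    · exact h1.elim
    · exact absurd ⟨rX _ _ _ h1.symm, rX _ _ _ h1⟩ h2
  -- Only labels of the first graph survive the contraction, so the default label `e₀` in the edge
  -- map is never used.
  have einl : ∀ e ∈ E(contract (splice G v K w π) X (Sum.inr x)), ∃ e', e = Sum.inl e' := by
    intro e he
    obtain ⟨p, q, hl⟩ := Graph.exists_isLink_of_mem_edgeSet he
    obtain ⟨a, b, h1, h2, -, -⟩ := contract_isLink.1 hl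
    rcases e with e | e
    · exact ⟨e, rfl⟩
    · rcases a with a | a <;> rcases b with b | b
      · exact h1.elim
      · exact h1.elim
      · exact h1.elim
      · exact absurd ⟨rX _ _ _ h1.symm, rX _ _ _ h1⟩ h2
  refine ⟨?_, ?_, ?_, ?_, hlink⟩
  · rw [vs]
    rintro p (rfl | ⟨p, hp, rfl⟩) q (rfl | ⟨q, hq, rfl⟩) hpq
    · rfl
    · exact absurd (Eq.symm hpq) hq.2
    · exact absurd hpq hp.2
    · exact congrArg Sum.inl hpq
  · rw [vs]
    ext u
    constructor
    · rintro ⟨p, rfl | ⟨p, hp, rfl⟩, rfl⟩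
      · exact hv
      · exact hp.1
    · intro hu
      by_cases huv : u = v
      · exact ⟨Sum.inr x, Or.inl rfl, huv.symm⟩
      · exact ⟨Sum.inl u, Or.inr ⟨u, ⟨hu, huv⟩, rfl⟩, rfl⟩
  · intro e he e' he' hee
    obtain ⟨e, rfl⟩ := einl e he
    obtain ⟨e', rfl⟩ := einl e' he'
    exact congrArg Sum.inl hee
  · ext e
    constructor
    · rintro ⟨e, he, rfl⟩
      obtain ⟨p, q, hl⟩ := Graph.exists_isLink_of_mem_edgeSet he
      exact (hlink _ _ _ hl).edge_mem
    · intro he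
      obtain ⟨p, q, hl⟩ := Graph.exists_isLink_of_mem_edgeSet he
      refine ⟨Sum.inl e, ?_, rfl⟩
      by_cases hp : p = v
      · subst hp
        exact (hcl e q hl).edge_mem
      · by_cases hq : q = v
        · subst hq
          exact (hcl e p hl.symm).edge_mem
        · exact (hcl2 e p q hl hp hq).edge_mem

/-- The joining edges carry the labels of the edges of G at v, and π puts these in bijection with
the edges of K at w. -/
lemma cut_splice {G : Graph α β} {v : α} {K : Graph α' β'} {w : α'} {π : β → β'}
    (hG : ∀ e x, ¬ G.IsLink e x x) (hK : ∀ e x, ¬ K.IsLink e x x)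
    (hπ : Set.BijOn π (G.incidenceSet v) (K.incidenceSet w)) :
    (cut (splice G v K w π) (Sum.inr '' (V(K) \ {w}))).ncard = deg K w := by
  have : cut (splice G v K w π) (Sum.inr '' (V(K) \ {w})) = Sum.inl '' G.incidenceSet v := by
    ext e
    constructor
    · rintro ⟨p, q, h1, ⟨a, ha, rfl⟩, hq⟩
      rcases e with e | e <;> rcases q with q | q
      · exact ⟨e, ⟨q, h1.1⟩, rfl⟩
      · exact h1.elim
      · exact h1.elim
      · exact absurd ⟨q, ⟨h1.1.right_mem, h1.2.2⟩, rfl⟩ hq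
    · rintro ⟨e, he, rfl⟩
      obtain ⟨z, hz⟩ := hπ.mapsTo he
      obtain ⟨u, hu⟩ := he
      have hzw : z ≠ w := by rintro rfl; exact hK _ _ hz
      have huv : u ≠ v := by rintro rfl; exact hG _ _ hu
      refine ⟨Sum.inr z, Sum.inl u, ⟨hu, hz, huv, hzw⟩, ⟨z, ⟨hz.right_mem, hzw⟩, rfl⟩, ?_⟩
      rintro ⟨_, -, h⟩
      cases h
  rw [this, Set.ncard_image_of_injective _ Sum.inl_injective, deg, ← hπ.image_eq,
    Set.InjOn.ncard_image hπ.injOn]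

end Splicings

section Pieces

variable {α β α' β' : Type*}

/-! ### `3`-connected bipartite cubic graphs of order greater than two -/

/-- The 3-connected pieces other than Θ: for cubic graphs 3-connectedness is the absence of smaller
cuts, and order two singles out Θ. -/
structure Piece (G : Graph α β) : Prop where
  cub : Cub G
  tec : TEC G
  two_lt : 2 < order G

/-- The difference of the two sides of the main inequality. -/
noncomputable def gap (G : Graph α β) : ℚ := (rhoOrd G : ℚ) / 2 + 3 - tv G

lemma Piece.of_isoVia {G : Graph α β} (hG : Piece G) {G' : Graph α' β'} {F : α → α'} {Γ : β → β'}
    (h : IsoVia G G' F Γ) : Piece G' :=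
  ⟨hG.cub.of_isoVia h, hG.tec.of_isoVia h, h.order_eq ▸ hG.two_lt⟩

lemma Cub.gap_isoVia {G : Graph α β} (hG : Cub G) {G' : Graph α' β'} {F : α → α'} {Γ : β → β'}
    (h : IsoVia G G' F Γ) : gap G' = gap G := by
  rw [gap, gap, hG.rhoOrd_eq h, hG.tv_isoVia h]

namespace Piece

variable {G : Graph α β} {X : Set α} {x y : α}

lemma contract (hG : Piece G) (hX : IsNT G X) (hx : x ∈ X) : Piece (contract G X x) := by
  refine ⟨hG.cub.contract hX.1 hX.2.1 hx, hG.tec.contract X x, ?_⟩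
  have h1 := (Set.one_lt_ncard (hG.cub.finite.sdiff (t := X))).2 hX.2.2.2
  rw [order, contract_verts' hX.1 hx, Set.ncard_insert_of_notMem (fun h => h.2 hx)
    hG.cub.finite.sdiff]
  omega

lemma contract_compl (hG : Piece G) (hX : IsNT G X) (hy : y ∈ V(G) \ X) :
    Piece (CubicGraph.contract G (V(G) \ X) y) := hG.contract (hG.cub.isNT_compl hX) hy

lemma six_le (hG : Piece G) : 6 ≤ order G := hG.cub.six_le_order hG.tec hG.two_lt

lemma order_contract_lt (hG : Piece G) (hX : IsNT G X) (hx : x ∈ X) :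
    order (CubicGraph.contract G X x) < order G :=
  CubicGraph.order_contract_lt hG.cub.finite hX.1 hX.2.2.1 hx

lemma order_step (hG : Piece G) (hX : IsNT G X) (hx : x ∈ X) (hy : y ∈ V(G) \ X) :
    order (CubicGraph.contract G X x) + order (CubicGraph.contract G (V(G) \ X) y) =
      order G + 2 := by
  have h1 := order_contract hG.cub.finite hX.1 hx
  have h2 := order_contract hG.cub.finite Set.sdiff_subset hy
  have h3 := Set.ncard_sdiff_add_ncard_of_subset hX.1 hG.cub.finite
  rw [← order] at h3
  omega

/-- The constant 3 of `gap` occurs once on the left and twice on the right, so the correction is pq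
− p − q − 3 = (p − 1)(q − 1) − 4. For p, q ≥ 3 it is nonnegative, and it vanishes only for p = q =
3. -/
lemma gap_step (hG : Piece G) (hX : IsNT G X) (hx : x ∈ X) (hy : y ∈ V(G) \ X) :
    gap G = gap (CubicGraph.contract G X x) + gap (CubicGraph.contract G (V(G) \ X) y) +
      (((numPartners (CubicGraph.contract G X x) x : ℚ) - 1) *
        ((numPartners (CubicGraph.contract G (V(G) \ X) y) y : ℚ) - 1) - 4) := by
  have h1 := hG.cub.rho_step hX.1 hX.2.1 hx hy
  rw [← @Nat.cast_inj ℚ] at h1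
  push_cast at h1
  rw [gap, gap, gap, hG.cub.tv_step hX hx hy]
  linarith

lemma numPartners_of_leaf (hG : Piece G) (hl : ∀ X, ¬ IsNT G X) {u : α} (hu : u ∈ V(G)) :
    2 * numPartners G u = order G := hG.cub.numPartners_of_leaf hG.tec hG.two_lt hl hu

lemma tv_of_leaf (hG : Piece G) (hl : ∀ X, ¬ IsNT G X) :
    tv G = ((order G : ℚ) / 2) ^ 2 + 3 := by
  rw [hG.cub.tv_leaf hl, leafWt, if_pos hG.six_le]

lemma gap_of_leaf (hG : Piece G) (hl : ∀ X, ¬ IsNT G X) : gap G = 0 := by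
  have h1 := hG.cub.rhoOrd_of_leaf hG.tec hG.two_lt hl
  rw [← @Nat.cast_inj ℚ] at h1
  push_cast at h1
  rw [gap, hG.tv_of_leaf hl]
  linarith

/-- At a nontrivial tight cut both contractions have order at least 6, and their orders sum to n +
2. -/
lemma leaf_of_order (hG : Piece G) (ho : order G < 10) : ∀ X, ¬ IsNT G X := by
  intro X hX
  obtain ⟨x, hx⟩ := hX.2.2.1.nonempty
  obtain ⟨y, hy⟩ := hX.2.2.2.nonempty
  have h1 := hG.order_step hX hx hy
  have h2 := (hG.contract hX hx).six_le
  have h3 := (hG.contract_compl hX hy).six_le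
  omega

lemma exists_isoVia_K33 (hG : Piece G) (ho : order G = 6) : ∃ F Γ, IsoVia G K33 F Γ := by
  obtain ⟨⟨A, B, E, s, t, h⟩, hT, h2⟩ := hG
  exact h.exists_isoVia_K33 (h.noParallel hT h2) ho

lemma inJ_of_leaf (hG : Piece G) (hl : ∀ X, ¬ IsNT G X) : InJ G := by
  obtain ⟨⟨A, B, E, s, t, h⟩, hT, h2⟩ := hG
  have hs := h.noParallel hT h2
  refine ⟨{ not_isLoopAt := fun e x hl => ?_, eq_of_isLink := fun e f x y he hf => ?_ }, h.isCubic,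
    h.isMatchingCovered, ⟨_, _, h.isBipartition⟩,
    fun X hX => hl X ((Cub.isNontrivialTightCut_iff ⟨_, _, _, _, _, h⟩).1 hX)⟩
  · obtain ⟨he, h1⟩ := (h.isLink _ _ _).1 hl
    have : s e = t e := by rcases h1 with ⟨h1, h2⟩ | ⟨h1, h2⟩ <;> simp [← h1, ← h2]
    exact h.notMem_B (h.smem e he) (this ▸ h.tmem e he)
  · obtain ⟨he', h1⟩ := (h.isLink _ _ _).1 he
    obtain ⟨hf', h2⟩ := (h.isLink _ _ _).1 hf
    have k1 : s e ≠ t f := fun h3 => h.notMem_B (h.smem e he') (h3 ▸ h.tmem f hf')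
    have k2 : s f ≠ t e := fun h3 => h.notMem_B (h.smem f hf') (h3 ▸ h.tmem e he')
    rcases h1 with ⟨h1, h3⟩ | ⟨h1, h3⟩ <;> rcases h2 with ⟨h2, h4⟩ | ⟨h2, h4⟩
    · exact hs e he' f hf' (h1 ▸ h2) (h3 ▸ h4)
    · exact absurd (h1 ▸ h2) k1
    · exact absurd (h2 ▸ h1) k2
    · exact hs e he' f hf' (h3 ▸ h4) (h1 ▸ h2)

/-- In a brace each vertex has n/2 ≥ 3 partners. Otherwise take a tight cut with u in the shore X: u
already has three partners when the complement of X is shrunk, and it loses none in G, since by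
induction the contraction vertex of the other contraction has a partner. -/
lemma three_le_numPartners (hG : Piece G) : ∀ u ∈ V(G), 3 ≤ numPartners G u := by
  induction hn : order G using Nat.strong_induction_on generalizing G with
  | _ n ih =>
    subst hn
    intro u hu
    by_cases hl : ∀ X, ¬ IsNT G X
    · have := hG.numPartners_of_leaf hl hu
      have := hG.six_le
      omega
    · push Not at hl
      obtain ⟨X, hX⟩ := hl
      obtain ⟨Y, hY, huY⟩ : ∃ Y, IsNT G Y ∧ u ∈ Y := by
        by_cases huX : u ∈ X
        · exact ⟨X, hX, huX⟩
        · exact ⟨_, hG.cub.isNT_compl hX, hu, huX⟩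
      obtain ⟨y, hy⟩ := hY.2.2.2.nonempty
      have h1 := ih _ (hG.order_contract_lt hY huY) (hG.contract hY huY) rfl u
        (by rw [contract_verts' hY.1 huY]; exact Set.mem_insert _ _)
      have h2 := ih _ (hG.order_contract_lt (hG.cub.isNT_compl hY) hy) (hG.contract_compl hY hy) rfl u
        (by rw [contract_verts' Set.sdiff_subset hy, Set.sdiff_sdiff_cancel_left hY.1]
            exact Set.mem_insert_of_mem _ huY)
      exact h2.trans (hG.cub.numPartners_le hY.1 hY.2.1 huY hy (by omega) huY)

lemma partners_step (hG : Piece G) (hX : IsNT G X) (hx : x ∈ X) (hy : y ∈ V(G) \ X) :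
    3 ≤ numPartners (CubicGraph.contract G X x) x ∧
      3 ≤ numPartners (CubicGraph.contract G (V(G) \ X) y) y := by
  constructor
  · exact (hG.contract hX hx).three_le_numPartners x
      (by rw [contract_verts' hX.1 hx]; exact Set.mem_insert _ _)
  · exact (hG.contract_compl hX hy).three_le_numPartners y
      (by rw [contract_verts' Set.sdiff_subset hy]; exact Set.mem_insert _ _)

lemma gap_nonneg (hG : Piece G) : 0 ≤ gap G := by
  induction hn : order G using Nat.strong_induction_on generalizing G with
  | _ n ih =>
    subst hn
    by_cases hl : ∀ X, ¬ IsNT G X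
    · rw [hG.gap_of_leaf hl]
    · push Not at hl
      obtain ⟨X, hX⟩ := hl
      obtain ⟨x, hx⟩ := hX.2.2.1.nonempty
      obtain ⟨y, hy⟩ := hX.2.2.2.nonempty
      have h1 := ih _ (hG.order_contract_lt hX hx) (hG.contract hX hx) rfl
      have h2 := ih _ (hG.order_contract_lt (hG.cub.isNT_compl hX) hy) (hG.contract_compl hX hy) rfl
      have h3 := hG.gap_step hX hx hy
      obtain ⟨p1, p2⟩ := hG.partners_step hX hx hy
      rw [← @Nat.cast_le ℚ] at p1 p2
      push_cast at p1 p2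
      nlinarith [mul_nonneg (sub_nonneg.2 p1) (sub_nonneg.2 p2)]

/-- For a brace the difference of the two sides is (n/2 − 3)². The bound is additive because the
orders of the contractions sum to n + 2. -/
lemma le_tv (hG : Piece G) : 3 * (order G : ℚ) - 6 ≤ tv G := by
  induction hn : order G using Nat.strong_induction_on generalizing G with
  | _ n ih =>
    subst hn
    by_cases hl : ∀ X, ¬ IsNT G X
    · rw [hG.tv_of_leaf hl]
      nlinarith [sq_nonneg ((order G : ℚ) / 2 - 3)]
    · push Not at hl
      obtain ⟨X, hX⟩ := hl
      obtain ⟨x, hx⟩ := hX.2.2.1.nonempty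
      obtain ⟨y, hy⟩ := hX.2.2.2.nonempty
      have h1 := ih _ (hG.order_contract_lt hX hx) (hG.contract hX hx) rfl
      have h2 := ih _ (hG.order_contract_lt (hG.cub.isNT_compl hX) hy) (hG.contract_compl hX hy) rfl
      have h3 := hG.order_step hX hx hy
      rw [← @Nat.cast_inj ℚ] at h3
      push_cast at h3
      rw [hG.cub.tv_step hX hx hy]
      linarith

/-- All three terms of `gap_step` are nonnegative, hence all vanish, and (p − 1)(q − 1) = 4 with p,
q ≥ 3 forces equality. -/
lemma gap_eq_zero_step (hG : Piece G) (h0 : gap G = 0) (hX : IsNT G X) (hx : x ∈ X)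
    (hy : y ∈ V(G) \ X) : gap (CubicGraph.contract G X x) = 0 ∧
      numPartners (CubicGraph.contract G X x) x = 3 ∧
      numPartners (CubicGraph.contract G (V(G) \ X) y) y = 3 := by
  have h1 := (hG.contract hX hx).gap_nonneg
  have h2 := (hG.contract_compl hX hy).gap_nonneg
  have h3 := hG.gap_step hX hx hy
  obtain ⟨p1, p2⟩ := hG.partners_step hX hx hy
  have q1 := p1
  have q2 := p2
  rw [← @Nat.cast_le ℚ] at q1 q2
  push_cast at q1 q2
  have k := mul_nonneg (sub_nonneg.2 q1) (sub_nonneg.2 q2)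
  refine ⟨by nlinarith, p1.antisymm' ?_, p2.antisymm' ?_⟩
  · rw [← @Nat.cast_le ℚ]; push_cast; nlinarith
  · rw [← @Nat.cast_le ℚ]; push_cast; nlinarith

lemma inK_of_order (hG : Piece G) (ho : order G = 6) : InK G := by
  obtain ⟨F, Γ, h⟩ := hG.exists_isoVia_K33 ho
  exact .base G h.iso

/-- Contracting the complement of a minimal shore leaves no nontrivial tight cut. -/
lemma leaf_of_minimal (hG : Piece G) (hX : IsNT G X) (hy : y ∈ V(G) \ X)
    (hmin : ∀ Z, IsNT G Z → X.ncard ≤ Z.ncard) :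
    ∀ Z, ¬ IsNT (CubicGraph.contract G (V(G) \ X) y) Z := by
  have hc := (hG.contract_compl hX hy).cub
  have hv : V(CubicGraph.contract G (V(G) \ X) y) = insert y X := by
    rw [contract_verts' Set.sdiff_subset hy, Set.sdiff_sdiff_cancel_left hX.1]
  -- A cut whose shore avoids the contraction vertex is a cut of G with its shore inside X, so
  -- minimality leaves only X, whose complement there is the single vertex y. Passing to the
  -- complement covers the shores that contain y.
  have key : ∀ Z, y ∉ Z → ¬ IsNT (CubicGraph.contract G (V(G) \ X) y) Z := by
    rintro Z hyZ ⟨h1, h2, h3, h4⟩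
    rw [cut_contract, expand_of_notMem Set.sdiff_subset h1 hy hyZ] at h2
    rw [hv] at h1 h4
    have hZX : Z ⊆ X := fun v hvZ => (h1 hvZ).resolve_left fun h5 => hyZ (h5 ▸ hvZ)
    have h5 := hmin Z ⟨hZX.trans hX.1, h2, h3,
      hX.2.2.2.mono (Set.sdiff_subset_sdiff_right hZX)⟩
    have h6 : X = Z := (Set.eq_of_subset_of_ncard_le hZX h5 (hG.cub.finite.subset hX.1)).symm
    subst h6
    obtain ⟨u, hu, v, hv', huv⟩ := h4
    have e1 := hu.1.resolve_right hu.2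
    have e2 := hv'.1.resolve_right hv'.2
    exact huv (e1.trans e2.symm)
  intro Z hZ
  by_cases hyZ : y ∈ Z
  · exact key _ (fun h => h.2 hyZ) (hc.isNT_compl hZ)
  · exact key Z hyZ hZ

/-- Choose a nontrivial tight cut with a smallest shore X. Shrinking the complement of X gives a
brace in which y has n/2 = 3 partners, so it is K₃,₃, and G is a splicing of `contract G X x` with
it at the vertex x, which also has three partners. That contraction has gap 0 again; if it is a
brace, its order is 6 for the same reason. -/
lemma inK_of_gap (hG : Piece G) (h0 : gap G = 0) : (∀ X, ¬ IsNT G X) ∨ InK G := by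
  induction hn : order G using Nat.strong_induction_on generalizing G with
  | _ n ih =>
    subst hn
    by_cases hl : ∀ X, ¬ IsNT G X
    · exact Or.inl hl
    right
    push Not at hl
    obtain ⟨X, hX, hmin⟩ : ∃ X, IsNT G X ∧ ∀ Z, IsNT G Z → X.ncard ≤ Z.ncard := by
      have hne : ∃ k, ∃ X, IsNT G X ∧ X.ncard = k := ⟨_, hl.choose, hl.choose_spec, rfl⟩
      obtain ⟨X, hX, hk⟩ := Nat.find_spec hne
      exact ⟨X, hX, fun Z hZ => hk ▸ Nat.find_min' hne ⟨Z, hZ, rfl⟩⟩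
    obtain ⟨x, hx⟩ := hX.2.2.1.nonempty
    obtain ⟨y, hy⟩ := hX.2.2.2.nonempty
    obtain ⟨g1, p1, p2⟩ := hG.gap_eq_zero_step h0 hX hx hy
    have P2 := hG.contract_compl hX hy
    have P1 := hG.contract hX hx
    have o2 := P2.numPartners_of_leaf (hG.leaf_of_minimal hX hy hmin) (u := y)
      (by rw [contract_verts' Set.sdiff_subset hy]; exact Set.mem_insert _ _)
    obtain ⟨F, Γ, hF⟩ := P2.exists_isoVia_K33 (by omega)
    refine .splice G _ x (F y) ?_ p1 (isSplicing_contract hX.1 hx hy hF)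
    rcases ih _ (hG.order_contract_lt hX hx) P1 g1 rfl with h1 | h1
    · have o1 := P1.numPartners_of_leaf h1 (u := x)
        (by rw [contract_verts' hX.1 hx]; exact Set.mem_insert _ _)
      exact P1.inK_of_order (by omega)
    · exact h1

lemma inJ_or_inK_of_gap (hG : Piece G) (h0 : gap G = 0) : InJ G ∨ InK G :=
  (hG.inK_of_gap h0).imp hG.inJ_of_leaf id

/-- Equality in the second bound means (n/2 − 3)² = 0 for a brace, so only K₃,₃ remains. -/
lemma inK_of_gap_of_tv (hG : Piece G) (h0 : gap G = 0) (ht : tv G = 3 * order G - 6) : InK G := by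
  rcases hG.inK_of_gap h0 with h1 | h1
  · rw [hG.tv_of_leaf h1] at ht
    have h2 : ((order G : ℚ) / 2 - 3) ^ 2 = 0 := by linarith
    have h3 : (order G : ℚ) = 6 := by
      have := pow_eq_zero_iff (two_ne_zero) |>.1 h2
      linarith
    exact hG.inK_of_order (by exact_mod_cast h3)
  · exact h1

lemma gap_of_inJ (hG : Piece G) (hJ : InJ G) : gap G = 0 :=
  hG.gap_of_leaf fun X hX => hJ.2.2.2.2 X (hG.cub.isNontrivialTightCut_iff.2 hX)

lemma of_order_six (hG : Piece G) (ho : order G = 6) : gap G = 0 ∧ tv G = 3 * order G - 6 := by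
  have hl := hG.leaf_of_order (by omega)
  refine ⟨hG.gap_of_leaf hl, ?_⟩
  rw [hG.tv_of_leaf hl, ho]
  norm_num

end Piece

/-! ### Members of 𝓚 attain both bounds. -/

lemma Iso.not_loop {G : Graph α β} {G' : Graph α' β'} (h : Iso G G')
    (h' : ∀ e x, ¬ G'.IsLink e x x) : ∀ e x, ¬ G.IsLink e x x := by
  intro e x hl
  obtain ⟨f, g, h⟩ := h
  exact h' _ _ ((h ⟨e, hl.edge_mem⟩ ⟨x, hl.left_mem⟩ ⟨x, hl.left_mem⟩).1 hl)

lemma Iso.exists_three {G : Graph α β} {G' : Graph α' β'} (h : Iso G G')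
    (h' : ∃ f : Fin 3 → α', Function.Injective f ∧ ∀ i, f i ∈ V(G')) :
    ∃ f : Fin 3 → α, Function.Injective f ∧ ∀ i, f i ∈ V(G) := by
  obtain ⟨f, -, -⟩ := h
  obtain ⟨g, hg, hg'⟩ := h'
  refine ⟨fun i => f.symm ⟨g i, hg' i⟩, fun i j hij => hg ?_, fun i => (f.symm _).2⟩
  simpa [Subtype.ext_iff] using f.symm.injective (Subtype.ext hij)

lemma InK.not_loop {G : Graph α β} (hG : InK G) : ∀ e x, ¬ G.IsLink e x x := by
  induction hG with
  | base G h => exact h.not_loop fun _ _ => K33_not_loop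
  | splice J G v w hG hv hJ ih =>
    obtain ⟨-, -, π, -, hJ⟩ := hJ
    exact hJ.not_loop (splice_not_loop ih fun _ _ => K33_not_loop)

lemma InK.exists_three {G : Graph α β} (hG : InK G) :
    ∃ f : Fin 3 → α, Function.Injective f ∧ ∀ i, f i ∈ V(G) := by
  cases hG with
  | base G h => exact h.exists_three ⟨Sum.inl, Sum.inl_injective, fun _ => Set.mem_univ _⟩
  | splice J G v w hG hv hJ =>
    obtain ⟨-, -, π, -, hJ⟩ := hJ
    refine hJ.exists_three ?_
    rcases w with w | w
    · exact ⟨fun i => Sum.inr (Sum.inr i), Sum.inr_injective.comp Sum.inr_injective,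
        fun i => Or.inr ⟨_, ⟨Set.mem_univ _, by simp⟩, rfl⟩⟩
    · exact ⟨fun i => Sum.inr (Sum.inl i), Sum.inr_injective.comp Sum.inl_injective,
        fun i => Or.inr ⟨_, ⟨Set.mem_univ _, by simp⟩, rfl⟩⟩

/-- Ensures that the shore of the first graph in a splicing has two vertices, so that the splicing
cut is nontrivial. -/
lemma InK.nontrivial_diff {G : Graph α β} (hG : InK G) (v : α) : (V(G) \ {v}).Nontrivial := by
  obtain ⟨f, hf, hV⟩ := hG.exists_three
  have key : ∀ i j : Fin 3, i ≠ j → f i ≠ v → f j ≠ v → (V(G) \ {v}).Nontrivial :=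
    fun i j hij h1 h2 => ⟨f i, ⟨hV i, h1⟩, f j, ⟨hV j, h2⟩, hf.ne hij⟩
  by_cases h0 : f 0 = v
  · exact key 1 2 (by decide) (h0 ▸ hf.ne (by decide)) (h0 ▸ hf.ne (by decide))
  · by_cases h1 : f 1 = v
    · exact key 0 2 (by decide) h0 (h1 ▸ hf.ne (by decide))
    · exact key 0 1 (by decide) h0 h1

/-- The members of `𝓚` attain both bounds. -/
lemma InK.gap_tv {G : Graph α β} (hK : InK G) (hG : Piece G) :
    gap G = 0 ∧ tv G = 3 * order G - 6 := by
  induction hK with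
  | base G h =>
    obtain ⟨F, Γ, h⟩ := hG.cub.exists_isoVia h
    exact hG.of_order_six (by rw [← h.order_eq, order_K33])
  | splice J G v w hK hv hJ ih =>
    obtain ⟨hvG, -, π, hπ, hJ⟩ := hJ
    obtain ⟨F, Γ, h⟩ := hG.cub.exists_isoVia hJ
    have hS := hG.of_isoVia h
    rw [← hG.cub.gap_isoVia h, ← hG.cub.tv_isoVia h, ← h.order_eq]
    have hl := hK.not_loop
    have hl' : ∀ e x, ¬ K33.IsLink e x x := fun _ _ => K33_not_loop
    set S := CubicGraph.splice G v K33 w π with hSdef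
    set X : Set (α ⊕ (Fin 3 ⊕ Fin 3)) := Sum.inr '' (V(K33) \ {w}) with hXdef
    have hcard : X.ncard = 5 := by
      rw [hXdef, Set.ncard_image_of_injective _ Sum.inr_injective,
        Set.ncard_sdiff_singleton_of_mem (K33_verts ▸ Set.mem_univ w), ← order, order_K33]
    have hcompl : V(S) \ X = Sum.inl '' (V(G) \ {v}) := by
      ext p
      constructor
      · rintro ⟨h1 | h1, h2⟩
        · exact h1
        · exact absurd h1 h2
      · rintro ⟨u, hu, rfl⟩
        exact ⟨Or.inl ⟨u, hu, rfl⟩, by rintro ⟨_, -, h⟩; cases h⟩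
    have hX : IsNT S X := by
      refine ⟨Set.subset_union_right, ?_, ?_, ?_⟩
      · rw [cut_splice hl hl' hπ, deg_K33]
      · exact (Set.one_lt_ncard (Set.finite_of_ncard_pos (by omega))).1 (by omega)
      · rw [hcompl]
        exact (hK.nontrivial_diff v).image Sum.inl_injective
    obtain ⟨x', hx'⟩ : (V(K33) \ {w}).Nonempty := by
      rw [← Set.image_nonempty (f := (Sum.inr : _ → α ⊕ (Fin 3 ⊕ Fin 3)))]
      exact hX.2.2.1.nonempty
    have hx : Sum.inr x' ∈ X := ⟨x', hx', rfl⟩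
    obtain ⟨y, hy⟩ := hX.2.2.2.nonempty
    obtain ⟨e₀, -⟩ : (G.incidenceSet v).Nonempty := by
      rw [← Set.image_nonempty (f := π), hπ.image_eq]
      apply Set.nonempty_of_ncard_ne_zero
      rw [← deg, deg_K33]
      omega
    have hi := splice_contract_isoVia hl hl' hvG hπ e₀ hx'
    have P1 := hS.contract hX hx
    have P2 := hS.contract_compl hX hy
    have o1 := hS.order_step hX hx hy
    have o2 := order_contract hS.cub.finite hX.1 hx
    obtain ⟨g1, t1⟩ := ih (P1.of_isoVia hi)
    rw [P1.cub.gap_isoVia hi] at g1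
    rw [P1.cub.tv_isoVia hi, hi.order_eq] at t1
    have hp := P1.cub.numPartners_eq hi (u := Sum.inr x')
      (by rw [contract_verts' hX.1 hx]; exact Set.mem_insert _ _)
    -- The shore of K₃,₃ has five vertices, so shrinking the other side leaves order six.
    have o6 : order (contract S (V(S) \ X) y) = 6 := by omega
    obtain ⟨g2, t2⟩ := P2.of_order_six o6
    have p2 := P2.numPartners_of_leaf (P2.leaf_of_order (by omega)) (u := y)
      (by rw [contract_verts' Set.sdiff_subset hy]; exact Set.mem_insert _ _)
    have p2' : numPartners (contract S (V(S) \ X) y) y = 3 := by omega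
    have p1 : numPartners (contract S X (Sum.inr x')) (Sum.inr x') = 3 := hp.symm.trans hv
    rw [← @Nat.cast_inj ℚ] at o1
    push_cast at o1
    constructor
    · rw [hS.gap_step hX hx hy, g1, g2, p1, p2']
      norm_num
    · rw [hS.cub.tv_step hX hx hy, t1, t2]
      linarith

end Pieces

section TwoCuts

variable {α β α' β' : Type*}

/-! ### `2`-cuts -/

/-- `{e, f}` is the `2`-cut `∂(X)`, where `e` joins `x` to `y`, `f` joins `x'` to `y'`, and `x`, `x'`
belong to `X`. -/
structure IsTwoCut (G : Graph α β) (X : Set α) (e f : β) (x y x' y' : α) : Prop where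
  sub : X ⊆ V(G)
  ne : e ≠ f
  cut_eq : cut G X = {e, f}
  he : G.IsLink e x y
  hx : x ∈ X
  hy : y ∉ X
  hf : G.IsLink f x' y'
  hx' : x' ∈ X
  hy' : y' ∉ X

/-- A `2`-cut in a graph given by its colored edges. -/
structure IsRepTwoCut (E : Finset β) (s t : β → α) (X : Set α) (e f : β) : Prop where
  he : e ∈ E
  hf : f ∈ E
  only : ∀ g ∈ E, ¬ (s g ∈ X ↔ t g ∈ X) → g = e ∨ g = f
  se : s e ∈ X
  te : t e ∉ X
  sf : s f ∉ X
  tf : t f ∈ X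

lemma IsTwoCut.compl {G : Graph α β} {X : Set α} {e f : β} {x y x' y' : α}
    (h : IsTwoCut G X e f x y x' y') : IsTwoCut G (V(G) \ X) e f y x y' x' := by
  refine ⟨Set.sdiff_subset, h.ne, ?_, h.he.symm, ⟨h.he.right_mem, h.hy⟩, fun h1 => h1.2 h.hx,
    h.hf.symm, ⟨h.hf.right_mem, h.hy'⟩, fun h1 => h1.2 h.hx'⟩
  rw [← h.cut_eq]
  ext g
  constructor
  · rintro ⟨u, v, hl, hu, hv⟩
    exact ⟨v, u, hl.symm, by_contra fun h1 => hv ⟨hl.right_mem, h1⟩, hu.2⟩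
  · rintro ⟨u, v, hl, hu, hv⟩
    exact ⟨v, u, hl.symm, ⟨hl.right_mem, hv⟩, fun h1 => h1.2 hu⟩

lemma IsTwoCut.exists_rep {G : Graph α β} (hG : Cub G) {X : Set α} {e f : β} {x y x' y' : α}
    (h : IsTwoCut G X e f x y x' y') : ∃ A B E s t, Rep G A B E s t ∧ IsRepTwoCut E s t X e f ∧
      s e = x ∧ t e = y ∧ s f = y' ∧ t f = x' := by
  obtain ⟨A, B, E, s, t, hR⟩ := hG
  have key : ∀ (A B : Finset α) (s t : β → α), Rep G A B E s t → s e ∈ X →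
      IsRepTwoCut E s t X e f ∧ s e = x ∧ t e = y ∧ s f = y' ∧ t f = x' := by
    intro A B s t hR hse
    obtain ⟨he, h1⟩ := (hR.isLink _ _ _).1 h.he
    obtain ⟨hf, h2⟩ := (hR.isLink _ _ _).1 h.hf
    have h3 : x = s e ∧ y = t e := h1.resolve_right fun h3 => h.hy (h3.2 ▸ hse)
    have hte : t e ∉ X := h3.2 ▸ h.hy
    have hc := hR.cut_two (X := X) (by rw [h.cut_eq, Set.ncard_pair h.ne])
    have h4 : x' = t f ∧ y' = s f := by
      refine h2.resolve_left fun h4 => h.ne ?_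
      exact Finset.card_le_one.1 hc.1.le e (Finset.mem_filter.2 ⟨he, hse, hte⟩) f
        (Finset.mem_filter.2 ⟨hf, h4.1 ▸ h.hx', h4.2 ▸ h.hy'⟩)
    refine ⟨⟨he, hf, fun g hg hgX => ?_, hse, hte, h4.2 ▸ h.hy', h4.1 ▸ h.hx'⟩, h3.1.symm,
      h3.2.symm, h4.2.symm, h4.1.symm⟩
    have := hR.mem_cut.2 ⟨hg, hgX⟩
    rwa [h.cut_eq] at this
  obtain ⟨he, ⟨h1, h2⟩ | ⟨h1, h2⟩⟩ := (hR.isLink _ _ _).1 h.he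
  · exact ⟨A, B, E, s, t, hR, key A B s t hR (h1 ▸ h.hx)⟩
  · exact ⟨B, A, E, t, s, hR.symm, key B A t s hR.symm (h1 ▸ h.hx)⟩

namespace Rep

variable {G : Graph α β} {A B : Finset α} {E : Finset β} {s t : β → α} {X : Set α} {e f : β}

lemma twoCut_compl (h : Rep G A B E s t) (k : IsRepTwoCut E s t X e f) :
    IsRepTwoCut E t s (V(G) \ X) e f := by
  refine ⟨k.he, k.hf, fun g hg h1 => k.only g hg fun h2 => h1 ?_, ⟨h.t_mem k.he, k.te⟩,
    fun h1 => h1.2 k.se, fun h1 => h1.2 k.tf, ⟨h.s_mem k.hf, k.sf⟩⟩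
  simp only [Set.mem_sdiff, h.s_mem hg, h.t_mem hg, true_and, h2]

lemma twoCut_notMem (h : Rep G A B E s t) (k : IsRepTwoCut E s t X e f) {g : β} (hg : g ∈ E)
    (h1 : s g = s f) (h2 : g ≠ f) : t g ∉ insert (s f) X := by
  rintro (h3 | h3)
  · exact h.notMem_B (h.smem f k.hf) (h3 ▸ h.tmem g hg)
  · rcases k.only g hg fun h4 => k.sf (h1 ▸ h4.2 h3) with rfl | rfl
    · exact k.te h3
    · exact h2 rfl

/-- Moving an end of an edge of a `2`-cut to the other shore gives a tight cut. -/
lemma isOut_insert (h : Rep G A B E s t) (k : IsRepTwoCut E s t X e f) :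
    IsOut E s t (insert (s f) X) := by
  have hef : e ≠ f := fun h1 => k.te (h1 ▸ k.tf)
  have hte : t e ≠ s f := fun h1 => h.notMem_B (h.smem f k.hf) (h1 ▸ h.tmem e k.he)
  have htf := k.tf
  generalize hW : insert (s f) X = W
  have mW : ∀ v, v ∈ W ↔ v = s f ∨ v ∈ X := fun v => hW ▸ Iff.rfl
  refine ⟨fun g hg h1 => ?_, ?_⟩
  · rw [mW] at h1 ⊢
    rcases h1 with h1 | h1
    · exact absurd (h.tmem g hg) (h1 ▸ h.notMem_B (h.smem f k.hf))
    · by_cases h2 : s g ∈ X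
      · exact Or.inr h2
      · rcases k.only g hg fun h3 => h2 (h3.2 h1) with rfl | rfl
        · exact absurd k.se h2
        · exact Or.inl rfl
  · have hc : #(insert e ({g ∈ E | s g = s f}.erase f)) = 3 := by
      rw [Finset.card_insert_of_notMem, Finset.card_erase_of_mem, h.degA _ (h.smem f k.hf)]
      · simp [k.hf]
      · simp only [Finset.mem_erase, Finset.mem_filter, not_and]
        intro _ _ h1
        exact k.sf (h1 ▸ k.se)
    rw [← hc]
    congr 1
    ext g
    rw [Finset.mem_filter, Finset.mem_insert, Finset.mem_erase, Finset.mem_filter, mW, mW]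
    constructor
    · rintro ⟨hg, h1, h2⟩
      rcases h1 with h1 | h1
      · exact Or.inr ⟨fun h3 => h2 (Or.inr (by rwa [h3])), hg, h1⟩
      · rcases k.only g hg fun h3 => h2 (Or.inr (h3.1 h1)) with rfl | rfl
        · exact Or.inl rfl
        · exact absurd h1 k.sf
    · rintro (rfl | ⟨h1, h2, h3⟩)
      · exact ⟨k.he, Or.inr k.se, fun h1 => h1.elim hte k.te⟩
      · exact ⟨h2, Or.inl h3, h.twoCut_notMem k h2 h3 h1⟩

lemma insert_subset_verts (h : Rep G A B E s t) (k : IsRepTwoCut E s t X e f) (hX : X ⊆ V(G)) :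
    insert (s f) X ⊆ V(G) := Set.insert_subset (h.s_mem k.hf) hX

/-- The ends of two parallel edges form a `λ`-matchable pair. -/
lemma lam_of_parallel (h : Rep G A B E s t) {g g' : β} (hg : g ∈ E) (hg' : g' ∈ E) (hne : g ≠ g')
    (hs : s g = s g') (ht : t g = t g') : lam G (s g) (t g) = 1 := by
  refine if_pos (h.isLambdaMatchablePair_iff.2 ⟨h.s_mem hg, h.t_mem hg, ?_⟩)
  have hA := h.degA _ (h.smem g hg)
  -- Take a perfect matching through the third edge at the end `s g`. It contains neither parallel
  -- edge, and adding both raises exactly the two ends to degree 3.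
  have hex : ∃ g'' ∈ E, s g'' = s g ∧ g'' ≠ g ∧ g'' ≠ g' := by
    by_contra hcon
    push Not at hcon
    have : ({x ∈ E | s x = s g} : Finset β) ⊆ {g, g'} := by
      intro x hx
      rw [Finset.mem_filter] at hx
      rw [Finset.mem_insert, Finset.mem_singleton]
      by_contra h1
      rw [not_or] at h1
      exact h1.2 (hcon x hx.1 hx.2 h1.1)
    have := Finset.card_le_card this
    have := Finset.card_le_two (a := g) (b := g')
    omega
  obtain ⟨g'', hg'', h1, h2, h3⟩ := hex
  obtain ⟨M, hM, hf, hgM⟩ := h.exists_factor_mem hg''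
  have hu : ∀ x ∈ M, s x = s g → x = g'' := fun x hx h4 =>
    Finset.card_le_one.1 (hf.1 _ (h.smem g hg)).le x (Finset.mem_filter.2 ⟨hx, h4⟩) g''
      (Finset.mem_filter.2 ⟨hgM, h1⟩)
  have n1 : g ∉ M := fun h4 => h2 (hu g h4 rfl).symm
  have n2 : g' ∉ M := fun h4 => h3 (hu g' h4 hs.symm).symm
  have key : ∀ (r : β → α) (c : α) (v : α), r g = c → r g' = c → #{x ∈ M | r x = v} = 1 →
      #{x ∈ insert g (insert g' M) | r x = v} = if v = c then 3 else 1 := by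
    intro r c v h4 h5 h6
    by_cases h7 : v = c
    · subst h7
      rw [if_pos rfl, Finset.filter_insert, if_pos h4, Finset.filter_insert, if_pos h5,
        Finset.card_insert_of_notMem, Finset.card_insert_of_notMem, h6]
      · simp [n2]
      · simp [n1, hne]
    · rw [if_neg h7, Finset.filter_insert, if_neg (by rw [h4]; exact fun h8 => h7 h8.symm),
        Finset.filter_insert, if_neg (by rw [h5]; exact fun h8 => h7 h8.symm), h6]
  refine ⟨insert g (insert g' M), ?_, fun v hv => ?_, fun v hv => ?_⟩
  · exact Finset.insert_subset hg (Finset.insert_subset hg' hM)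
  · rw [key s (s g) v rfl hs.symm (hf.1 v hv), pairDeg]
    have : v ≠ t g := fun h4 => h.notMem_B hv (h4 ▸ h.tmem g hg)
    simp [this]
  · rw [key t (t g) v rfl ht.symm (hf.2 v hv), pairDeg]
    have : v ≠ s g := fun h4 => h.notMem_A hv (h4 ▸ h.smem g hg)
    simp [this]

/-- Pairs on one side of a `2`-cut. -/
lemma lam_twoCut (h : Rep G A B E s t) (hXV : X ⊆ V(G)) (k : IsRepTwoCut E s t X e f) {a b : α}
    (ha : a ∈ A) (hb : b ∈ B) (haX : a ∉ X) (hbX : b ∉ X) :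
    lam G a b = lam (CubicGraph.contract G (insert (s f) X) (s f)) a b := by
  have oW := h.isOut_insert k
  have hWV := h.insert_subset_verts k hXV
  have hnW := fun g hg => h.twoCut_notMem k (g := g) hg
  generalize hW : insert (s f) X = W at *
  have mW : ∀ v, v ∈ W ↔ v = s f ∨ v ∈ X := fun v => hW ▸ Iff.rfl
  have sW : s f ∈ W := (mW _).2 (Or.inl rfl)
  have hbW : b ∉ W := by
    rw [mW]
    rintro (rfl | h1)
    · exact h.notMem_B (h.smem f k.hf) hb
    · exact hbX h1
  -- The vertex s f lies in the shrunk set W, so pairs containing it cross ∂(W). When the complement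
  -- of W is shrunk, the two edges at s f other than f become parallel, so the first factor of
  -- `lam_across` is 1.
  by_cases haf : a = s f
  · subst haf
    have hte : t e ∉ W := by
      rw [mW]
      rintro (h1 | h1)
      · exact h.notMem_B (h.smem f k.hf) (h1 ▸ h.tmem e k.he)
      · exact k.te h1
    have hte' : t e ∈ V(G) \ W := ⟨h.t_mem k.he, hte⟩
    rw [h.lam_across hWV oW sW hte' ha hb sW hbW]
    have hc : 1 < #({g ∈ E | s g = s f}.erase f) := by
      rw [Finset.card_erase_of_mem, h.degA _ ha]
      · omega
      · simp [k.hf]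
    obtain ⟨g, hg, g', hg', hne⟩ := Finset.one_lt_card.1 hc
    rw [Finset.mem_erase, Finset.mem_filter] at hg hg'
    have r := h.contract_compl oW hte'
    have key : ∀ g, g ≠ f ∧ g ∈ E ∧ s g = s f →
        collapse (V(G) \ W) (t e) (t g) = t e := fun g hg =>
      collapse_of_mem ⟨h.t_mem hg.2.1, hnW g hg.2.1 hg.2.2 hg.1⟩
    have memE : ∀ g, g ≠ f ∧ g ∈ E ∧ s g = s f →
        g ∈ ({g ∈ E | s g ∈ W} : Finset β) := fun g hg =>
      Finset.mem_filter.2 ⟨hg.2.1, by rw [hg.2.2]; exact sW⟩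
    have := r.lam_of_parallel (memE g hg) (memE g' hg') hne (hg.2.2.trans hg'.2.2.symm)
      ((key g hg).trans (key g' hg').symm)
    rw [key g hg, hg.2.2] at this
    rw [this, one_mul]
  · exact h.lam_outside hWV oW sW ha hb (fun h1 => ((mW _).1 h1).elim haf haX) hbW

lemma card_twoCut (k : IsRepTwoCut E s t X e f) {M : Finset β} (hM : M ⊆ E) :
    #{g ∈ M | s g ∈ X ∧ t g ∉ X} ≤ 1 ∧ #{g ∈ M | s g ∉ X ∧ t g ∈ X} ≤ 1 := by
  constructor
  · rw [Finset.card_le_one]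
    have : ∀ g ∈ ({g ∈ M | s g ∈ X ∧ t g ∉ X} : Finset β), g = e := by
      intro g hg
      rw [Finset.mem_filter] at hg
      refine (k.only g (hM hg.1) (by tauto)).resolve_right ?_
      rintro rfl
      exact k.sf hg.2.1
    exact fun g hg g' hg' => (this g hg).trans (this g' hg').symm
  · rw [Finset.card_le_one]
    have : ∀ g ∈ ({g ∈ M | s g ∉ X ∧ t g ∈ X} : Finset β), g = f := by
      intro g hg
      rw [Finset.mem_filter] at hg
      refine (k.only g (hM hg.1) (by tauto)).resolve_left ?_
      rintro rfl
      exact hg.2.1 k.se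
    exact fun g hg g' hg' => (this g hg).trans (this g' hg').symm

/-- No pair on different sides of a `2`-cut is `λ`-matchable. -/
lemma lam_twoCut_across (h : Rep G A B E s t) (k : IsRepTwoCut E s t X e f) {a b : α}
    (ha : a ∈ A) (hb : b ∈ B) (hab : ¬ (a ∈ X ↔ b ∈ X)) : lam G a b = 0 := by
  refine if_neg fun hl => ?_
  obtain ⟨-, -, M, hM, hf⟩ := h.isLambdaMatchablePair_iff.1 hl
  have h1 := h.factor_count hM hf X
  rw [sum_pairDeg (fun h2 => h.notMem_B (Finset.mem_filter.1 h2).1 hb),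
    sum_pairDeg' (fun h2 => h.notMem_B ha (Finset.mem_filter.1 h2).1)] at h1
  -- Each color has equally many vertices in X, so a triple degree on one side only would need two
  -- more cut edges in one direction than in the other, while there is just one per direction.
  obtain ⟨h2, h3⟩ := card_twoCut k hM
  obtain ⟨h4, h5⟩ := card_twoCut k subset_rfl
  have h6 := h.excess X
  simp only [Finset.mem_filter, ha, hb, true_and] at h1
  by_cases haX : a ∈ X <;> by_cases hbX : b ∈ X
  · tauto
  · rw [if_pos haX, if_neg hbX] at h1
    omega
  · rw [if_neg haX, if_pos hbX] at h1
    omega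
  · tauto

lemma rhoOrd_side (h : Rep G A B E s t) (hXV : X ⊆ V(G)) (k : IsRepTwoCut E s t X e f) :
    rhoOrd (CubicGraph.contract G (insert (s f) X) (s f)) =
      2 * ∑ a ∈ A with a ∉ X, ∑ b ∈ B with b ∉ X, lam G a b := by
  have r := h.contract (h.insert_subset_verts k hXV) (h.isOut_insert k) (Set.mem_insert _ _)
  have hl := fun a b ha hb => h.lam_twoCut hXV k (a := a) (b := b) ha hb
  generalize hW : insert (s f) X = W at *
  have mW : ∀ v, v ∈ W ↔ v = s f ∨ v ∈ X := fun v => hW ▸ Iff.rfl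
  have e1 : insert (s f) ({v ∈ A | v ∉ W} : Finset α) = {v ∈ A | v ∉ X} := by
    ext v
    simp only [Finset.mem_insert, Finset.mem_filter, mW, not_or]
    constructor
    · rintro (rfl | h1)
      · exact ⟨h.smem f k.hf, k.sf⟩
      · exact ⟨h1.1, h1.2.2⟩
    · intro h1
      by_cases h2 : v = s f
      · exact Or.inl h2
      · exact Or.inr ⟨h1.1, h2, h1.2⟩
  have e2 : ({v ∈ B | v ∉ W} : Finset α) = {v ∈ B | v ∉ X} := by
    ext v
    simp only [Finset.mem_filter, mW, not_or]
    constructor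
    · exact fun h1 => ⟨h1.1, h1.2.2⟩
    · exact fun h1 => ⟨h1.1, fun h2 => h.notMem_B (h.smem f k.hf) (h2 ▸ h1.1), h1.2⟩
  rw [r.rhoOrd_eq, rho_eq, e1, e2]
  congr 1
  refine Finset.sum_congr rfl fun a ha => Finset.sum_congr rfl fun b hb => ?_
  rw [Finset.mem_filter] at ha hb
  exact (hl a b ha.1 hb.1 ha.2 hb.2).symm

lemma rhoOrd_twoCut (h : Rep G A B E s t) (hXV : X ⊆ V(G)) (k : IsRepTwoCut E s t X e f) :
    rhoOrd G = rhoOrd (CubicGraph.contract G (insert (t f) (V(G) \ X)) (t f)) +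
      rhoOrd (CubicGraph.contract G (insert (s f) X) (s f)) := by
  have key : ∀ Z, Z = V(G) \ X → rhoOrd (CubicGraph.contract G (insert (t f) Z) (t f)) =
      2 * ∑ a ∈ A with a ∈ X, ∑ b ∈ B with b ∈ X, lam G a b := by
    intro Z hZ
    have mZ : ∀ v ∈ V(G), v ∉ Z ↔ v ∈ X := fun v hv => by simp [hZ, hv]
    rw [h.symm.rhoOrd_side (hZ ▸ Set.sdiff_subset) (hZ ▸ h.twoCut_compl k), Finset.sum_comm]
    have e1 : ({v ∈ A | v ∉ Z} : Finset α) = {v ∈ A | v ∈ X} :=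
      Finset.filter_congr fun v hv => mZ v (h.mem_verts.2 (Or.inl hv))
    have e2 : ({v ∈ B | v ∉ Z} : Finset α) = {v ∈ B | v ∈ X} :=
      Finset.filter_congr fun v hv => mZ v (h.mem_verts.2 (Or.inr hv))
    rw [e1, e2]
    simp only [lam_comm G]
  rw [h.rhoOrd_side hXV k, key _ rfl, h.rhoOrd_eq, ← mul_add, rho_eq,
    ← Finset.sum_filter_add_sum_filter_not A (· ∈ X)]
  congr 2
  · refine Finset.sum_congr rfl fun a ha => ?_
    rw [Finset.mem_filter] at ha
    rw [← Finset.sum_filter_add_sum_filter_not B (· ∈ X),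
      Finset.sum_eq_zero (s := {b ∈ B | b ∉ X}), add_zero]
    · intro b hb
      rw [Finset.mem_filter] at hb
      exact h.lam_twoCut_across k ha.1 hb.1 (by tauto)
  · refine Finset.sum_congr rfl fun a ha => ?_
    rw [Finset.mem_filter] at ha
    rw [← Finset.sum_filter_add_sum_filter_not B (· ∈ X),
      Finset.sum_eq_zero (s := {b ∈ B | b ∈ X}), zero_add]
    intro b hb
    rw [Finset.mem_filter] at hb
    exact h.lam_twoCut_across k ha.1 hb.1 (by tauto)

end Rep

/-! ### Marked components as contractions, and additivity at 2-cuts. -/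

namespace IsTwoCut

variable {G : Graph α β} {X : Set α} {e f : β} {x y x' y' : α}

lemma ne_ends (hG : Cub G) (h : IsTwoCut G X e f x y x' y') : y ≠ y' := by
  obtain ⟨A, B, E, s, t, r, k, -, rfl, rfl, -⟩ := h.exists_rep hG
  exact fun h1 => r.notMem_B (r.smem f k.hf) (h1 ▸ r.tmem e k.he)

lemma insert_subset (h : IsTwoCut G X e f x y x' y') : insert y' X ⊆ V(G) :=
  Set.insert_subset h.hf.right_mem h.sub

lemma ncard_cut_insert (hG : Cub G) (h : IsTwoCut G X e f x y x' y') :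
    (cut G (insert y' X)).ncard = 3 := by
  obtain ⟨A, B, E, s, t, r, k, -, -, rfl, -⟩ := h.exists_rep hG
  exact r.ncard_cut_of_isOut (r.isOut_insert k)

lemma diff_insert (h : IsTwoCut G X e f x y x' y') :
    insert y' (V(G) \ insert y' X) = V(G) \ X := by
  ext v
  simp only [Set.mem_insert_iff, Set.mem_sdiff, not_or]
  by_cases hv : v = y'
  · subst hv
    simp [h.hf.right_mem, h.hy']
  · simp [hv]

lemma verts_contract (h : IsTwoCut G X e f x y x' y') :
    V(contract G (insert y' X) y') = V(G) \ X := by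
  rw [contract_verts' h.insert_subset (Set.mem_insert _ _), h.diff_insert]

/-- Marked components at `2`-cuts are contractions at tight cuts. -/
lemma addEdge_eq (hG : Cub G) (h : IsTwoCut G X e f x y x' y') :
    addEdge (G.induce (V(G) \ X)) e y y' = contract G (insert y' X) y' := by
  have hne := h.ne_ends hG
  have hyW : y ∉ insert y' X := fun h1 => h1.elim hne h.hy
  have hxW : x ∈ insert y' X := Or.inr h.hx
  have col : ∀ v, v ∉ X → collapse (insert y' X) y' v = v := by
    intro v hv
    by_cases h1 : v = y'
    · subst h1
      exact collapse_of_mem (Set.mem_insert _ _)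
    · exact collapse_of_notMem fun h2 => h2.elim h1 hv
  have only : ∀ g u v, G.IsLink g u v → u ∈ X → v ∉ X → g = e ∧ u = x ∧ v = y ∨
      g = f ∧ u = x' ∧ v = y' := by
    intro g u v hl hu hv
    have : g ∈ cut G X := ⟨u, v, hl, hu, hv⟩
    rw [h.cut_eq] at this
    rcases this with rfl | rfl
    · rcases hl.eq_and_eq_or_eq_and_eq h.he with h1 | ⟨rfl, rfl⟩
      · exact Or.inl ⟨rfl, h1⟩
      · exact absurd h.hx hv
    · rcases hl.eq_and_eq_or_eq_and_eq h.hf with h1 | ⟨rfl, rfl⟩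
      · exact Or.inr ⟨rfl, h1⟩
      · exact absurd h.hx' hv
  have eX : ∀ u v, G.IsLink e u v → u ∉ X → v ∉ X → False := by
    intro u v hl hu hv
    rcases hl.eq_and_eq_or_eq_and_eq h.he with ⟨rfl, -⟩ | ⟨-, rfl⟩
    · exact hu h.hx
    · exact hv h.hx
  refine Graph.ext ?_ ?_
  · rw [h.verts_contract]
    ext v
    constructor
    · rintro (h1 | rfl | rfl)
      · exact h1
      · exact ⟨h.he.right_mem, h.hy⟩
      · exact ⟨h.hf.right_mem, h.hy'⟩
    · exact Or.inl
  · intro g u v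
    rw [contract_isLink]
    simp only [addEdge, Graph.induce_isLink]
    constructor
    · rintro (⟨rfl, ⟨rfl, rfl⟩ | ⟨rfl, rfl⟩⟩ | ⟨hge, hl, hu, hv⟩)
      · exact ⟨u, x, h.he.symm, fun h1 => hyW h1.1, col u h.hy, collapse_of_mem hxW⟩
      · exact ⟨x, v, h.he, fun h1 => hyW h1.2, collapse_of_mem hxW, col v h.hy⟩
      · refine ⟨u, v, hl, ?_, col u hu.2, col v hv.2⟩
        rintro ⟨rfl | h1, rfl | h2⟩
        · obtain ⟨A, B, E, s, t, r⟩ := hG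
          obtain ⟨hg, h3⟩ := (r.isLink _ _ _).1 hl
          have : s g = t g := by rcases h3 with ⟨h3, h4⟩ | ⟨h3, h4⟩ <;> rw [← h3, ← h4]
          exact r.notMem_B (r.smem g hg) (this ▸ r.tmem g hg)
        · exact hv.2 h2
        · exact hu.2 h1
        · exact hu.2 h1
    · rintro ⟨p, q, hl, hpq, rfl, rfl⟩
      by_cases hp : p ∈ X <;> by_cases hq : q ∈ X
      · exact absurd ⟨Or.inr hp, Or.inr hq⟩ hpq
      · rcases only g p q hl hp hq with ⟨rfl, rfl, rfl⟩ | ⟨rfl, rfl, rfl⟩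
        · left
          rw [collapse_of_mem hxW, col q hq]
          exact ⟨rfl, Or.inr ⟨rfl, rfl⟩⟩
        · exact absurd ⟨Or.inr hp, Or.inl rfl⟩ hpq
      · rcases only g q p hl.symm hq hp with ⟨rfl, rfl, rfl⟩ | ⟨rfl, rfl, rfl⟩
        · left
          rw [collapse_of_mem hxW, col p hp]
          exact ⟨rfl, Or.inl ⟨rfl, rfl⟩⟩
        · exact absurd ⟨Or.inl rfl, Or.inr hq⟩ hpq
      · right
        rw [col p hp, col q hq]
        refine ⟨?_, hl, ⟨hl.left_mem, hp⟩, ⟨hl.right_mem, hq⟩⟩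
        rintro rfl
        exact eX p q hl hp hq

lemma addEdge_eq' (hG : Cub G) (h : IsTwoCut G X e f x y x' y') :
    addEdge (G.induce X) e x x' = contract G (insert x' (V(G) \ X)) x' := by
  have := h.compl.addEdge_eq hG
  rwa [Set.sdiff_sdiff_cancel_left h.sub] at this

lemma cub_contract (hG : Cub G) (h : IsTwoCut G X e f x y x' y') :
    Cub (contract G (insert y' X) y') :=
  hG.contract h.insert_subset (h.ncard_cut_insert hG) (Set.mem_insert _ _)

lemma order_contract (h : IsTwoCut G X e f x y x' y') :
    order (contract G (insert y' X) y') = (V(G) \ X).ncard := by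
  rw [order, h.verts_contract]

lemma order_contract' (h : IsTwoCut G X e f x y x' y') :
    order (contract G (insert x' (V(G) \ X)) x') = X.ncard := by
  rw [h.compl.order_contract, Set.sdiff_sdiff_cancel_left h.sub]

lemma order_eq (hG : Cub G) (h : IsTwoCut G X e f x y x' y') :
    order G = order (contract G (insert x' (V(G) \ X)) x') +
      order (contract G (insert y' X) y') := by
  rw [h.order_contract, h.order_contract', add_comm,
    Set.ncard_sdiff_add_ncard_of_subset h.sub hG.finite, order]

lemma rhoOrd_eq (hG : Cub G) (h : IsTwoCut G X e f x y x' y') :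
    rhoOrd G = rhoOrd (contract G (insert x' (V(G) \ X)) x') +
      rhoOrd (contract G (insert y' X) y') := by
  obtain ⟨A, B, E, s, t, r, k, -, -, rfl, rfl⟩ := h.exists_rep hG
  exact r.rhoOrd_twoCut h.sub k

lemma two_le_ncard (hG : Cub G) (h : IsTwoCut G X e f x y x' y') : 2 ≤ (V(G) \ X).ncard := by
  rw [← Set.ncard_pair (h.ne_ends hG)]
  apply Set.ncard_le_ncard _ hG.finite.sdiff
  rintro v (rfl | rfl)
  · exact ⟨h.he.right_mem, h.hy⟩
  · exact ⟨h.hf.right_mem, h.hy'⟩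

lemma isNT_insert (hG : Cub G) (h : IsTwoCut G X e f x y x' y') (h3 : 3 ≤ (V(G) \ X).ncard) :
    IsNT G (insert y' X) := by
  refine ⟨h.insert_subset, h.ncard_cut_insert hG,
    ⟨y', Set.mem_insert _ _, x, Or.inr h.hx, fun h1 => h.hy' (h1 ▸ h.hx)⟩,
    (Set.one_lt_ncard hG.finite.sdiff).1 ?_⟩
  have h1 := Set.ncard_insert_le y' (V(G) \ insert y' X)
  rw [h.diff_insert] at h1
  omega

/-- A `2`-cut with a shore of two vertices. -/
lemma tv_eq_of_small (hG : Cub G) (h : IsTwoCut G X e f x y x' y') (h2 : (V(G) \ X).ncard = 2) :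
    tv G = tv (contract G (insert x' (V(G) \ X)) x') := by
  have o1 := h.order_eq hG
  rw [h.order_contract, h2] at o1
  have o2 := h.order_contract'
  have o3 := h.compl.two_le_ncard hG
  rw [Set.sdiff_sdiff_cancel_left h.sub] at o3
  -- If the other shore also has two vertices, both orders are below 6 and all weights vanish.
  -- Otherwise moving x' across gives a nontrivial tight cut, and its second contraction has order
  -- at most four, hence weight 0.
  rcases o3.eq_or_lt with h3 | h3
  · rw [hG.tv_small (by omega), (h.compl.cub_contract hG).tv_small (by omega)]
  · have hNT := h.compl.isNT_insert hG (by rw [Set.sdiff_sdiff_cancel_left h.sub]; omega)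
    obtain ⟨w, hw⟩ := hNT.2.2.2.nonempty
    rw [hG.tv_step hNT (Set.mem_insert _ _) hw, (hG.contract_compl hNT.2.1 hw).tv_small, add_zero]
    have c1 := CubicGraph.order_contract hG.finite Set.sdiff_subset hw
    have c2 := Set.ncard_sdiff_add_ncard_of_subset hNT.1 hG.finite
    have c3 := Set.ncard_insert_le x' (V(G) \ X)
    rw [← order] at c2
    omega

/-- Use the tight cut obtained by moving y' to X. One contraction is the marked component on V(G) \
X. The other is the marked component on X with an extra 2-cut shore {y, y'}, which does not change
the weight by `tv_eq_of_small`. -/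
lemma tv_eq (hG : Cub G) (h : IsTwoCut G X e f x y x' y') :
    tv G = tv (contract G (insert x' (V(G) \ X)) x') + tv (contract G (insert y' X) y') := by
  rcases (h.two_le_ncard hG).eq_or_lt with h2 | h2
  · rw [h.tv_eq_of_small hG h2.symm, (h.cub_contract hG).tv_small, add_zero]
    rw [h.order_contract]
    omega
  · have hNT := h.isNT_insert hG h2
    have hne := h.ne_ends hG
    have hy : y ∈ V(G) \ insert y' X :=
      ⟨h.he.right_mem, fun h1 => h1.elim hne h.hy⟩
    have hc := hG.contract_compl hNT.2.1 hy
    rw [hG.tv_step hNT (Set.mem_insert _ _) hy, add_comm]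
    congr 1
    have hv : V(contract G (V(G) \ insert y' X) y) = insert y (insert y' X) := by
      rw [contract_verts' Set.sdiff_subset hy, Set.sdiff_sdiff_cancel_left hNT.1]
    have cX : ∀ v ∈ insert y' X, collapse (V(G) \ insert y' X) y v = v := fun v hv =>
      collapse_of_notMem fun h1 => h1.2 hv
    have hd : V(contract G (V(G) \ insert y' X) y) \ X = {y, y'} := by
      rw [hv]
      ext v
      simp only [Set.mem_sdiff, Set.mem_insert_iff, Set.mem_singleton_iff]
      constructor
      · rintro ⟨rfl | rfl | h1, h2⟩
        · exact Or.inl rfl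
        · exact Or.inr rfl
        · exact absurd h1 h2
      · rintro (rfl | rfl)
        · exact ⟨Or.inl rfl, h.hy⟩
        · exact ⟨Or.inr (Or.inl rfl), h.hy'⟩
    have hXsub : X ⊆ V(contract G (V(G) \ insert y' X) y) := fun v hvX => hv ▸ Or.inr (Or.inr hvX)
    have k : IsTwoCut (contract G (V(G) \ insert y' X) y) X e f x y x' y' := by
      refine ⟨hXsub, h.ne, ?_, ?_, h.hx, h.hy, ?_, h.hx', h.hy'⟩
      · rw [cut_contract, expand_of_notMem Set.sdiff_subset hXsub hy h.hy, h.cut_eq]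
      · exact contract_isLink.2 ⟨x, y, h.he, fun h1 => h1.1.2 (Or.inr h.hx), cX x (Or.inr h.hx),
          collapse_of_mem hy⟩
      · exact contract_isLink.2 ⟨x', y', h.hf, fun h1 => h1.1.2 (Or.inr h.hx'),
          cX x' (Or.inr h.hx'), cX y' (Or.inl rfl)⟩
    rw [k.tv_eq_of_small hc (by rw [hd, Set.ncard_pair hne]), hd,
      contract_contract (x := y) (Z := {x', y, y'}) (Or.inr (Or.inl rfl)), expand_of_mem Set.sdiff_subset]
    · congr 2
      ext v
      simp only [Set.mem_union, Set.mem_sdiff, Set.mem_insert_iff, Set.mem_singleton_iff, not_or]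
      constructor
      · rintro ((rfl | rfl | rfl) | h1)
        · exact Or.inl rfl
        · exact Or.inr ⟨hy.1, h.hy⟩
        · exact Or.inr ⟨h.hf.right_mem, h.hy'⟩
        · exact Or.inr ⟨h1.1, h1.2.2⟩
      · rintro (rfl | h1)
        · exact Or.inl (Or.inl rfl)
        · by_cases h2 : v = y'
          · exact Or.inl (Or.inr (Or.inr h2))
          · exact Or.inr ⟨h1.1, h2, h1.2⟩
    · rw [hv]
      rintro v (rfl | rfl | rfl)
      · exact Or.inr (Or.inr h.hx')
      · exact Or.inl rfl
      · exact Or.inr (Or.inl rfl)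
    · exact hy
    · exact Or.inr (Or.inl rfl)

end IsTwoCut

end TwoCuts

section Counting

variable {α β α' β' : Type*}

/-! ### The numbers of `3`-connected pieces -/

/-- The vertices that no cut with at most two edges separates from `u`. -/
def cluster (G : Graph α β) (u : α) : Set α :=
  {v ∈ V(G) | ∀ Y, (cut G Y).ncard ≤ 2 → (u ∈ Y ↔ v ∈ Y)}

/-- A vertex weighting whose total is `a` for each cluster of two vertices and `b` for each other
cluster. -/
noncomputable def clusterSum (a b : ℚ) (G : Graph α β) : ℚ :=
  ∑ᶠ u ∈ V(G), (if (cluster G u).ncard = 2 then a else b) / (cluster G u).ncard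

namespace IsTwoCut

variable {G : Graph α β} {X : Set α} {e f : β} {x y x' y' : α}

/-- If a set separates the ends of the new edge of a marked component, then its cut has an edge that
is not in the component. -/
lemma exists_mem_cut (hG : Cub G) (h : IsTwoCut G X e f x y x' y') {Y : Set α}
    (hY : ¬ (x ∈ Y ↔ x' ∈ Y)) : ∃ g ∈ cut G Y, ∀ u v, G.IsLink g u v → ¬ (u ∈ X ∧ v ∈ X) := by
  by_contra hcon
  push Not at hcon
  have key : ∀ g u v, G.IsLink g u v → u ∉ X → (u ∈ Y ↔ v ∈ Y) := by
    intro g u v hl hu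
    by_contra h1
    obtain ⟨p, q, hl', hp, hq⟩ := hcon g ((mem_cut_of_isLink hl Y).2 h1)
    rcases hl.eq_and_eq_or_eq_and_eq hl' with ⟨rfl, rfl⟩ | ⟨rfl, rfl⟩
    · exact hu hp
    · exact hu hq
  have k1 := key e y x h.he.symm h.hy
  have k2 := key f y' x' h.hf.symm h.hy'
  -- the side of `Y` that contains `y` but not `y'`, or conversely
  have hcut : ∀ g ∈ cut G ((V(G) \ X) ∩ Y), g = e ∨ g = f := by
    rintro g ⟨u, v, hl, ⟨⟨huV, huX⟩, huY⟩, hv⟩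
    have hvY := (key g u v hl huX).1 huY
    have hvX : v ∈ X := by_contra fun h1 => hv ⟨⟨hl.right_mem, h1⟩, hvY⟩
    have : g ∈ cut G X := ⟨v, u, hl.symm, hvX, huX⟩
    rw [h.cut_eq] at this
    exact this
  have hmem : ∀ g p q, G.IsLink g p q → p ∈ X → q ∉ X → (q ∈ Y ↔ g ∈ cut G ((V(G) \ X) ∩ Y)) := by
    intro g p q hl hp hq
    rw [mem_cut_of_isLink hl]
    have := hl.right_mem
    simp only [Set.mem_inter_iff, Set.mem_sdiff]
    tauto
  have m1 := hmem e x y h.he h.hx h.hy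
  have m2 := hmem f x' y' h.hf h.hx' h.hy'
  -- As the new edge crosses Y, exactly one of y, y' lies in Y. So the part of Y outside X would be
  -- cut off by a single edge, a bridge.
  have hle : (cut G ((V(G) \ X) ∩ Y)).ncard ≤ 1 := by
    have : Finite (cut G ((V(G) \ X) ∩ Y)) := Set.Finite.subset (Set.toFinite {e, f}) hcut
    rw [Set.ncard_le_one_iff_subsingleton]
    intro g hg g' hg'
    rcases hcut g hg with rfl | rfl <;> rcases hcut g' hg' with rfl | rfl
    · rfl
    · tauto
    · tauto
    · rfl
  obtain ⟨A, B, E, s, t, r⟩ := hG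
  have hx0 : x ∈ V(G) ∧ x ∉ (V(G) \ X) ∩ Y := ⟨h.he.left_mem, fun h1 => h1.1.2 h.hx⟩
  by_cases hy : y ∈ Y
  · have := r.two_le_cut h.he.right_mem (X := (V(G) \ X) ∩ Y) ⟨⟨h.he.right_mem, h.hy⟩, hy⟩ hx0.1 hx0.2
    omega
  · have hy' : y' ∈ Y := by tauto
    have := r.two_le_cut h.hf.right_mem (X := (V(G) \ X) ∩ Y) ⟨⟨h.hf.right_mem, h.hy'⟩, hy'⟩
      hx0.1 hx0.2
    omega

/-- The only edge of the component that is not inherited with its ends is the new one. If it crosses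
Y, then `exists_mem_cut` supplies an edge of ∂(Y) in G that the component has lost, so the size does
not grow. -/
lemma cut_component_le (hG : Cub G) (h : IsTwoCut G X e f x y x' y') (Y : Set α) :
    (cut (addEdge (G.induce X) e x x') Y).ncard ≤ (cut G Y).ncard := by
  have hfin : (cut G Y).Finite := by
    obtain ⟨A, B, E, s, t, r⟩ := hG
    exact r.cut_finite Y
  have hsub : ∀ g ∈ cut (addEdge (G.induce X) e x x') Y, (g = e ∧ ¬ (x ∈ Y ↔ x' ∈ Y)) ∨
      g ∈ cut G Y ∧ ∃ u v, G.IsLink g u v ∧ u ∈ X ∧ v ∈ X := by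
    rintro g ⟨u, v, hl | hl, hu, hv⟩
    · left
      refine ⟨hl.1, ?_⟩
      rcases hl.2 with ⟨rfl, rfl⟩ | ⟨rfl, rfl⟩ <;> tauto
    · obtain ⟨-, hl⟩ := hl
      rw [Graph.induce_isLink] at hl
      exact Or.inr ⟨⟨u, v, hl.1, hu, hv⟩, u, v, hl⟩
  by_cases hY : x ∈ Y ↔ x' ∈ Y
  · refine Set.ncard_le_ncard (fun g hg => ?_) hfin
    rcases hsub g hg with h1 | h1
    · exact absurd hY h1.2
    · exact h1.1
  · obtain ⟨g₀, hg₀, h0⟩ := h.exists_mem_cut hG hY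
    have h1 : cut (addEdge (G.induce X) e x x') Y ⊆ insert e (cut G Y \ {g₀}) := by
      intro g hg
      rcases hsub g hg with h1 | ⟨h1, u, v, hl, huv⟩
      · exact Or.inl h1.1
      · refine Or.inr ⟨h1, ?_⟩
        rintro rfl
        exact h0 u v hl huv
    refine (Set.ncard_le_ncard h1 (hfin.sdiff.insert e)).trans ((Set.ncard_insert_le _ _).trans ?_)
    exact (Set.ncard_sdiff_singleton_add_one hg₀ hfin).le

lemma verts_component (h : IsTwoCut G X e f x y x' y') :
    V(addEdge (G.induce X) e x x') = X := by
  ext v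
  constructor
  · rintro (h1 | rfl | rfl)
    · exact h1
    · exact h.hx
    · exact h.hx'
  · exact Or.inl

/-- A cluster meeting X stays in X, as ∂(X) has two edges. Small cuts of the component are cuts of G
because the component is a contraction; conversely small cuts of G induce small cuts of the
component by `cut_component_le`. -/
lemma cluster_eq (hG : Cub G) (h : IsTwoCut G X e f x y x' y') {u : α} (hu : u ∈ X) :
    cluster G u = cluster (addEdge (G.induce X) e x x') u := by
  have hcX : (cut G X).ncard ≤ 2 := by rw [h.cut_eq, Set.ncard_pair h.ne]
  ext v
  constructor
  · rintro ⟨hv, h1⟩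
    have hvX : v ∈ X := (h1 X hcX).1 hu
    refine ⟨by rw [h.verts_component]; exact hvX, fun Y hY => ?_⟩
    rw [h.addEdge_eq' hG, cut_contract] at hY
    have h2 := h1 _ hY
    have h3 : ∀ w ∈ X, w ∈ expand G (insert x' (V(G) \ X)) x' Y ↔ w ∈ Y := by
      intro w hw
      have : collapse (insert x' (V(G) \ X)) x' w = w := by
        by_cases h4 : w = x'
        · rw [h4, collapse_of_mem (Set.mem_insert _ _)]
        · exact collapse_of_notMem fun h5 => h5.elim h4 fun h6 => h6.2 hw
      simp only [expand, Set.mem_ofPred_eq, this, h.sub hw, true_and]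
    rwa [h3 u hu, h3 v hvX] at h2
  · rintro ⟨hv, h1⟩
    rw [h.verts_component] at hv
    exact ⟨h.sub hv, fun Y hY => h1 Y ((h.cut_component_le hG Y).trans hY)⟩

lemma clusterSum_eq (hG : Cub G) (h : IsTwoCut G X e f x y x' y') (a b : ℚ) :
    clusterSum a b G = clusterSum a b (addEdge (G.induce X) e x x') +
      clusterSum a b (addEdge (G.induce (V(G) \ X)) e y y') := by
  rw [clusterSum, clusterSum, clusterSum, h.verts_component, h.compl.verts_component,
    ← finsum_mem_add_sdiff h.sub hG.finite]
  congr 1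
  · exact finsum_mem_congr rfl fun u hu => by rw [h.cluster_eq hG hu]
  · exact finsum_mem_congr rfl fun u hu => by rw [h.compl.cluster_eq hG hu]

end IsTwoCut

/-- Without small cuts the whole vertex set is one cluster, and the shares of its vertices add up to
one value. -/
lemma TEC.clusterSum_eq {G : Graph α β} (hT : TEC G) (hG : Cub G) (a b : ℚ) :
    clusterSum a b G = if order G = 2 then a else b := by
  have key : ∀ u ∈ V(G), cluster G u = V(G) := by
    intro u hu
    ext v
    refine ⟨fun h => h.1, fun hv => ⟨hv, fun Y hY => ?_⟩⟩
    by_contra h1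
    have : 3 ≤ (cut G Y).ncard := by
      by_cases huY : u ∈ Y
      · exact hT Y ⟨u, hu, huY⟩ ⟨v, hv, fun h2 => h1 ⟨fun _ => h2, fun _ => huY⟩⟩
      · exact hT Y ⟨v, hv, by tauto⟩ ⟨u, hu, huY⟩
    omega
  have hpos : (order G : ℚ) ≠ 0 := by
    obtain ⟨A, B, E, s, t, r⟩ := hG
    have := r.order_pos
    positivity
  rw [clusterSum, finsum_mem_congr rfl fun u hu => by rw [key u hu], ← order,
    finsum_mem_eq_finite_toFinset_sum _ hG.finite, Finset.sum_const,
    ← Set.ncard_eq_toFinset_card _ hG.finite, ← order, nsmul_eq_mul, mul_div_cancel₀ _ hpos]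

/-! ### The `2`-cut decomposition procedure -/

lemma exists_isTwoCut {G : Graph α β} (hG : Cub G) (hK : ¬ IsKConnected 3 G) :
    ∃ X e f x y x' y', IsTwoCut G X e f x y x' y' := by
  have hT : ¬ TEC G := fun h => hK (h.isKConnected hG)
  simp only [TEC, not_forall] at hT
  obtain ⟨X, ⟨u, hu, huX⟩, ⟨v, hv, hvX⟩, h3⟩ := hT
  obtain ⟨A, B, E, s, t, r⟩ := hG
  have h2 := r.two_le_cut hu huX hv hvX
  obtain ⟨e, f, hef, hc⟩ := Set.ncard_eq_two.1 (by omega : (cut G X).ncard = 2)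
  have hX : cut G (V(G) ∩ X) = cut G X := by
    ext g
    constructor
    · rintro ⟨p, q, hl, hp, hq⟩
      exact ⟨p, q, hl, hp.2, fun h => hq ⟨hl.right_mem, h⟩⟩
    · rintro ⟨p, q, hl, hp, hq⟩
      exact ⟨p, q, hl, ⟨hl.left_mem, hp⟩, fun h => hq h.2⟩
  rw [← hX] at hc
  obtain ⟨x, y, h1⟩ : e ∈ cut G (V(G) ∩ X) := by rw [hc]; exact Or.inl rfl
  obtain ⟨x', y', h1'⟩ : f ∈ cut G (V(G) ∩ X) := by rw [hc]; exact Or.inr rfl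
  exact ⟨_, e, f, x, y, x', y', Set.inter_subset_left, hef, hc, h1.1, h1.2.1, h1.2.2, h1'.1,
    h1'.2.1, h1'.2.2⟩

namespace IsTwoCut

variable {G : Graph α β} {X : Set α} {e f : β} {x y x' y' : α}

lemma cub_component (hG : Cub G) (h : IsTwoCut G X e f x y x' y') :
    Cub (addEdge (G.induce X) e x x') := by
  rw [h.addEdge_eq' hG]
  exact h.compl.cub_contract hG

lemma order_component_lt (hG : Cub G) (h : IsTwoCut G X e f x y x' y') :
    order (addEdge (G.induce X) e x x') < order G := by
  rw [order, h.verts_component, order]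
  refine Set.ncard_lt_ncard ⟨h.sub, fun h1 => h.hy (h1 h.he.right_mem)⟩ hG.finite

end IsTwoCut

lemma Cub.exists_twoCutDecomposition {G : Graph α β} (hG : Cub G) :
    ∃ P, IsTwoCutDecomposition G P := by
  induction hn : order G using Nat.strong_induction_on generalizing G with
  | _ n ih =>
    subst hn
    by_cases hK : IsKConnected 3 G
    · exact ⟨_, .leaf G hK⟩
    · obtain ⟨X, e, f, x, y, x', y', h⟩ := exists_isTwoCut hG hK
      obtain ⟨P₁, h₁⟩ := ih _ (h.order_component_lt hG) (h.cub_component hG) rfl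
      obtain ⟨P₂, h₂⟩ := ih _ (h.compl.order_component_lt hG) (h.compl.cub_component hG) rfl
      exact ⟨_, .step G X e f x y x' y' P₁ P₂ hK h.sub h.ne h.cut_eq h.he h.hx h.hy h.hf h.hx' h.hy'
        h₁ h₂⟩

lemma twoCutDecomposition_mem {G : Graph α β} {P : Multiset (Graph α β)}
    (hP : IsTwoCutDecomposition G P) (hG : Cub G) : ∀ Q ∈ P, Cub Q ∧ TEC Q := by
  induction hP with
  | leaf G hK =>
    intro Q hQ
    rw [Multiset.mem_singleton.1 hQ]
    exact ⟨hG, .of_isKConnected hG hK⟩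
  | step G X e f x y x' y' P₁ P₂ hK hX hef hcut he hx hy hf hx' hy' h₁ h₂ ih₁ ih₂ =>
    have h : IsTwoCut G X e f x y x' y' := ⟨hX, hef, hcut, he, hx, hy, hf, hx', hy'⟩
    intro Q hQ
    rcases Multiset.mem_add.1 hQ with hQ | hQ
    · exact ih₁ (h.cub_component hG) Q hQ
    · exact ih₂ (h.compl.cub_component hG) Q hQ

/-- A function that is additive at `2`-cuts is the sum of its values at the pieces. -/
lemma twoCutDecomposition_sum {φ : Graph α β → ℚ}
    (hφ : ∀ (G : Graph α β) (X : Set α) (e f : β) (x y x' y' : α), Cub G →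
      IsTwoCut G X e f x y x' y' → φ G = φ (addEdge (G.induce X) e x x') +
        φ (addEdge (G.induce (V(G) \ X)) e y y'))
    {G : Graph α β} {P : Multiset (Graph α β)} (hP : IsTwoCutDecomposition G P) (hG : Cub G) :
    φ G = (P.map φ).sum := by
  induction hP with
  | leaf G hK => simp
  | step G X e f x y x' y' P₁ P₂ hK hX hef hcut he hx hy hf hx' hy' h₁ h₂ ih₁ ih₂ =>
    have h : IsTwoCut G X e f x y x' y' := ⟨hX, hef, hcut, he, hx, hy, hf, hx', hy'⟩
    rw [hφ G X e f x y x' y' hG h, ih₁ (h.cub_component hG), ih₂ (h.compl.cub_component hG),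
      Multiset.map_add, Multiset.sum_add]

/-! ### The graph `Θ` -/

lemma Rep.exists_singleton {G : Graph α β} {A B : Finset α} {E : Finset β} {s t : β → α}
    (h : Rep G A B E s t) (ho : order G = 2) : ∃ a b, A = {a} ∧ B = {b} ∧ a ≠ b ∧ #E = 3 ∧
      ∀ e ∈ E, s e = a ∧ t e = b := by
  have hA : #A = 1 := by rw [h.order_eq] at ho; omega
  obtain ⟨a, rfl⟩ := Finset.card_eq_one.1 hA
  obtain ⟨b, rfl⟩ := Finset.card_eq_one.1 (h.card_eq.symm.trans hA)
  have hs : ∀ e ∈ E, s e = a := fun e he => Finset.mem_singleton.1 (h.smem e he)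
  refine ⟨a, b, rfl, rfl, ?_, ?_, fun e he => ⟨hs e he, Finset.mem_singleton.1 (h.tmem e he)⟩⟩
  · rintro rfl
    exact h.notMem_B (Finset.mem_singleton_self a) (Finset.mem_singleton_self a)
  · rw [← h.degA a (Finset.mem_singleton_self a), Finset.filter_true_of_mem hs]

/-- One vertex of each color and degree 3 leave only three parallel edges. -/
lemma Cub.iso_theta_iff {G : Graph α β} (hG : Cub G) : Iso G Theta ↔ order G = 2 := by
  constructor
  · intro h
    obtain ⟨F, Γ, h⟩ := hG.exists_isoVia h
    rw [← h.order_eq, order, show V(Theta) = {false, true} from rfl, Set.ncard_pair (by decide)]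
  · intro ho
    obtain ⟨A, B, E, s, t, h⟩ := hG
    obtain ⟨a, b, rfl, rfl, hab, hE, hst⟩ := h.exists_singleton ho
    have hV : ∀ v, v ∈ V(G) ↔ v = a ∨ v = b := fun v => by rw [h.mem_verts]; simp
    let g : E ≃ Fin 3 := E.equivFinOfCardEq hE
    have hg : ∀ e (he : e ∈ E), (if he : e ∈ E then g ⟨e, he⟩ else 0) = g ⟨e, he⟩ :=
      fun e he => dif_pos he
    refine IsoVia.iso (F := fun v => if v = a then false else true)
      (Γ := fun e => if he : e ∈ E then g ⟨e, he⟩ else 0) ⟨?_, ?_, ?_, ?_, ?_⟩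
    · intro u hu v hv huv
      rw [hV] at hu hv
      dsimp only at huv
      rcases hu with rfl | rfl <;> rcases hv with rfl | rfl
      · rfl
      · rw [if_pos rfl, if_neg hab.symm] at huv; cases huv
      · rw [if_pos rfl, if_neg hab.symm] at huv; cases huv
      · rfl
    · rw [show V(Theta) = {false, true} from rfl]
      ext c
      constructor
      · rintro ⟨v, -, rfl⟩
        dsimp only
        split_ifs <;> simp
      · rintro (rfl | rfl)
        · exact ⟨a, (hV a).2 (Or.inl rfl), if_pos rfl⟩
        · exact ⟨b, (hV b).2 (Or.inr rfl), if_neg hab.symm⟩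
    · intro e he e' he' hee
      rw [h.mem_edgeSet] at he he'
      dsimp only at hee
      rw [hg e he, hg e' he', g.apply_eq_iff_eq, Subtype.mk.injEq] at hee
      exact hee
    · rw [show E(Theta) = Set.univ from rfl, Set.eq_univ_iff_forall]
      intro i
      refine ⟨g.symm i, h.mem_edgeSet.2 (g.symm i).2, ?_⟩
      dsimp only
      rw [hg _ (g.symm i).2]
      simp
    · intro e x y hl
      obtain ⟨he, h1⟩ := (h.isLink _ _ _).1 hl
      obtain ⟨h2, h3⟩ := hst e he
      rw [h2, h3] at h1
      rcases h1 with ⟨rfl, rfl⟩ | ⟨rfl, rfl⟩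
      · simp [Theta, hab.symm]
      · simp [Theta, hab.symm]

lemma Cub.rhoOrd_of_order_two {G : Graph α β} (hG : Cub G) (ho : order G = 2) : rhoOrd G = 2 := by
  obtain ⟨A, B, E, s, t, h⟩ := hG
  obtain ⟨a, b, rfl, rfl, hab, hE, hst⟩ := h.exists_singleton ho
  obtain ⟨e, he, e', he', hne⟩ := Finset.one_lt_card.1 (by omega : 1 < #E)
  have := h.lam_of_parallel he he' hne ((hst e he).1.trans (hst e' he').1.symm)
    ((hst e he).2.trans (hst e' he').2.symm)
  rw [(hst e he).1, (hst e he).2] at this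
  rw [h.rhoOrd_eq, Rep.rho_eq, Finset.sum_singleton, Finset.sum_singleton, this]

/-! ### Sums over the pieces -/

section Sums

variable {H : Graph α β} {P : Multiset (Graph α β)}

/-- The left side does not mention P, so θ and θ̄ do not depend on the decomposition. This matters
because 𝓛 and 𝓚' only ask for some decomposition with good pieces. -/
lemma clusterSum_eq_theta (hP : IsTwoCutDecomposition H P) (hH : Cub H) (a b : ℚ) :
    clusterSum a b H = a * theta P + b * thetaBar P := by
  rw [twoCutDecomposition_sum (φ := clusterSum a b)
    (fun G X e f x y x' y' hG h => h.clusterSum_eq hG a b) hP hH]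
  have hmem := twoCutDecomposition_mem hP hH
  clear hP
  induction P using Multiset.induction_on with
  | empty => simp [theta, thetaBar]
  | cons Q P ih =>
    have hQ := hmem Q (Multiset.mem_cons_self _ _)
    have ih := ih fun K hK => hmem K (Multiset.mem_cons_of_mem hK)
    rw [Multiset.map_cons, Multiset.sum_cons, ih, hQ.2.clusterSum_eq hQ.1]
    simp only [theta, thetaBar, Multiset.countP_cons, hQ.1.iso_theta_iff]
    split_ifs <;> push_cast <;> ring

/-- The contribution of a piece to the difference of the two sides of the first inequality. -/
noncomputable def pieceGap (Q : Graph α β) : ℚ :=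
  -- `clusterSum 1 (-3)` stands for θ − 3θ̄.
  (rhoOrd Q : ℚ) / 2 - tv Q - clusterSum 1 (-3) Q

/-- The contribution of a piece to the difference of the two sides of the second inequality. -/
noncomputable def pieceGap' (Q : Graph α β) : ℚ :=
  -- `clusterSum 5 9` stands for the terms 5θ + 9θ̄, moved to the left side.
  tv Q + clusterSum 1 (-3) Q - 3 * order Q + clusterSum 5 9 Q

lemma pieceGap_eq_sum (hP : IsTwoCutDecomposition H P) (hH : Cub H) :
    pieceGap H = (P.map pieceGap).sum := by
  refine twoCutDecomposition_sum (fun G X e f x y x' y' hG h => ?_) hP hH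
  rw [pieceGap, pieceGap, pieceGap, h.clusterSum_eq hG, h.addEdge_eq hG, h.addEdge_eq' hG,
    h.rhoOrd_eq hG, h.tv_eq hG]
  push_cast
  ring

lemma pieceGap'_eq_sum (hP : IsTwoCutDecomposition H P) (hH : Cub H) :
    pieceGap' H = (P.map pieceGap').sum := by
  refine twoCutDecomposition_sum (fun G X e f x y x' y' hG h => ?_) hP hH
  rw [pieceGap', pieceGap', pieceGap', h.clusterSum_eq hG, h.clusterSum_eq hG, h.addEdge_eq hG,
    h.addEdge_eq' hG, h.order_eq hG, h.tv_eq hG]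
  push_cast
  ring

lemma order_two_or_piece {Q : Graph α β} (hQ : Cub Q ∧ TEC Q) : order Q = 2 ∨ Piece Q := by
  obtain ⟨A, B, E, s, t, h⟩ := hQ.1
  rcases h.order_pos.eq_or_lt with h1 | h1
  · exact Or.inl h1.symm
  · exact Or.inr ⟨hQ.1, hQ.2, h1⟩

/-- For Θ one has ρ = 1, weight 0, θ = 1 and θ̄ = 0, so the slacks are 1 − 0 − 1 and 0 + 1 − 6 + 5.
-/
lemma pieceGap_of_order_two {Q : Graph α β} (hQ : Cub Q ∧ TEC Q) (ho : order Q = 2) :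
    pieceGap Q = 0 ∧ pieceGap' Q = 0 := by
  rw [pieceGap, pieceGap', hQ.2.clusterSum_eq hQ.1, hQ.2.clusterSum_eq hQ.1, if_pos ho, if_pos ho,
    hQ.1.tv_small (by omega), hQ.1.rhoOrd_of_order_two ho, ho]
  norm_num

lemma Piece.pieceGap_eq {Q : Graph α β} (hQ : Piece Q) :
    pieceGap Q = gap Q ∧ pieceGap' Q = tv Q - (3 * order Q - 6) := by
  have ho := hQ.two_lt.ne'
  rw [pieceGap, pieceGap', hQ.tec.clusterSum_eq hQ.cub, hQ.tec.clusterSum_eq hQ.cub, if_neg ho,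
    if_neg ho, gap]
  constructor <;> ring

lemma pieceGap_nonneg {Q : Graph α β} (hQ : Cub Q ∧ TEC Q) : 0 ≤ pieceGap Q := by
  rcases order_two_or_piece hQ with h | h
  · rw [(pieceGap_of_order_two hQ h).1]
  · rw [h.pieceGap_eq.1]
    exact h.gap_nonneg

lemma pieceGap'_nonneg {Q : Graph α β} (hQ : Cub Q ∧ TEC Q) : 0 ≤ pieceGap' Q := by
  rcases order_two_or_piece hQ with h | h
  · rw [(pieceGap_of_order_two hQ h).2]
  · rw [h.pieceGap_eq.2]
    linarith [h.le_tv]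

lemma sum_map_nonneg {φ : Graph α β → ℚ} (h : ∀ Q ∈ P, 0 ≤ φ Q) : 0 ≤ (P.map φ).sum := by
  refine Multiset.sum_nonneg fun q hq => ?_
  obtain ⟨Q, hQ, rfl⟩ := Multiset.mem_map.1 hq
  exact h Q hQ

lemma sum_map_eq_zero {φ : Graph α β → ℚ} (h : ∀ Q ∈ P, 0 ≤ φ Q) (h0 : (P.map φ).sum = 0) :
    ∀ Q ∈ P, φ Q = 0 := by
  intro Q hQ
  obtain ⟨P', rfl⟩ := Multiset.exists_cons_of_mem hQ
  rw [Multiset.map_cons, Multiset.sum_cons] at h0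
  have h1 := sum_map_nonneg (P := P') fun K hK => h K (Multiset.mem_cons_of_mem hK)
  have h2 := h Q hQ
  linarith

lemma sum_map_of_eq_zero {φ : Graph α β → ℚ} (h : ∀ Q ∈ P, φ Q = 0) : (P.map φ).sum = 0 := by
  rw [Multiset.map_congr rfl h]
  simp

lemma Cub.pieceGap_nonneg (hH : Cub H) : 0 ≤ pieceGap H ∧ 0 ≤ pieceGap' H := by
  obtain ⟨P, hP⟩ := hH.exists_twoCutDecomposition
  have hmem := twoCutDecomposition_mem hP hH
  rw [pieceGap_eq_sum hP hH, pieceGap'_eq_sum hP hH]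
  exact ⟨sum_map_nonneg fun Q hQ => CubicGraph.pieceGap_nonneg (hmem Q hQ),
    sum_map_nonneg fun Q hQ => pieceGap'_nonneg (hmem Q hQ)⟩

/-- A sum of nonnegative contributions vanishes exactly when each piece contributes 0. Since the
slack is an invariant of H, any decomposition may be used in either direction. -/
lemma Cub.inL_iff (hH : Cub H) (hp : V(H).Finite ∧ IsConnected H ∧ IsBipartite H ∧ IsCubic H) :
    pieceGap H = 0 ↔ InL H := by
  constructor
  · intro h0
    obtain ⟨P, hP⟩ := hH.exists_twoCutDecomposition
    have hmem := twoCutDecomposition_mem hP hH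
    rw [pieceGap_eq_sum hP hH] at h0
    refine ⟨hp.1, hp.2.1, hp.2.2.1, hp.2.2.2, P, hP, fun Q hQ => ?_⟩
    have h1 := sum_map_eq_zero (fun Q hQ => CubicGraph.pieceGap_nonneg (hmem Q hQ)) h0 Q hQ
    rcases order_two_or_piece (hmem Q hQ) with h | h
    · exact Or.inr (Or.inr ((hmem Q hQ).1.iso_theta_iff.2 h))
    · rw [h.pieceGap_eq.1] at h1
      rcases h.inJ_or_inK_of_gap h1 with h2 | h2
      · exact Or.inl h2
      · exact Or.inr (Or.inl h2)
  · rintro ⟨-, -, -, -, P, hP, hall⟩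
    have hmem := twoCutDecomposition_mem hP hH
    rw [pieceGap_eq_sum hP hH]
    refine sum_map_of_eq_zero fun Q hQ => ?_
    rcases order_two_or_piece (hmem Q hQ) with h | h
    · exact (pieceGap_of_order_two (hmem Q hQ) h).1
    · rw [h.pieceGap_eq.1]
      rcases hall Q hQ with h1 | h1 | h1
      · exact h.gap_of_inJ h1
      · exact (h1.gap_tv h).1
      · exact absurd ((hmem Q hQ).1.iso_theta_iff.1 h1) h.two_lt.ne'

lemma Cub.inKPrime_iff (hH : Cub H)
    (hp : V(H).Finite ∧ IsConnected H ∧ IsBipartite H ∧ IsCubic H) :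
    pieceGap H = 0 ∧ pieceGap' H = 0 ↔ InKPrime H := by
  constructor
  · rintro ⟨h0, h0'⟩
    obtain ⟨P, hP⟩ := hH.exists_twoCutDecomposition
    have hmem := twoCutDecomposition_mem hP hH
    rw [pieceGap_eq_sum hP hH] at h0
    rw [pieceGap'_eq_sum hP hH] at h0'
    refine ⟨hp.1, hp.2.1, hp.2.2.1, hp.2.2.2, P, hP, fun Q hQ => ?_⟩
    have h1 := sum_map_eq_zero (fun Q hQ => CubicGraph.pieceGap_nonneg (hmem Q hQ)) h0 Q hQ
    have h2 := sum_map_eq_zero (fun Q hQ => pieceGap'_nonneg (hmem Q hQ)) h0' Q hQ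
    rcases order_two_or_piece (hmem Q hQ) with h | h
    · exact Or.inr ((hmem Q hQ).1.iso_theta_iff.2 h)
    · rw [h.pieceGap_eq.1] at h1
      rw [h.pieceGap_eq.2] at h2
      exact Or.inl (h.inK_of_gap_of_tv h1 (by linarith))
  · rintro ⟨-, -, -, -, P, hP, hall⟩
    have hmem := twoCutDecomposition_mem hP hH
    have key : ∀ Q ∈ P, pieceGap Q = 0 ∧ pieceGap' Q = 0 := by
      intro Q hQ
      rcases order_two_or_piece (hmem Q hQ) with h | h
      · exact pieceGap_of_order_two (hmem Q hQ) h
      · rw [h.pieceGap_eq.1, h.pieceGap_eq.2]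
        rcases hall Q hQ with h1 | h1
        · obtain ⟨h2, h3⟩ := h1.gap_tv h
          exact ⟨h2, by rw [h3]; ring⟩
        · exact absurd ((hmem Q hQ).1.iso_theta_iff.1 h1) h.two_lt.ne'
    rw [pieceGap_eq_sum hP hH, pieceGap'_eq_sum hP hH]
    exact ⟨sum_map_of_eq_zero fun Q hQ => (key Q hQ).1, sum_map_of_eq_zero fun Q hQ => (key Q hQ).2⟩

end Sums

end Counting

end CubicGraph

/-! ### The theorem, from the two slacks of H. -/

theorem mainTheorem4 {α β : Type*} (H : Graph α β) (A B : Set α)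
    (hfin : V(H).Finite) (hconn : IsConnected H) (hcubic : IsCubic H)
    (hbip : IsBipartition H A B) :
    (∃ L, IsTightCutDecomposition H L) ∧ (∃ P, IsTwoCutDecomposition H P) ∧
    ∀ L P : Multiset (Graph α β), IsTightCutDecomposition H L → IsTwoCutDecomposition H P →
      (rho H A B : ℚ) ≥ bTilde L + 3 * bPrime L - 3 * thetaBar P + theta P ∧
      bTilde L + 3 * bPrime L - 3 * thetaBar P + theta P
        ≥ 3 * (order H : ℚ) - 9 * thetaBar P - 5 * theta P ∧
      ((rho H A B : ℚ) = bTilde L + 3 * bPrime L - 3 * thetaBar P + theta P ↔ InL H) ∧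
      (((rho H A B : ℚ) = bTilde L + 3 * bPrime L - 3 * thetaBar P + theta P ∧
        bTilde L + 3 * bPrime L - 3 * thetaBar P + theta P
          = 3 * (order H : ℚ) - 9 * thetaBar P - 5 * theta P) ↔ InKPrime H) := by
  have hp : V(H).Finite ∧ IsConnected H ∧ IsBipartite H ∧ IsCubic H :=
    ⟨hfin, hconn, ⟨A, B, hbip⟩, hcubic⟩
  obtain ⟨A', B', E, s, t, rfl, rfl, h⟩ := exists_rep hfin hconn hcubic hbip
  have hH : Cub H := ⟨_, _, _, _, _, h⟩
  refine ⟨hH.exists_tightCutDecomposition, hH.exists_twoCutDecomposition, fun L P hL hP => ?_⟩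
  have h1 := hH.pieceGap_nonneg
  have h2 := hH.inL_iff hp
  have h3 := hH.inKPrime_iff hp
  have h4 := bTilde_add_bPrime hL hH
  have h5 := clusterSum_eq_theta hP hH 1 (-3)
  have h6 := clusterSum_eq_theta hP hH 5 9
  -- For the given L and P, rewrite the intrinsic slacks in terms of b̃, b', θ and θ̄; the rest is
  -- linear arithmetic.
  simp only [pieceGap, pieceGap', h5, h6, h.rhoOrd_eq, ← h4] at h1 h2 h3
  push_cast at h1 h2 h3
  refine ⟨by linarith [h1.1], by linarith [h1.2], ?_, ?_⟩
  · rw [← h2]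
    constructor <;> intro h7 <;> linarith
  · rw [← h3]
    constructor <;> rintro ⟨h7, h8⟩ <;> constructor <;> linarith
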